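/- A Boolean algebra here is a relatively complemented distributive lattice $(\mathcal B,\cup,\cap,\setminus,\emptyset)$ with least element $\emptyset$ (a greatest element is not required). A Boolean dynamical system $(\mathcal B,\mathcal L,\theta)$ consists of a Boolean algebra $\mathcal B$, a set $\mathcal L$ and Boolean homomorphisms $\theta_a:\mathcal B\to\mathcal B$ ($a\in\mathcal L$) with $\theta_a(\emptyset)=\emptyset$ such that, for every nonempty word $\alpha=a_1\cdots a_n$ in $\mathcal L$, with $\theta_\alpha=\theta_{a_n}\circ\cdots\circ\theta_{a_1}$, the set $\{\theta_\alpha(A):A\in\mathcal B\}$ has a least upper bound $\mathcal R_\alpha$ and $\mathcal R_\alpha=\theta_\alpha(\mathcal D_\alpha)$ for some $\mathcal D_\alpha\in\mathcal B$. For the empty word put $\theta_\emptyset=\mathrm{id}$, and read $A\subseteq\mathcal R_\emptyset$ as true for all $A\in\mathcal B$. Let $\Delta_A=\{a\in\mathcal L:\theta_a(A)\neq\emptyset\}$; the set $A$ is regular if $0<|\Delta_B|<\infty$ for every $\emptyset\ne B\subseteq A$ (so $\emptyset$ is regular). The Cuntz–Krieger relations for families $p_A$ ($A\in\mathcal B$),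 $s_a$, $s_a^*$ ($a\in\mathcal L$) are: $p_\emptyset=0$, $p_{A\cap B}=p_Ap_B$, $p_{A\cup B}=p_A+p_B-p_{A\cap B}$; $s_as_a^*s_a=s_a$ and $s_a^*s_as_a^*=s_a^*$; $p_As_a=s_ap_{\theta_a(A)}$ and $s_a^*p_A=p_{\theta_a(A)}s_a^*$; $s_a^*s_b=\delta_{a,b}\,p_{\mathcal R_a}$; and $p_A=\sum_{a\in\Delta_A}s_ap_{\theta_a(A)}s_a^*$ for every regular $A$. Let $C^*(\mathcal B,\mathcal L,\theta)$ be the C*-algebra generated by a universal Cuntz–Krieger representation (the $p_A$ being projections and $s_a^*$ the adjoint of $s_a$), write $s_\alpha=s_{a_1}\cdots s_{a_n}$, and let $$T=\{s_\alpha p_As_\beta^*:\alpha,\beta\in\mathcal L^*,\ A\in\mathcal B,\ A\subseteq\mathcal R_\alpha\cap\mathcal R_\beta\}\cup\{0\}\subseteq C^*(\mathcal B,\mathcal L,\theta),$$ where $\mathcal L^*$ is the set of all finite words; $T$ is an inverse semigroup with zero. Let $\mathcal G_{tight}(T)$ be its tight groupoid, i.e. the topological groupoid of germs $[t,\xi]$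 of the action of $T$ on the space of tight filters of its semilattice of idempotents; for an idempotent $e$ let $\operatorname{Dom}(e)$ be the set of the tight filters that contain $e$, and let $\Theta(t,\operatorname{Dom}(t^*t))=\{[t,\xi]:\xi\in\operatorname{Dom}(t^*t)\}$. Let $R$ be a commutative ring with unit. The Steinberg algebra $A_R(\mathcal G_{tight}(T))$ is the set of the locally constant, compactly supported functions $\mathcal G_{tight}(T)\to R$, with the convolution product $(fg)(\gamma)=\sum_{\gamma_1\gamma_2=\gamma}f(\gamma_1)g(\gamma_2)$. Finally let $R(\mathcal B,\mathcal L,\theta)$ be the (not necessarily unital) $R$-algebra with generators $p_A$, $s_a$, $s_a^*$ ($A\in\mathcal B$, $a\in\mathcal L$) and the Cuntz–Krieger relations. **Theorem 7.1.** For every Boolean dynamical system $(\mathcal B,\mathcal L,\theta)$ and every commutative ring $R$ with unit, $A_R(\mathcal G_{tight}(T))$ is closed under convolution, the characteristic functions below belong to it, and there is a unique isomorphism of $R$-algebras $$\tau:A_R(\mathcal G_{tight}(T))\to R(\mathcal B,\mathcal L,\theta)$$ such that, for all $a\in\mathcal L$ and $A\in\mathcal B$, $$\tau\big(1_{\Theta(s_a,\operatorname{Dom}(s_a^*s_a))}\big)=s_a,\qquad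 \tau\big(1_{\Theta(s_a^*,\operatorname{Dom}(s_as_a^*))}\big)=s_a^*,\qquad \tau\big(1_{\Theta(p_A,\operatorname{Dom}(p_A))}\big)=p_A.$$ -/

import Mathlib

open scoped ENNReal

universe u v w

/-! ## Boolean dynamical systems -/

/-- A Boolean dynamical system `(B, L, θ)`. A Boolean algebra here is a relatively complemented
distributive lattice with a least element; it need not have a greatest one. Every `θ a` is a
Boolean homomorphism (relative complements are then preserved, see `map_sdiff`), and for each
nonempty word `α = a₁ ⋯ aₙ` the composite `θ_α = θ_{aₙ} ∘ ⋯ ∘ θ_{a₁}` has compact range and closed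
domain: the least upper bound of `{θ_α(A) : A ∈ B}` exists and is itself of the form `θ_α(D)`. -/
structure BooleanDynamicalSystem (B : Type u) (L : Type v) [GeneralizedBooleanAlgebra B] where
  θ : L → B → B
  map_bot : ∀ a, θ a ⊥ = ⊥
  map_sup : ∀ a X Y, θ a (X ⊔ Y) = θ a X ⊔ θ a Y
  map_inf : ∀ a X Y, θ a (X ⊓ Y) = θ a X ⊓ θ a Y
  exists_domain : ∀ α : List L, α ≠ [] → ∃ E : B,
    IsLUB (Set.range fun X => α.foldl (fun Y a => θ a Y) X) (α.foldl (fun Y a => θ a Y) E)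

namespace BooleanDynamicalSystem

variable {B : Type u} {L : Type v} [GeneralizedBooleanAlgebra B] (D : BooleanDynamicalSystem B L)

theorem map_sdiff (a : L) (X Y : B) : D.θ a (X \ Y) = D.θ a X \ D.θ a Y := by
  refine (sdiff_unique ?_ ?_).symm
  · rw [← D.map_inf, ← D.map_sup, sup_inf_sdiff]
  · rw [← D.map_inf, ← D.map_inf, inf_inf_sdiff, D.map_bot]

/-- The action `θ_α` of a word `α`, with `θ_∅ = id`. -/
def act (α : List L) (X : B) : B := α.foldl (fun Y a => D.θ a Y) X

open Classical in
/-- `R_α`, the least upper bound of `{θ_α(A) : A ∈ B}`, for a nonempty word `α`.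
(The value at the empty word is irrelevant and never used.) -/
noncomputable def rng (α : List L) : B :=
  if h : α ≠ [] then D.act α (D.exists_domain α h).choose else ⊥

theorem isLUB_rng {α : List L} (h : α ≠ []) : IsLUB (Set.range (D.act α)) (D.rng α) := by
  have := (D.exists_domain α h).choose_spec
  rw [rng, dif_pos h]
  exact this

/-- The relation `A ⊆ R_α`. For the empty word it holds for all `A`, according to the convention
that `R_∅` is the formal union of all elements of `B`. -/
def Below (α : List L) (X : B) : Prop := α ≠ [] → X ≤ D.rng α

/-- `Δ_A`, the set of all letters `a` with `θ_a(A) ≠ ∅`. -/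
def letters (X : B) : Set L := {a | D.θ a X ≠ ⊥}

/-- Regular sets: `0 < |Δ_Y| < ∞` for every nonempty `Y ⊆ X`. The empty set is regular. -/
def IsRegular (X : B) : Prop :=
  ∀ Y, Y ≠ ⊥ → Y ≤ X → (D.letters Y).Nonempty ∧ (D.letters Y).Finite

/-! ### Cuntz-Krieger families -/

/-- The Cuntz-Krieger relations of a Boolean dynamical system for families `P_A`, `S_a`, and `Sd_a`
(playing the part of `S_a^*`) in a ring that need not have a unit. Since no involution is assumed,
the adjoints of those relations that are not self-adjoint are listed too; in a `*`-algebra, with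
`Sd_a = S_a^*` and `P_A^* = P_A`, they are redundant. -/
structure IsCKFamily {A : Type*} [NonUnitalRing A] (P : B → A) (S Sd : L → A) : Prop where
  bot : P ⊥ = 0
  inf : ∀ X Y, P (X ⊓ Y) = P X * P Y
  sup : ∀ X Y, P (X ⊔ Y) = P X + P Y - P (X ⊓ Y)
  isometry_left : ∀ a, S a * Sd a * S a = S a
  isometry_right : ∀ a, Sd a * S a * Sd a = Sd a
  comm_left : ∀ a X, P X * S a = S a * P (D.θ a X)
  comm_right : ∀ a X, Sd a * P X = P (D.θ a X) * Sd a
  source : ∀ a, Sd a * S a = P (D.rng [a])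
  orthogonal : ∀ a b, a ≠ b → Sd a * S b = 0
  regular : ∀ X, D.IsRegular X → ∀ F : Finset L, (F : Set L) = D.letters X →
    P X = ∑ a ∈ F, S a * P (D.θ a X) * Sd a

/-- A Cuntz-Krieger representation in a C*-algebra: a family of projections `P_A` and partial
isometries `S_a` that satisfy the Cuntz-Krieger relations. -/
structure IsCKRepresentation {A : Type*} [NonUnitalCStarAlgebra A] (P : B → A) (S : L → A) :
    Prop where
  projection : ∀ X, IsStarProjection (P X)
  family : D.IsCKFamily P S (fun a => star (S a))

/-- `S_α x = S_{a₁} ⋯ S_{aₙ} x` for a word `α = a₁ ⋯ aₙ`. -/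
def word {A : Type*} [Mul A] (S : L → A) (α : List L) (x : A) : A :=
  α.foldr (fun a y => S a * y) x

/-- `x S_β^* = x S_{bₙ}^* ⋯ S_{b₁}^*` for a word `β = b₁ ⋯ bₙ`, where `Sd b` stands for `S_b^*`. -/
def wordStar {A : Type*} [Mul A] (Sd : L → A) (β : List L) (x : A) : A :=
  β.foldr (fun b y => y * Sd b) x

/-- The element `S_α P_X S_β^*`. -/
def monomial {A : Type*} [Mul A] (P : B → A) (S Sd : L → A) (α : List L) (X : B) (β : List L) : A :=
  word S α (wordStar Sd β (P X))

/-- The set `{S_α P_X S_β^* : α, β ∈ L^*, X ∈ B, X ⊆ R_α ∩ R_β} ∪ {0}`. (The further condition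
`R_α ∩ R_β ≠ ∅` only excludes elements with `X = ∅`, which are equal to `0`.) -/
def monomials {A : Type*} [NonUnitalRing A] (P : B → A) (S Sd : L → A) : Set A :=
  {x | x = 0 ∨ ∃ α X β, D.Below α X ∧ D.Below β X ∧ x = monomial P S Sd α X β}

section facts

theorem act_cons (a : L) (α : List L) (X : B) : D.act (a :: α) X = D.act α (D.θ a X) := rfl

theorem act_append (α β : List L) (X : B) : D.act (α ++ β) X = D.act β (D.act α X) := by
  simp [act, List.foldl_append]

theorem θ_mono (a : L) {X Y : B} (h : X ≤ Y) : D.θ a X ≤ D.θ a Y := by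
  rw [← inf_eq_left] at h ⊢
  rw [← D.map_inf, h]

theorem act_mono (α : List L) {X Y : B} (h : X ≤ Y) : D.act α X ≤ D.act α Y := by
  induction α generalizing X Y with
  | nil => exact h
  | cons a α ih => exact ih (D.θ_mono a h)

theorem below_iff (α : List L) (X : B) : D.Below α X ↔ ∃ Y, X ≤ D.act α Y := by
  constructor
  · intro h
    by_cases hα : α = []
    · subst hα
      exact ⟨X, le_rfl⟩
    · have := h hα
      rw [rng, dif_pos hα] at this
      exact ⟨_, this⟩
  · rintro ⟨Y, hY⟩ hα
    exact hY.trans ((D.isLUB_rng hα).1 ⟨Y, rfl⟩)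

variable {D} in
theorem Below.mono {α : List L} {X Y : B} (h : D.Below α Y) (hXY : X ≤ Y) : D.Below α X :=
  fun hα => hXY.trans (h hα)

variable {D} in
theorem Below.of_cons {a : L} {α : List L} {X : B} (h : D.Below (a :: α) X) : D.Below α X := by
  obtain ⟨Y, hY⟩ := (D.below_iff _ _).1 h
  exact (D.below_iff _ _).2 ⟨D.θ a Y, hY⟩

variable {D} in
theorem Below.le_act {a : L} {α : List L} {X : B} (h : D.Below (a :: α) X) :
    X ≤ D.act α (D.rng [a]) := by
  obtain ⟨Y, hY⟩ := (D.below_iff _ _).1 h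
  exact hY.trans (D.act_mono α ((D.isLUB_rng (α := [a]) (by simp)).1 ⟨Y, rfl⟩))

variable {D} in
theorem Below.append {α : List L} {X : B} (h : D.Below α X) (β : List L) :
    D.Below (α ++ β) (D.act β X) := by
  obtain ⟨Y, hY⟩ := (D.below_iff _ _).1 h
  exact (D.below_iff _ _).2 ⟨Y, by rw [act_append]; exact D.act_mono β hY⟩

variable {A : Type*} [NonUnitalRing A]

theorem word_mul (S : L → A) (α : List L) (x y : A) : word S α x * y = word S α (x * y) := by
  induction α with
  | nil => rfl
  | cons a α ih =>
    change S a * word S α x * y = S a * word S α (x * y)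
    rw [mul_assoc, ih]

theorem mul_wordStar (Sd : L → A) (β : List L) (x y : A) :
    x * wordStar Sd β y = wordStar Sd β (x * y) := by
  induction β with
  | nil => rfl
  | cons b β ih =>
    change x * (wordStar Sd β y * Sd b) = wordStar Sd β (x * y) * Sd b
    rw [← mul_assoc, ih]

theorem word_wordStar (S Sd : L → A) (α β : List L) (x : A) :
    word S α (wordStar Sd β x) = wordStar Sd β (word S α x) := by
  induction α with
  | nil => rfl
  | cons a α ih =>
    change S a * word S α (wordStar Sd β x) = wordStar Sd β (S a * word S α x)
    rw [ih, mul_wordStar]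

theorem word_append (S : L → A) (α β : List L) (x : A) :
    word S (α ++ β) x = word S α (word S β x) := by
  simp [word]

theorem wordStar_append (S : L → A) (α β : List L) (x : A) :
    wordStar S (α ++ β) x = wordStar S α (wordStar S β x) := by
  simp [wordStar]

theorem word_zero (S : L → A) (α : List L) : word S α 0 = 0 := by
  induction α with
  | nil => rfl
  | cons a α ih =>
    change S a * word S α 0 = 0
    rw [ih, mul_zero]

theorem wordStar_zero (S : L → A) (α : List L) : wordStar S α 0 = 0 := by
  induction α with
  | nil => rfl
  | cons a α ih =>
    change wordStar S α 0 * S a = 0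
    rw [ih, zero_mul]

variable {D} {P : B → A} {S Sd : L → A}

theorem IsCKFamily.mul_word (h : D.IsCKFamily P S Sd) (X : B) (γ : List L) (x : A) :
    P X * word S γ x = word S γ (P (D.act γ X) * x) := by
  induction γ generalizing X with
  | nil => rfl
  | cons c γ ih =>
    change P X * (S c * word S γ x) = S c * word S γ (P (D.act γ (D.θ c X)) * x)
    rw [← mul_assoc, h.comm_left, mul_assoc, ih]

theorem IsCKFamily.wordStar_mul (h : D.IsCKFamily P S Sd) (X : B) (γ : List L) (x : A) :
    wordStar Sd γ x * P X = wordStar Sd γ (x * P (D.act γ X)) := by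
  induction γ generalizing X with
  | nil => rfl
  | cons c γ ih =>
    change wordStar Sd γ x * Sd c * P X = wordStar Sd γ (x * P (D.act γ (D.θ c X))) * Sd c
    rw [mul_assoc, h.comm_right, ← mul_assoc, ih]

theorem IsCKFamily.cons_cons (h : D.IsCKFamily P S Sd) (b : L) (β γ : List L) (X Y : B)
    (hY : D.Below (b :: γ) Y) :
    wordStar Sd (b :: β) (P X) * word S (b :: γ) (P Y) = wordStar Sd β (P X) * word S γ (P Y) := by
  change wordStar Sd β (P X) * Sd b * (S b * word S γ (P Y)) = _
  rw [mul_assoc, ← mul_assoc (Sd b), h.source, h.mul_word, ← h.inf,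
    inf_eq_right.2 hY.le_act]

theorem IsCKFamily.inner_self (h : D.IsCKFamily P S Sd) (β : List L) (X Y : B)
    (hY : D.Below β Y) : wordStar Sd β (P X) * word S β (P Y) = P (X ⊓ Y) := by
  induction β with
  | nil => exact (h.inf X Y).symm
  | cons b β ih => rw [h.cons_cons b β β X Y hY, ih hY.of_cons]

theorem IsCKFamily.inner (h : D.IsCKFamily P S Sd) (β γ : List L) (X Y : B)
    (hX : D.Below β X) (hY : D.Below γ Y) :
    (∃ δ, γ = β ++ δ ∧
      wordStar Sd β (P X) * word S γ (P Y) = word S δ (P (D.act δ X ⊓ Y))) ∨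
    (∃ δ, β = γ ++ δ ∧
      wordStar Sd β (P X) * word S γ (P Y) = wordStar Sd δ (P (X ⊓ D.act δ Y))) ∨
    wordStar Sd β (P X) * word S γ (P Y) = 0 := by
  induction β generalizing γ with
  | nil =>
    refine Or.inl ⟨γ, rfl, ?_⟩
    change P X * word S γ (P Y) = _
    rw [h.mul_word, h.inf]
  | cons b β ih =>
    cases γ with
    | nil =>
      refine Or.inr (Or.inl ⟨b :: β, rfl, ?_⟩)
      change wordStar Sd (b :: β) (P X) * P Y = _
      rw [h.wordStar_mul, h.inf]
    | cons c γ =>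
      by_cases hbc : b = c
      · subst hbc
        rw [h.cons_cons b β γ X Y hY]
        rcases ih γ hX.of_cons hY.of_cons with ⟨δ, h1, h2⟩ | ⟨δ, h1, h2⟩ | h2
        · exact Or.inl ⟨δ, by rw [h1]; rfl, h2⟩
        · exact Or.inr (Or.inl ⟨δ, by rw [h1]; rfl, h2⟩)
        · exact Or.inr (Or.inr h2)
      · refine Or.inr (Or.inr ?_)
        change wordStar Sd β (P X) * Sd b * (S c * word S γ (P Y)) = 0
        rw [mul_assoc, ← mul_assoc (Sd b), h.orthogonal b c hbc, zero_mul, mul_zero]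

theorem monomial_mul_monomial {B : Type u} (P : B → A) (S Sd : L → A) (α β γ δ : List L) (X Y : B) :
    monomial P S Sd α X β * monomial P S Sd γ Y δ =
      word S α (wordStar Sd δ (wordStar Sd β (P X) * word S γ (P Y))) := by
  rw [monomial, monomial, word_mul, word_wordStar S Sd γ, mul_wordStar]

theorem IsCKFamily.mul_mem (h : D.IsCKFamily P S Sd) {x y : A}
    (hx : x ∈ D.monomials P S Sd) (hy : y ∈ D.monomials P S Sd) :
    x * y ∈ D.monomials P S Sd := by
  rcases hx with rfl | ⟨α, X, β, h1, h2, rfl⟩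
  · exact Or.inl (zero_mul _)
  rcases hy with rfl | ⟨γ, Y, δ, h3, h4, rfl⟩
  · exact Or.inl (mul_zero _)
  rw [monomial_mul_monomial]
  rcases h.inner β γ X Y h2 h3 with ⟨ε, -, he⟩ | ⟨ε, -, he⟩ | he
  · refine Or.inr ⟨α ++ ε, _, δ, (h1.append ε).mono inf_le_left, h4.mono inf_le_right, ?_⟩
    rw [he, monomial, word_append, word_wordStar S Sd ε]
  · refine Or.inr ⟨α, _, δ ++ ε, h1.mono inf_le_left, (h4.append ε).mono inf_le_right, ?_⟩
    rw [he, monomial, wordStar_append]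
  · refine Or.inl ?_
    rw [he, wordStar_zero, word_zero]

end facts

/-! ### The universal C*-algebra and the inverse semigroup `T` -/

section involution

variable {A : Type*} [NonUnitalRing A] [StarRing A]

theorem star_word (S : L → A) (α : List L) (x : A) :
    star (word S α x) = wordStar (fun a => star (S a)) α (star x) := by
  induction α with
  | nil => rfl
  | cons a α ih =>
    change star (S a * word S α x) = wordStar (fun a => star (S a)) α (star x) * star (S a)
    rw [star_mul, ih]

theorem star_wordStar (S : L → A) (α : List L) (x : A) :
    star (wordStar (fun a => star (S a)) α x) = word S α (star x) := by
  induction α with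
  | nil => rfl
  | cons a α ih =>
    change star (wordStar (fun a => star (S a)) α x * star (S a)) = S a * word S α (star x)
    rw [star_mul, ih, star_star]

end involution

section cstar

variable {D} {A : Type*} [NonUnitalCStarAlgebra A] {P : B → A} {S : L → A}

theorem IsCKRepresentation.star_monomial (h : D.IsCKRepresentation P S) (α β : List L) (X : B) :
    star (monomial P S (fun a => star (S a)) α X β) =
      monomial P S (fun a => star (S a)) β X α := by
  rw [monomial, star_word, star_wordStar, (h.projection X).isSelfAdjoint.star_eq, monomial,
    word_wordStar]

theorem IsCKRepresentation.star_mem (h : D.IsCKRepresentation P S) {x : A}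
    (hx : x ∈ D.monomials P S (fun a => star (S a))) :
    star x ∈ D.monomials P S (fun a => star (S a)) := by
  rcases hx with rfl | ⟨α, X, β, h1, h2, rfl⟩
  · exact Or.inl (star_zero _)
  · exact Or.inr ⟨β, X, α, h2, h1, h.star_monomial α β X⟩

theorem IsCKRepresentation.monomial_star_mul_self (h : D.IsCKRepresentation P S) (α β : List L)
    (X : B) (hα : D.Below α X) :
    star (monomial P S (fun a => star (S a)) α X β) * monomial P S (fun a => star (S a)) α X β =
      monomial P S (fun a => star (S a)) β X β := by
  rw [h.star_monomial, monomial_mul_monomial, h.family.inner_self α X X hα, inf_idem, monomial]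

theorem IsCKRepresentation.mul_star_mul (h : D.IsCKRepresentation P S) {x : A}
    (hx : x ∈ D.monomials P S (fun a => star (S a))) : x * star x * x = x := by
  rcases hx with rfl | ⟨α, X, β, h1, h2, rfl⟩
  · simp
  · rw [mul_assoc, h.monomial_star_mul_self α β X h1, monomial_mul_monomial,
      h.family.inner_self β X X h2, inf_idem, monomial]

/-- An idempotent partial isometry in a C*-algebra is a projection. -/
theorem eq_star_mul_self {x : A} (h1 : x * star x * x = x) (h2 : x * x = x) : x = star x * x := by
  rw [← sub_eq_zero, ← CStarRing.star_mul_self_eq_zero_iff]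
  have h3 : star x * star x = star x := by rw [← star_mul, h2]
  have h4 : star x * x * x = star x * x := by rw [mul_assoc, h2]
  have h5 : star x * (star x * x) = star x * x := by rw [← mul_assoc, h3]
  have h6 : star x * x * (star x * x) = star x * x := by rw [mul_assoc, ← mul_assoc x, h1]
  rw [star_sub, star_mul, star_star, sub_mul, mul_sub, mul_sub, h4, h5, h6]
  simp

theorem IsCKRepresentation.idem_form (h : D.IsCKRepresentation P S) {x : A}
    (hx : x ∈ D.monomials P S (fun a => star (S a))) (hi : x * x = x) :
    x = 0 ∨ ∃ β X, D.Below β X ∧ x = monomial P S (fun a => star (S a)) β X β := by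
  have h0 := eq_star_mul_self (h.mul_star_mul hx) hi
  rcases hx with rfl | ⟨α, X, β, h1, h2, rfl⟩
  · exact Or.inl rfl
  · exact Or.inr ⟨β, X, h2, h0.trans (h.monomial_star_mul_self α β X h1)⟩

theorem IsCKRepresentation.idem_comm (h : D.IsCKRepresentation P S) {x y : A}
    (hx : x ∈ D.monomials P S (fun a => star (S a))) (hxi : x * x = x)
    (hy : y ∈ D.monomials P S (fun a => star (S a))) (hyi : y * y = y) : x * y = y * x := by
  rcases h.idem_form hx hxi with rfl | ⟨β, X, h1, rfl⟩
  · simp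
  rcases h.idem_form hy hyi with rfl | ⟨γ, Y, h2, rfl⟩
  · simp
  have key : star (monomial P S (fun a => star (S a)) β X β *
      monomial P S (fun a => star (S a)) γ Y γ) = monomial P S (fun a => star (S a)) β X β *
      monomial P S (fun a => star (S a)) γ Y γ := by
    rw [monomial_mul_monomial]
    rcases h.family.inner β γ X Y h1 h2 with ⟨δ, h3, h4⟩ | ⟨δ, h3, h4⟩ | h4
    · rw [h4, ← word_wordStar S _ δ, ← word_append, ← h3]
      exact h.star_monomial γ γ _
    · rw [h4, ← wordStar_append, ← h3]
      exact h.star_monomial β β _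
    · rw [h4, wordStar_zero, word_zero, star_zero]
  rw [star_mul, h.star_monomial, h.star_monomial] at key
  exact key.symm

end cstar

/-- A C*-algebra together with a Cuntz-Krieger representation of `D` in it. -/
structure Representation where
  alg : Type (max u v)
  [cstar : NonUnitalCStarAlgebra alg]
  P : B → alg
  S : L → alg
  isCK : D.IsCKRepresentation P S

attribute [instance] Representation.cstar

theorem IsCKRepresentation.norm_S_le {D : BooleanDynamicalSystem B L} {A : Type*}
    [NonUnitalCStarAlgebra A] {P : B → A} {S : L → A} (h : D.IsCKRepresentation P S) (a : L) :
    ‖S a‖ ≤ 1 := by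
  have h1 : ‖S a‖ * ‖S a‖ ≤ 1 := by
    rw [← CStarRing.norm_star_mul_self, h.family.source a]
    exact (h.projection _).norm_le
  nlinarith [norm_nonneg (S a)]

/-- The family of the projections `P_X` of all representations, in the C*-algebra of bounded
families. -/
noncomputable def bigP (X : B) : lp (fun ρ : Representation D => ρ.alg) ∞ :=
  ⟨fun ρ => ρ.P X, memℓp_infty ⟨1, by rintro _ ⟨ρ, rfl⟩; exact (ρ.isCK.projection X).norm_le⟩⟩

/-- The family of the partial isometries `S_a` of all representations. -/
noncomputable def bigS (a : L) : lp (fun ρ : Representation D => ρ.alg) ∞ :=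
  ⟨fun ρ => ρ.S a, memℓp_infty ⟨1, by rintro _ ⟨ρ, rfl⟩; exact ρ.isCK.norm_S_le a⟩⟩

/-- The universal C*-algebra `C^*(B, L, θ)`: the C*-algebra generated by the direct sum of all
Cuntz-Krieger representations. -/
noncomputable def universalSubalgebra :
    NonUnitalStarSubalgebra ℂ (lp (fun ρ : Representation D => ρ.alg) ∞) :=
  (NonUnitalStarAlgebra.adjoin ℂ (Set.range D.bigP ∪ Set.range D.bigS)).topologicalClosure

/-- `C^*(B, L, θ)` as a type. -/
abbrev UniversalCStarAlgebra : Type (max u v + 1) := D.universalSubalgebra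

noncomputable instance : NonUnitalCStarAlgebra D.UniversalCStarAlgebra :=
  NonUnitalStarSubalgebra.nonUnitalCStarAlgebra _
    (h_closed := NonUnitalStarSubalgebra.isClosed_topologicalClosure _)

/-- The projections `p_X` of the universal representation. -/
noncomputable def univP (X : B) : D.UniversalCStarAlgebra :=
  ⟨D.bigP X, NonUnitalStarSubalgebra.le_topologicalClosure _
    (NonUnitalStarAlgebra.subset_adjoin ℂ _ (Or.inl ⟨X, rfl⟩))⟩

/-- The partial isometries `s_a` of the universal representation. -/
noncomputable def univS (a : L) : D.UniversalCStarAlgebra :=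
  ⟨D.bigS a, NonUnitalStarSubalgebra.le_topologicalClosure _
    (NonUnitalStarAlgebra.subset_adjoin ℂ _ (Or.inr ⟨a, rfl⟩))⟩

/-- The component of `C^*(B, L, θ)` at a representation `ρ`: the `*`-homomorphism required by the
universal property. -/
noncomputable def toRep (ρ : Representation D) : D.UniversalCStarAlgebra →⋆ₙₐ[ℂ] ρ.alg where
  toFun x := (x : lp (fun ρ : Representation D => ρ.alg) ∞) ρ
  map_smul' _ _ := rfl
  map_zero' := rfl
  map_add' _ _ := rfl
  map_mul' _ _ := rfl
  map_star' _ := rfl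

theorem toRep_univP (ρ : Representation D) (X : B) : D.toRep ρ (D.univP X) = ρ.P X := rfl

theorem toRep_univS (ρ : Representation D) (a : L) : D.toRep ρ (D.univS a) = ρ.S a := rfl

theorem univ_ext {x y : D.UniversalCStarAlgebra} (h : ∀ ρ, D.toRep ρ x = D.toRep ρ y) : x = y :=
  Subtype.ext (lp.ext (funext h))

theorem univ_isCKRepresentation : D.IsCKRepresentation D.univP D.univS where
  projection X :=
    { isIdempotentElem := D.univ_ext fun ρ => (ρ.isCK.projection X).isIdempotentElem
      isSelfAdjoint := D.univ_ext fun ρ => (ρ.isCK.projection X).isSelfAdjoint }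
  family :=
    { bot := D.univ_ext fun ρ => ρ.isCK.family.bot
      inf := fun X Y => D.univ_ext fun ρ => ρ.isCK.family.inf X Y
      sup := fun X Y => D.univ_ext fun ρ => ρ.isCK.family.sup X Y
      isometry_left := fun a => D.univ_ext fun ρ => ρ.isCK.family.isometry_left a
      isometry_right := fun a => D.univ_ext fun ρ => ρ.isCK.family.isometry_right a
      comm_left := fun a X => D.univ_ext fun ρ => ρ.isCK.family.comm_left a X
      comm_right := fun a X => D.univ_ext fun ρ => ρ.isCK.family.comm_right a X
      source := fun a => D.univ_ext fun ρ => ρ.isCK.family.source a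
      orthogonal := fun a b hab => D.univ_ext fun ρ => ρ.isCK.family.orthogonal a b hab
      regular := fun X hX F hF => D.univ_ext fun ρ => by
        rw [map_sum]
        exact ρ.isCK.family.regular X hX F hF }

end BooleanDynamicalSystem

/-! ## Inverse semigroups -/

/-- A `*`-inverse semigroup with zero: every `s` satisfies `s s^* s = s`, and idempotents
commute. -/
class InverseSemigroup (S : Type*) extends SemigroupWithZero S, StarMul S where
  mul_star_mul : ∀ s : S, s * star s * s = s
  idem_comm : ∀ e f : S, e * e = e → f * f = f → e * f = f * e

namespace BooleanDynamicalSystem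

variable {B : Type u} {L : Type v} [GeneralizedBooleanAlgebra B] (D : BooleanDynamicalSystem B L)

/-- The inverse semigroup
`T = {s_α p_X s_β^* : α, β ∈ L^*, X ∈ B, X ⊆ R_α ∩ R_β} ∪ {0} ⊆ C^*(B, L, θ)`. -/
def T : Type (max u v + 1) :=
  {x : D.UniversalCStarAlgebra // x ∈ D.monomials D.univP D.univS (fun a => star (D.univS a))}

noncomputable instance : InverseSemigroup D.T where
  mul x y := ⟨x.1 * y.1, D.univ_isCKRepresentation.family.mul_mem x.2 y.2⟩
  mul_assoc x y z := Subtype.ext (mul_assoc x.1 y.1 z.1)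
  zero := ⟨0, Or.inl rfl⟩
  zero_mul x := Subtype.ext (zero_mul x.1)
  mul_zero x := Subtype.ext (mul_zero x.1)
  star x := ⟨star x.1, D.univ_isCKRepresentation.star_mem x.2⟩
  star_involutive x := Subtype.ext (star_star x.1)
  star_mul x y := Subtype.ext (star_mul x.1 y.1)
  mul_star_mul x := Subtype.ext (D.univ_isCKRepresentation.mul_star_mul x.2)
  idem_comm x y hx hy := Subtype.ext (D.univ_isCKRepresentation.idem_comm
    x.2 (congrArg Subtype.val hx) y.2 (congrArg Subtype.val hy))

/-- `p_X` as an element of `T`. -/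
noncomputable def pT (X : B) : D.T :=
  ⟨D.univP X, Or.inr ⟨[], X, [], fun h => absurd rfl h, fun h => absurd rfl h, rfl⟩⟩

/-- `s_a = s_a p_{R_a}` as an element of `T`. -/
noncomputable def sT (a : L) : D.T :=
  ⟨D.univS a, Or.inr ⟨[a], D.rng [a], [], fun _ => le_rfl, fun h => absurd rfl h, by
    change D.univS a = D.univS a * D.univP (D.rng [a])
    rw [← D.univ_isCKRepresentation.family.source a, ← mul_assoc]
    exact (D.univ_isCKRepresentation.family.isometry_left a).symm⟩⟩

end BooleanDynamicalSystem

namespace InverseSemigroup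

variable {S : Type*} [InverseSemigroup S]

theorem idem_star_eq {e : S} (he : e * e = e) : star e = e := by
  have h1 : star e * star e = star e := by rw [← star_mul, he]
  have h2 : e = star e * e := by
    conv_lhs => rw [← mul_star_mul e, idem_comm e (star e) he h1, mul_assoc, he]
  rw [h2, star_mul, star_star]

theorem star_mul_self_idem (s : S) : star s * s * (star s * s) = star s * s := by
  rw [← mul_assoc, mul_assoc (star s) s, mul_assoc (star s), mul_star_mul]

theorem mul_star_self_idem (s : S) : s * star s * (s * star s) = s * star s := by
  rw [← mul_assoc, mul_star_mul]

theorem idem_mul_idem {e f : S} (he : e * e = e) (hf : f * f = f) : e * f * (e * f) = e * f := by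
  rw [mul_assoc, ← mul_assoc f, ← idem_comm e f he hf, mul_assoc e f f, hf, ← mul_assoc, he]

theorem conj_mul_conj (s : S) {e f : S} (he : e * e = e) :
    star s * e * s * (star s * f * s) = star s * (e * f) * s := by
  have h : s * star s * e = e * (s * star s) := idem_comm _ _ (mul_star_self_idem s) he
  calc star s * e * s * (star s * f * s) = star s * (e * (s * star s)) * f * s := by
        simp only [mul_assoc]
    _ = star s * (s * star s * e) * f * s := by rw [h]
    _ = (star s * s * star s) * (e * f) * s := by simp only [mul_assoc]
    _ = star s * (e * f) * s := by
        have := mul_star_mul (star s)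
        rw [star_star] at this
        rw [this]

theorem conj_idem (s : S) {e : S} (he : e * e = e) :
    star s * e * s * (star s * e * s) = star s * e * s := by
  rw [conj_mul_conj s he, he]

theorem conj_idem_star (s : S) {e : S} (he : e * e = e) :
    s * e * star s * (s * e * star s) = s * e * star s := by
  simpa using conj_idem (star s) he

/-! ### Tight filters -/

/-- The set `E^{X,Y}` of the idempotents that lie below all elements of `X` and are orthogonal to
all elements of `Y`; for idempotents, `e ≤ f` means `e f = e`. -/
def between (X Y : Set S) : Set S :=
  {e | e * e = e ∧ (∀ x ∈ X, e * x = e) ∧ ∀ y ∈ Y, e * y = 0}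

/-- `Z` is a cover of the set `F` of idempotents: it is a subset of `F`, and every nonzero element
of `F` has a nonzero product with some element of `Z`. -/
def IsCover (Z F : Set S) : Prop := Z ⊆ F ∧ ∀ e ∈ F, e ≠ 0 → ∃ z ∈ Z, e * z ≠ 0

variable (S) in
/-- A tight filter on the semilattice `E(S)` of idempotents of `S`: a proper nonempty filter `ξ`
such that, for all finite sets `X, Y` of idempotents and every finite cover `Z` of `E^{X,Y}`, if
`X ⊆ ξ` and `Y ∩ ξ = ∅` then `Z ∩ ξ ≠ ∅`. -/
@[ext]
structure TightFilter where
  carrier : Set S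
  idem : ∀ e ∈ carrier, e * e = e
  nonempty : carrier.Nonempty
  zero_notMem : (0 : S) ∉ carrier
  mul_mem : ∀ e ∈ carrier, ∀ f ∈ carrier, e * f ∈ carrier
  upward : ∀ e ∈ carrier, ∀ f, f * f = f → e * f = e → f ∈ carrier
  tight : ∀ X Y Z : Set S, X.Finite → Y.Finite → Z.Finite →
    (∀ x ∈ X, x * x = x) → (∀ y ∈ Y, y * y = y) → IsCover Z (between X Y) →
    X ⊆ carrier → Disjoint Y carrier → ∃ z ∈ Z, z ∈ carrier

namespace TightFilter

/-- The domain `D_e` of the idempotent `e`. -/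
def dom (e : S) : Set (TightFilter S) := {ξ | e ∈ ξ.carrier}

/-- The topology of pointwise convergence of characters, generated by the sets `D_e` and their
complements. -/
instance : TopologicalSpace (TightFilter S) :=
  TopologicalSpace.generateFrom {U | ∃ e : S, e * e = e ∧ (U = dom e ∨ U = (dom e)ᶜ)}

theorem mem_of_mul_mem {ξ : TightFilter S} {e f : S} (he : e * e = e) (hf : f * f = f)
    (h : e * f ∈ ξ.carrier) : e ∈ ξ.carrier :=
  ξ.upward _ h e he (by rw [mul_assoc, ← idem_comm e f he hf, ← mul_assoc, he])

/-- The action of `S` on tight filters, `t · ξ = {f ∈ E(S) : t^* f t ∈ ξ}`, for `t^* t ∈ ξ`. It is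
the filter generated by `{t e t^* : e ∈ ξ}`. -/
def act (t : S) (ξ : TightFilter S) (ht : star t * t ∈ ξ.carrier) : TightFilter S where
  carrier := {f | f * f = f ∧ star t * f * t ∈ ξ.carrier}
  idem _ h := h.1
  nonempty := by
    refine ⟨t * star t, mul_star_self_idem t, ?_⟩
    rw [← mul_assoc, mul_assoc _ (star t) t]
    rwa [star_mul_self_idem]
  zero_notMem h := ξ.zero_notMem (by simpa using h.2)
  mul_mem e he f hf := by
    refine ⟨idem_mul_idem he.1 hf.1, ?_⟩
    rw [← conj_mul_conj t he.1]
    exact ξ.mul_mem _ he.2 _ hf.2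
  upward e he f hf hef := by
    refine ⟨hf, ξ.upward _ he.2 _ (conj_idem t hf) ?_⟩
    rw [conj_mul_conj t he.1, hef]
  tight X Y Z hX hY hZ hXi hYi hc hXs hYs := by
    have hcomm : ∀ {e : S}, e * e = e → t * star t * e = e * (t * star t) :=
      fun he => idem_comm _ _ (mul_star_self_idem t) he
    have hst : star t * t * star t = star t := by simpa using mul_star_mul (star t)
    obtain ⟨z', ⟨z, hz, rfl⟩, hz'⟩ := ξ.tight (insert (star t * t) ((fun x => star t * x * t) '' X))
      ((fun y => star t * y * t) '' Y) ((fun z => star t * z * t) '' Z)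
      ((hX.image _).insert _) (hY.image _) (hZ.image _)
      (by
        rintro _ (rfl | ⟨x, hx, rfl⟩)
        · exact star_mul_self_idem t
        · exact conj_idem t (hXi x hx))
      (by rintro _ ⟨y, hy, rfl⟩; exact conj_idem t (hYi y hy))
      (by
        refine ⟨?_, ?_⟩
        · rintro _ ⟨z, hz, rfl⟩
          obtain ⟨h1, h2, h3⟩ := hc.1 hz
          refine ⟨conj_idem t h1, ?_, ?_⟩
          · rintro _ (rfl | ⟨x, hx, rfl⟩)
            · rw [mul_assoc (star t * z), ← mul_assoc t, mul_star_mul]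
            · simp only
              rw [conj_mul_conj t h1, h2 x hx]
          · rintro _ ⟨y, hy, rfl⟩
            simp only
            rw [conj_mul_conj t h1, h3 y hy, mul_zero, zero_mul]
        · rintro e ⟨h1, h2, h3⟩ he0
          have het : e * (star t * t) = e := h2 _ (Or.inl rfl)
          have hte : star t * t * e = e := by
            rw [idem_comm _ _ (star_mul_self_idem t) h1, het]
          have hback : star t * (t * e * star t) * t = e := by
            calc star t * (t * e * star t) * t = star t * t * e * (star t * t) := by
                  simp only [mul_assoc]
              _ = e := by rw [hte, het]
          have key : ∀ f : S, f * f = f →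
              t * e * star t * f = t * (e * (star t * f * t)) * star t := by
            intro f hf
            calc t * e * star t * f = t * e * (star t * t * star t) * f := by rw [hst]
              _ = t * e * star t * (t * star t * f) := by simp only [mul_assoc]
              _ = t * e * star t * (f * (t * star t)) := by rw [hcomm hf]
              _ = _ := by simp only [mul_assoc]
          obtain ⟨z, hz, hz0⟩ := hc.2 (t * e * star t)
            ⟨conj_idem_star t h1, fun x hx => by
              rw [key x (hXi x hx), h2 _ (Or.inr ⟨x, hx, rfl⟩)], fun y hy => by
              rw [key y (hYi y hy), h3 _ ⟨y, hy, rfl⟩, mul_zero, zero_mul]⟩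
            (fun h0 => he0 (by rw [← hback, h0, mul_zero, zero_mul]))
          refine ⟨_, ⟨z, hz, rfl⟩, fun h0 => hz0 ?_⟩
          simp only at h0
          rw [key z (hc.1 hz).1, h0, mul_zero, zero_mul])
      (by
        rintro _ (rfl | ⟨x, hx, rfl⟩)
        · exact ht
        · exact (hXs hx).2)
      (by
        rw [Set.disjoint_left]
        rintro _ ⟨y, hy, rfl⟩ hm
        exact Set.disjoint_left.1 hYs hy ⟨hYi y hy, hm⟩)
    exact ⟨z, hz, (hc.1 hz).1, hz'⟩

end TightFilter

/-! ### The tight groupoid -/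

variable (S) in
/-- Pairs `(t, ξ)` with `ξ` in the domain of `t`. -/
structure PreGerm where
  elt : S
  point : TightFilter S
  mem : star elt * elt ∈ point.carrier

variable (S) in
/-- `(s, ξ)` and `(t, η)` have the same germ if `ξ = η` and `s e = t e` for some idempotent
`e ∈ ξ`. -/
def germSetoid : Setoid (PreGerm S) where
  r x y := x.point = y.point ∧ ∃ e ∈ x.point.carrier, x.elt * e = y.elt * e
  iseqv :=
    { refl := fun x => ⟨rfl, x.point.nonempty.choose, x.point.nonempty.choose_spec, rfl⟩
      symm := by
        rintro ⟨s, ξ, hs⟩ ⟨t, η, ht⟩ ⟨h, e, he, h2⟩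
        simp only at h he h2
        subst h
        exact ⟨rfl, e, he, h2.symm⟩
      trans := by
        rintro ⟨s, ξ, hs⟩ ⟨t, η, ht⟩ ⟨r, ζ, hr⟩ ⟨h, e, he, h2⟩ ⟨h', f, hf, h3⟩
        simp only at h h' he hf h2 h3
        subst h
        subst h'
        refine ⟨rfl, e * f, ξ.mul_mem _ he _ hf, ?_⟩
        change s * (e * f) = r * (e * f)
        rw [← mul_assoc, h2, mul_assoc, idem_comm e f (ξ.idem _ he) (ξ.idem _ hf), ← mul_assoc, h3,
          mul_assoc] }

variable (S) in
/-- The tight groupoid of `S`: the groupoid of germs of the action of `S` on its space of tight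
filters. -/
def TightGroupoid := Quotient (germSetoid S)

namespace TightGroupoid

/-- The germ `[t, ξ]`. -/
def germ (t : S) (ξ : TightFilter S) (ht : star t * t ∈ ξ.carrier) : TightGroupoid S :=
  Quotient.mk (germSetoid S) ⟨t, ξ, ht⟩

theorem germ_eq_iff {s t : S} {ξ η : TightFilter S} {hs : star s * s ∈ ξ.carrier}
    {ht : star t * t ∈ η.carrier} :
    germ s ξ hs = germ t η ht ↔ ξ = η ∧ ∃ e ∈ ξ.carrier, s * e = t * e :=
  ⟨fun h => Quotient.exact h, fun h => Quotient.sound h⟩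

/-- The source of `[t, ξ]` is `ξ`. -/
def source : TightGroupoid S → TightFilter S :=
  Quotient.lift PreGerm.point fun _ _ h => h.1

theorem act_congr {s t : S} {ξ : TightFilter S} {hs : star s * s ∈ ξ.carrier}
    {ht : star t * t ∈ ξ.carrier} {e : S} (he : e ∈ ξ.carrier) (h : s * e = t * e) :
    ξ.act s hs = ξ.act t ht := by
  have hei := ξ.idem e he
  have key : ∀ (r f : S), f * f = f →
      (star r * f * r ∈ ξ.carrier ↔ star (r * e) * f * (r * e) ∈ ξ.carrier) := by
    intro r f hf
    have h1 : star (r * e) * f * (r * e) = (star r * f * r) * e := by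
      rw [star_mul, idem_star_eq hei]
      calc e * star r * f * (r * e) = e * (star r * f * r) * e := by simp only [mul_assoc]
        _ = (star r * f * r) * e := by
          rw [idem_comm e _ hei (conj_idem r hf), mul_assoc, hei]
    rw [h1]
    exact ⟨fun h2 => ξ.mul_mem _ h2 _ he,
      fun h2 => TightFilter.mem_of_mul_mem (conj_idem r hf) hei h2⟩
  ext f
  change (f * f = f ∧ _) ↔ (f * f = f ∧ _)
  refine and_congr_right fun hf => ?_
  rw [key s f hf, key t f hf, h]

/-- The range of `[t, ξ]` is `t · ξ`. -/
def range : TightGroupoid S → TightFilter S :=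
  Quotient.lift (fun x => x.point.act x.elt x.mem) (by
    rintro ⟨s, ξ, hs⟩ ⟨t, η, ht⟩ ⟨h, e, he, h2⟩
    simp only at h he h2
    subst h
    exact act_congr he h2)

theorem mem_of_comp {s t : S} {ξ : TightFilter S} {ht : star t * t ∈ ξ.carrier}
    (hs : star s * s ∈ (ξ.act t ht).carrier) : star (s * t) * (s * t) ∈ ξ.carrier := by
  have h := hs.2
  rwa [star_mul, ← mul_assoc, mul_assoc (star t)]

/-- `IsComp a b c` says that the pair `(a, b)` is composable and that `a b = c`, where the product
of germs is `[s, t · ξ] [t, ξ] = [s t, ξ]`. -/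
def IsComp (a b c : TightGroupoid S) : Prop :=
  ∃ (s t : S) (ξ : TightFilter S) (ht : star t * t ∈ ξ.carrier)
    (hs : star s * s ∈ (ξ.act t ht).carrier),
    a = germ s (ξ.act t ht) hs ∧ b = germ t ξ ht ∧ c = germ (s * t) ξ (mem_of_comp hs)

/-- The product is well defined: it exists, and is then unique, exactly for the pairs `(a, b)` with
`source a = range b`. -/
theorem existsUnique_isComp (a b : TightGroupoid S) (h : source a = range b) :
    ∃! c, IsComp a b c := by
  obtain ⟨⟨s, η, hs⟩, rfl⟩ := Quotient.exists_rep a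
  obtain ⟨⟨t, ξ, ht⟩, rfl⟩ := Quotient.exists_rep b
  change η = ξ.act t ht at h
  subst h
  refine ⟨germ (s * t) ξ (mem_of_comp hs), ⟨s, t, ξ, ht, hs, rfl, rfl, rfl⟩, ?_⟩
  rintro c ⟨s', t', ξ', ht', hs', h1, h2, rfl⟩
  obtain ⟨h3, e, he, h4⟩ := germ_eq_iff.1 h2
  obtain ⟨-, f, hf, h5⟩ := germ_eq_iff.1 h1
  subst h3
  refine germ_eq_iff.2 ⟨rfl, star t * f * t * e, ξ.mul_mem _ hf.2 _ he, ?_⟩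
  have ht1 : t * (star t * f * t * e) = f * (t * e) := by
    calc t * (star t * f * t * e) = t * star t * f * (t * e) := by simp only [mul_assoc]
      _ = f * (t * star t) * (t * e) := by rw [idem_comm _ _ (mul_star_self_idem t) hf.1]
      _ = f * ((t * star t * t) * e) := by simp only [mul_assoc]
      _ = f * (t * e) := by rw [mul_star_mul]
  have hcomm : star t * f * t * e = e * (star t * f * t * e) := by
    rw [idem_comm e _ (ξ.idem _ he) (idem_mul_idem (conj_idem t hf.1) (ξ.idem _ he)),
      mul_assoc _ e e, ξ.idem _ he]
  have ht2 : t' * (star t * f * t * e) = f * (t * e) := by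
    rw [hcomm, ← mul_assoc, ← h4, mul_assoc, ← hcomm, ht1]
  change s' * t' * (star t * f * t * e) = s * t * (star t * f * t * e)
  rw [mul_assoc s', mul_assoc s t, ht1, ht2, ← mul_assoc s', ← mul_assoc s f, h5]

theorem IsComp.source_eq_range {a b c : TightGroupoid S} (h : IsComp a b c) :
    source a = range b := by
  obtain ⟨s, t, ξ, ht, hs, rfl, rfl, rfl⟩ := h
  rfl

/-- The set `Θ(t, U) = {[t, ξ] : ξ ∈ U}` of germs, where only `ξ` in the domain of `t` count. -/
def Θ (t : S) (U : Set (TightFilter S)) : Set (TightGroupoid S) :=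
  {a | ∃ (ξ : TightFilter S) (ht : star t * t ∈ ξ.carrier), ξ ∈ U ∧ a = germ t ξ ht}

/-- The topology of the groupoid of germs, generated by the sets `Θ(t, U)` with `U` an open subset
of the domain of `t`. -/
instance : TopologicalSpace (TightGroupoid S) :=
  TopologicalSpace.generateFrom
    {V | ∃ (t : S) (U : Set (TightFilter S)),
      IsOpen U ∧ U ⊆ TightFilter.dom (star t * t) ∧ V = Θ t U}

end TightGroupoid

end InverseSemigroup

/-! ## The Steinberg algebra -/

open InverseSemigroup in
/-- The Steinberg algebra `A_R(G)` of the tight groupoid `G` of `S`, as an `R`-module: the locally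
constant functions `G → R` with compact support `{a : f a ≠ 0}`. Its product is the convolution
below. (This is the usual definition when `G` is Hausdorff, as it is for the inverse semigroup `T`
of a Boolean dynamical system.) -/
def SteinbergAlgebra (R : Type w) [CommRing R] (S : Type*) [InverseSemigroup S] :
    Submodule R (TightGroupoid S → R) where
  carrier := {f | IsLocallyConstant f ∧ IsCompact (Function.support f)}
  zero_mem' := ⟨IsLocallyConstant.const 0, by simp⟩
  add_mem' := by
    rintro f g ⟨hf, hf'⟩ ⟨hg, hg'⟩
    exact ⟨hf.add hg, (hf'.union hg').of_isClosed_subset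
      ((hf.add hg).isOpen_fiber 0).isClosed_compl (Function.support_add f g)⟩
  smul_mem' := by
    rintro r f ⟨hf, hf'⟩
    have hr : IsLocallyConstant (r • f) := hf.comp (fun x => r • x)
    exact ⟨hr, hf'.of_isClosed_subset (hr.isOpen_fiber 0).isClosed_compl (Function.support_const_smul_subset r f)⟩

open InverseSemigroup in
/-- The convolution product `(f g)(c) = ∑ f(a) g(b)`, the sum extending over all composable pairs
`(a, b)` with `a b = c`. -/
noncomputable def convolution {R : Type w} [CommRing R] {S : Type*} [InverseSemigroup S]
    (f g : TightGroupoid S → R) (c : TightGroupoid S) : R :=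
  ∑ᶠ x : {x : TightGroupoid S × TightGroupoid S // TightGroupoid.IsComp x.1 x.2 c},
    f x.1.1 * g x.1.2

/-! ## The algebra `R(B, L, θ)` -/

/-- The generators `p_X`, `s_a` and `s_a^*` (written `sd a`). -/
inductive CKGenerator (B : Type u) (L : Type v) : Type (max u v)
  | p (X : B)
  | s (a : L)
  | sd (a : L)

namespace BooleanDynamicalSystem

variable {B : Type u} {L : Type v} [GeneralizedBooleanAlgebra B] (D : BooleanDynamicalSystem B L)
  (R : Type w) [CommRing R]

open CKGenerator in
/-- The Cuntz-Krieger relations between the generators of the free `R`-algebra. -/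
inductive Rel : FreeAlgebra R (CKGenerator B L) → FreeAlgebra R (CKGenerator B L) → Prop
  | bot : Rel (FreeAlgebra.ι R (p ⊥)) 0
  | inf (X Y) : Rel (FreeAlgebra.ι R (p (X ⊓ Y))) (FreeAlgebra.ι R (p X) * FreeAlgebra.ι R (p Y))
  | sup (X Y) : Rel (FreeAlgebra.ι R (p (X ⊔ Y)))
      (FreeAlgebra.ι R (p X) + FreeAlgebra.ι R (p Y) - FreeAlgebra.ι R (p (X ⊓ Y)))
  | isometry_left (a) : Rel
      (FreeAlgebra.ι R (s a) * FreeAlgebra.ι R (sd a) * FreeAlgebra.ι R (s a))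
      (FreeAlgebra.ι R (s a))
  | isometry_right (a) : Rel
      (FreeAlgebra.ι R (sd a) * FreeAlgebra.ι R (s a) * FreeAlgebra.ι R (sd a))
      (FreeAlgebra.ι R (sd a))
  | comm_left (a X) : Rel (FreeAlgebra.ι R (p X) * FreeAlgebra.ι R (s a))
      (FreeAlgebra.ι R (s a) * FreeAlgebra.ι R (p (D.θ a X)))
  | comm_right (a X) : Rel (FreeAlgebra.ι R (sd a) * FreeAlgebra.ι R (p X))
      (FreeAlgebra.ι R (p (D.θ a X)) * FreeAlgebra.ι R (sd a))
  | source (a) : Rel (FreeAlgebra.ι R (sd a) * FreeAlgebra.ι R (s a))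
      (FreeAlgebra.ι R (p (D.rng [a])))
  | orthogonal (a b) (h : a ≠ b) : Rel (FreeAlgebra.ι R (sd a) * FreeAlgebra.ι R (s b)) 0
  | regular (X) (hX : D.IsRegular X) (F : Finset L) (hF : (F : Set L) = D.letters X) :
      Rel (FreeAlgebra.ι R (p X))
        (∑ a ∈ F, FreeAlgebra.ι R (s a) * FreeAlgebra.ι R (p (D.θ a X)) * FreeAlgebra.ι R (sd a))

/-- The image of a generator in the unital `R`-algebra presented by the Cuntz-Krieger relations. -/
def gen (x : CKGenerator B L) : RingQuot (D.Rel R) :=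
  RingQuot.mkAlgHom R (D.Rel R) (FreeAlgebra.ι R x)

/-- The `R`-algebra `R(B, L, θ)`, not unital in general, with generators `p_X`, `s_a`, `s_a^*` and
the Cuntz-Krieger relations. Since the relations have no constant term, the unital algebra with the
same presentation is its unitization; so it is the non-unital subalgebra of the latter that the
generators generate. Its universal property is `existsUnique_lift`. -/
def alg : NonUnitalSubalgebra R (RingQuot (D.Rel R)) :=
  NonUnitalAlgebra.adjoin R (Set.range (D.gen R))

/-- The generator `p_X` of `R(B, L, θ)`. -/
def pR (X : B) : D.alg R := ⟨D.gen R (.p X), NonUnitalAlgebra.subset_adjoin R ⟨_, rfl⟩⟩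

/-- The generator `s_a` of `R(B, L, θ)`. -/
def sR (a : L) : D.alg R := ⟨D.gen R (.s a), NonUnitalAlgebra.subset_adjoin R ⟨_, rfl⟩⟩

/-- The generator `s_a^*` of `R(B, L, θ)`. -/
def sdR (a : L) : D.alg R := ⟨D.gen R (.sd a), NonUnitalAlgebra.subset_adjoin R ⟨_, rfl⟩⟩

theorem coe_pR (X : B) : (D.pR R X : RingQuot (D.Rel R)) = RingQuot.mkAlgHom R (D.Rel R)
    (FreeAlgebra.ι R (.p X)) := rfl

theorem coe_sR (a : L) : (D.sR R a : RingQuot (D.Rel R)) = RingQuot.mkAlgHom R (D.Rel R)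
    (FreeAlgebra.ι R (.s a)) := rfl

theorem coe_sdR (a : L) : (D.sdR R a : RingQuot (D.Rel R)) = RingQuot.mkAlgHom R (D.Rel R)
    (FreeAlgebra.ι R (.sd a)) := rfl

theorem alg_isCKFamily : D.IsCKFamily (D.pR R) (D.sR R) (D.sdR R) where
  bot := Subtype.ext (by
    exact (RingQuot.mkAlgHom_rel R (Rel.bot (D := D) (R := R))).trans (map_zero _))
  inf X Y := Subtype.ext (by
    simpa [coe_pR, coe_sR, coe_sdR] using RingQuot.mkAlgHom_rel R (Rel.inf (D := D) (R := R) X Y))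
  sup X Y := Subtype.ext (by
    simpa [coe_pR, coe_sR, coe_sdR] using RingQuot.mkAlgHom_rel R (Rel.sup (D := D) (R := R) X Y))
  isometry_left a := Subtype.ext (by
    simpa [coe_pR, coe_sR, coe_sdR] using RingQuot.mkAlgHom_rel R (Rel.isometry_left (D := D) (R := R) a))
  isometry_right a := Subtype.ext (by
    simpa [coe_pR, coe_sR, coe_sdR] using RingQuot.mkAlgHom_rel R (Rel.isometry_right (D := D) (R := R) a))
  comm_left a X := Subtype.ext (by
    simpa [coe_pR, coe_sR, coe_sdR] using RingQuot.mkAlgHom_rel R (Rel.comm_left (D := D) (R := R) a X))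
  comm_right a X := Subtype.ext (by
    simpa [coe_pR, coe_sR, coe_sdR] using RingQuot.mkAlgHom_rel R (Rel.comm_right (D := D) (R := R) a X))
  source a := Subtype.ext (by
    simpa [coe_pR, coe_sR, coe_sdR] using RingQuot.mkAlgHom_rel R (Rel.source (D := D) (R := R) a))
  orthogonal a b h := Subtype.ext (by
    simpa [coe_pR, coe_sR, coe_sdR] using RingQuot.mkAlgHom_rel R (Rel.orthogonal (D := D) (R := R) a b h))
  regular X hX F hF := Subtype.ext (by
    have := RingQuot.mkAlgHom_rel R (Rel.regular (D := D) (R := R) X hX F hF)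
    rw [map_sum] at this
    simpa [coe_pR, coe_sR, coe_sdR] using this)

/-- `R(B, L, θ)` is universal among the `R`-algebras with a family that satisfies the
Cuntz-Krieger relations. -/
theorem existsUnique_lift {A : Type*} [NonUnitalRing A] [Module R A] [IsScalarTower R A A]
    [SMulCommClass R A A] {P : B → A} {S Sd : L → A} (h : D.IsCKFamily P S Sd) :
    ∃! φ : D.alg R →ₙₐ[R] A,
      (∀ X, φ (D.pR R X) = P X) ∧ (∀ a, φ (D.sR R a) = S a) ∧ ∀ a, φ (D.sdR R a) = Sd a := by
  let ψ : CKGenerator B L → A := fun x => CKGenerator.casesOn x P S Sd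
  let Ψ : FreeAlgebra R (CKGenerator B L) →ₐ[R] Unitization R A :=
    FreeAlgebra.lift R fun x => Unitization.inr (ψ x)
  have hp : ∀ X, Ψ (FreeAlgebra.ι R (.p X)) = (P X : Unitization R A) := fun X => by simp [Ψ, ψ]
  have hs : ∀ a, Ψ (FreeAlgebra.ι R (.s a)) = (S a : Unitization R A) := fun X => by simp [Ψ, ψ]
  have hsd : ∀ a, Ψ (FreeAlgebra.ι R (.sd a)) = (Sd a : Unitization R A) := fun X => by
    simp [Ψ, ψ]
  have hrel : ∀ ⦃x y⦄, D.Rel R x y → Ψ x = Ψ y := by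
    intro x y hxy
    cases hxy with
    | bot => rw [hp, h.bot, map_zero, Unitization.inr_zero]
    | inf X Y => rw [map_mul, hp, hp, hp, h.inf, Unitization.inr_mul]
    | sup X Y =>
      rw [map_sub, map_add, hp, hp, hp, hp, h.sup, Unitization.inr_sub, Unitization.inr_add]
    | isometry_left a => simp only [map_mul, hs, hsd, ← Unitization.inr_mul, h.isometry_left]
    | isometry_right a => simp only [map_mul, hs, hsd, ← Unitization.inr_mul, h.isometry_right]
    | comm_left a X => simp only [map_mul, hs, hp, ← Unitization.inr_mul, h.comm_left]
    | comm_right a X => simp only [map_mul, hsd, hp, ← Unitization.inr_mul, h.comm_right]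
    | source a => simp only [map_mul, hs, hsd, hp, ← Unitization.inr_mul, h.source]
    | orthogonal a b hab =>
      simp only [map_mul, hs, hsd, ← Unitization.inr_mul, h.orthogonal a b hab, map_zero,
        Unitization.inr_zero]
    | regular X hX F hF =>
      rw [map_sum, hp, h.regular X hX F hF]
      simp only [map_mul, hs, hsd, hp, ← Unitization.inr_mul]
      exact map_sum (Unitization.inrHom R R A) _ _
  let Φ : RingQuot (D.Rel R) →ₐ[R] Unitization R A := RingQuot.liftAlgHom R ⟨Ψ, hrel⟩
  have hΦ : ∀ x, Φ (RingQuot.mkAlgHom R (D.Rel R) x) = Ψ x := fun x =>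
    RingQuot.liftAlgHom_mkAlgHom_apply R Ψ hrel x
  have hmem : ∀ z ∈ D.alg R, (Φ z).fst = 0 := by
    intro z hz
    refine NonUnitalAlgebra.adjoin_induction (R := R)
      (p := fun x _ => (Φ x).fst = 0) ?_ ?_ ?_ ?_ ?_ hz
    · rintro _ ⟨x, rfl⟩
      rw [gen, hΦ]
      simp [Ψ]
    · intro x y _ _ hx hy
      rw [map_add, Unitization.fst_add, hx, hy, add_zero]
    · rw [map_zero, Unitization.fst_zero]
    · intro x y _ _ hx hy
      rw [map_mul, Unitization.fst_mul, hx, hy, mul_zero]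
    · intro r x _ hx
      rw [map_smul, Unitization.fst_smul, hx, smul_zero]
  let φ : D.alg R →ₙₐ[R] A :=
    { toFun := fun z => (Φ z.1).snd
      map_smul' := fun r z => by simp
      map_zero' := by simp
      map_add' := fun x y => by simp
      map_mul' := fun x y => by simp [hmem _ x.2, hmem _ y.2] }
  refine ⟨φ, ⟨fun X => ?_, fun a => ?_, fun a => ?_⟩, ?_⟩
  · change (Φ (D.pR R X).1).snd = P X
    rw [coe_pR, hΦ, hp, Unitization.snd_inr]
  · change (Φ (D.sR R a).1).snd = S a
    rw [coe_sR, hΦ, hs, Unitization.snd_inr]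
  · change (Φ (D.sdR R a).1).snd = Sd a
    rw [coe_sdR, hΦ, hsd, Unitization.snd_inr]
  · rintro φ' ⟨h1, h2, h3⟩
    ext ⟨z, hz⟩
    refine NonUnitalAlgebra.adjoin_induction (R := R)
      (p := fun x hx => φ' ⟨x, hx⟩ = φ ⟨x, hx⟩) ?_ ?_ ?_ ?_ ?_ hz
    · rintro _ ⟨x, rfl⟩
      have hφ : φ ⟨D.gen R x, NonUnitalAlgebra.subset_adjoin R ⟨x, rfl⟩⟩ = ψ x := by
        change (Φ (D.gen R x)).snd = ψ x
        rw [gen, hΦ]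
        simp [Ψ]
      rw [hφ]
      cases x with
      | p X => exact h1 X
      | s a => exact h2 a
      | sd a => exact h3 a
    · intro x y hx hy h4 h5
      exact (map_add φ' ⟨x, hx⟩ ⟨y, hy⟩).trans
        ((congrArg₂ (· + ·) h4 h5).trans (map_add φ ⟨x, hx⟩ ⟨y, hy⟩).symm)
    · exact (map_zero φ').trans (map_zero φ).symm
    · intro x y hx hy h4 h5
      exact (map_mul φ' ⟨x, hx⟩ ⟨y, hy⟩).trans
        ((congrArg₂ (· * ·) h4 h5).trans (map_mul φ ⟨x, hx⟩ ⟨y, hy⟩).symm)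
    · intro r x hx h4
      exact (map_smul φ' r ⟨x, hx⟩).trans
        ((congrArg (r • ·) h4).trans (map_smul φ r ⟨x, hx⟩).symm)

end BooleanDynamicalSystem

open InverseSemigroup

open InverseSemigroup

/-! ### Idempotents and domains in an inverse semigroup. -/

namespace InverseSemigroup

variable {S : Type*} [InverseSemigroup S]

/-! The isomorphism is built in the direction from $R(\mathcal B,\mathcal L,\theta)$ to functions.
The semigroup $T$ acts by left translation on the functions on its tight groupoid. Tightness of the
filters says exactly that the operators of $p_A$, $s_a$, $s_a^*$ satisfy the additive Cuntz–Krieger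
relations (`leftRegular_isCKFamily`), so the universal property makes $R(\mathcal B,\mathcal
L,\theta)$ act too. Evaluation at the characteristic function of the unit space gives the linear map
`toFunction`. It sends the image of $t\in T$ to the characteristic function of the bisection of $t$,
and it turns products into convolutions because convolving with such a function is translation by
$t$ (`convolution_indicator_bisection`). Then $\tau$ is the inverse of this map.

Surjectivity rests on $T$ being $E^*$-unitary (`T.isEStarUnitary`). This makes the intersection of
two bisections a bisection, hence all bisections clopen and compact, and their characteristic
functions span the Steinberg algebra (`bisectionSpan_eq_steinbergAlgebra`). It holds because a
nonzero idempotent $s_\alpha p_As_\beta^*$ has $\alpha=\beta$ (`eq_of_idem`): the gauge action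
separates the degrees $|\alpha|-|\beta|$.

Injectivity needs a map $T\to R(\mathcal B,\mathcal L,\theta)$, although $T$ lives in a C*-algebra.
So every coincidence of monomials there has to hold in all Cuntz–Krieger families
(`IsCKFamily.monomial_eq`). It reduces to $p_X=s_\varepsilon p_Ys_\varepsilon^*$. For the first
letter $a$ of $\varepsilon$, this forces $X$ to be regular with no letter other than $a$, and then
the relation for regular sets gives the equation everywhere. The argument uses $p_X\ne0$ for
$X\neq\emptyset$, which a representation on the boundary paths shows (`univP_ne_zero`).

The map is tight (`T.isTightRepresentation_lift`): what a finite cover leaves over is regular and is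
expanded letter by letter until the words of the cover are exhausted. Finally, a tight
representation kills every combination of elements of $T$ that vanishes as a function
(`IsTightRepresentation.sum_eq_zero`). If its image $x$ were nonzero, a maximal ideal of the
diagonal that contains the annihilator of $x$ would define a tight filter. Grouping the terms by
their germs there would give an annihilator of $x$ outside the ideal. -/

theorem star_mul_self_mul_star (s : S) : star s * s * star s = star s := by
  simpa using mul_star_mul (star s)

theorem zero_idem : (0 : S) * 0 = 0 := mul_zero 0

theorem star_mul_self_mul_idem (s : S) {e : S} (he : e * e = e) :
    star (s * e) * (s * e) = star s * s * e := by
  rw [star_mul, idem_star_eq he]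
  calc e * star s * (s * e) = e * (star s * s) * e := by simp only [mul_assoc]
    _ = star s * s * e := by
      rw [idem_comm e _ he (star_mul_self_idem s), mul_assoc, he]

/-- The elements of `S` above a nonzero idempotent are idempotent. -/
def IsEStarUnitary (S : Type*) [InverseSemigroup S] : Prop :=
  ∀ s e : S, e * e = e → e ≠ 0 → s * e = e → s * s = s

/-! ### The space of tight filters. -/

namespace TightFilter

theorem mul_mem_iff (ξ : TightFilter S) {e f : S} (he : e * e = e) (hf : f * f = f) :
    e * f ∈ ξ.carrier ↔ e ∈ ξ.carrier ∧ f ∈ ξ.carrier :=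
  ⟨fun h => ⟨mem_of_mul_mem he hf h, mem_of_mul_mem hf he (by rwa [idem_comm f e hf he])⟩,
    fun h => ξ.mul_mem _ h.1 _ h.2⟩

/-- Tightness for a single idempotent $e$, where the covering elements need not lie below $e$:
multiplying them by $e$ gives a cover of $E^{\{e\},\emptyset}$. -/
theorem exists_mem_of_cover (ξ : TightFilter S) {e : S} (he : e ∈ ξ.carrier) {Z : Set S}
    (hZ : Z.Finite) (hZi : ∀ z ∈ Z, z * z = z)
    (hc : ∀ f, f * f = f → f * e = f → f ≠ 0 → ∃ z ∈ Z, f * z ≠ 0) :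
    ∃ z ∈ Z, z ∈ ξ.carrier := by
  have hei := ξ.idem e he
  obtain ⟨_, ⟨z, hz, rfl⟩, h⟩ := ξ.tight {e} ∅ ((e * ·) '' Z) (Set.finite_singleton e)
    Set.finite_empty (hZ.image _) (by rintro _ rfl; exact hei) (by simp)
    (by
      refine ⟨?_, ?_⟩
      · rintro _ ⟨z, hz, rfl⟩
        refine ⟨idem_mul_idem hei (hZi z hz), ?_, by simp⟩
        intro x hx
        rw [Set.mem_singleton_iff.1 hx]
        simp only
        rw [idem_comm e z hei (hZi z hz), mul_assoc, hei]
      · rintro f ⟨h1, h2, -⟩ h0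
        have hfe := h2 e rfl
        obtain ⟨z, hz, h3⟩ := hc f h1 hfe h0
        exact ⟨_, ⟨z, hz, rfl⟩, by simp only; rwa [← mul_assoc, hfe]⟩)
    (by simpa using he) (by simp)
  exact ⟨z, hz, ((ξ.mul_mem_iff hei (hZi z hz)).1 h).2⟩

/-- Since $(se)^*(se)=s^*s\,e$, whether $\xi$ lies in the domain of $s$ depends only on the
behaviour of $s$ below an element of $\xi$. -/
theorem star_mul_self_mem_of_mul_eq (ξ : TightFilter S) {s t e : S}
    (ht : star t * t ∈ ξ.carrier) (he : e ∈ ξ.carrier) (h : s * e = t * e) :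
    star s * s ∈ ξ.carrier := by
  have hei := ξ.idem e he
  refine mem_of_mul_mem (star_mul_self_idem s) hei ?_
  rw [← star_mul_self_mul_idem s hei, h, star_mul_self_mul_idem t hei]
  exact ξ.mul_mem _ ht _ he

theorem star_mul_mem {ξ : TightFilter S} {r t : S} (hr : star (r * t) * (r * t) ∈ ξ.carrier) :
    star t * t ∈ ξ.carrier := by
  refine ξ.upward _ hr _ (star_mul_self_idem t) ?_
  calc star (r * t) * (r * t) * (star t * t) = star (r * t) * (r * (t * star t * t)) := by
        simp only [mul_assoc]
    _ = star (r * t) * (r * t) := by rw [mul_star_mul]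

/-- The limit of an ultrafilter of tight filters that contain a fixed idempotent. -/
def ultraLimit (𝒰 : Ultrafilter (TightFilter S)) (e : S) (he : dom e ∈ 𝒰) : TightFilter S where
  carrier := {f | dom f ∈ 𝒰}
  idem f hf := by
    obtain ⟨ξ, hξ⟩ := 𝒰.nonempty_of_mem hf
    exact ξ.idem f hξ
  nonempty := ⟨e, he⟩
  zero_notMem h := by
    obtain ⟨ξ, hξ⟩ := 𝒰.nonempty_of_mem h
    exact ξ.zero_notMem hξ
  mul_mem f hf g hg := by
    filter_upwards [hf, hg] with ξ h1 h2 using ξ.mul_mem f h1 g h2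
  upward f hf g hg h := by
    filter_upwards [hf] with ξ h1 using ξ.upward f h1 g hg h
  tight X Y Z hX hY hZ hXi hYi hc hXs hYs := by
    -- Finiteness of `X` and `Y` makes their conditions hold on one common member of the
    -- ultrafilter; finiteness of `Z` then selects a single `z`.
    have h1 : ∀ᶠ ξ in (𝒰 : Filter (TightFilter S)), ∀ x ∈ X, x ∈ ξ.carrier :=
      (Filter.eventually_all_finite hX).2 fun x hx => hXs hx
    have h2 : ∀ᶠ ξ in (𝒰 : Filter (TightFilter S)), ∀ y ∈ Y, y ∉ ξ.carrier :=
      (Filter.eventually_all_finite hY).2 fun y hy =>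
        Ultrafilter.compl_mem_iff_notMem.2 (Set.disjoint_left.1 hYs hy)
    have h3 : (⋃ z ∈ Z, dom z) ∈ 𝒰 := by
      filter_upwards [h1, h2] with ξ h4 h5
      obtain ⟨z, hz, hz'⟩ := ξ.tight X Y Z hX hY hZ hXi hYi hc h4 (Set.disjoint_left.2 h5)
      exact Set.mem_biUnion hz hz'
    exact (Ultrafilter.finite_biUnion_mem_iff hZ).1 h3

/-- An ultrafilter that contains `dom e` converges to its `ultraLimit`, as it decides each subbasic
set `dom f` in the same way as the limit does. Containing $e$ keeps the limit nonempty. -/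
theorem isCompact_dom (e : S) : IsCompact (dom e) := by
  rw [isCompact_iff_ultrafilter_le_nhds]
  intro 𝒰 h𝒰
  have he : dom e ∈ 𝒰 := Filter.le_principal_iff.1 h𝒰
  refine ⟨ultraLimit 𝒰 e he, he, ?_⟩
  rw [TopologicalSpace.nhds_generateFrom]
  refine le_iInf₂ fun U hU => Filter.le_principal_iff.2 ?_
  obtain ⟨hξ, f, hf, rfl | rfl⟩ := hU
  · exact hξ
  · exact Ultrafilter.compl_mem_iff_notMem.2 hξ

theorem isOpen_dom {e : S} (he : e * e = e) : IsOpen (dom e) :=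
  TopologicalSpace.isOpen_generateFrom_of_mem ⟨e, he, Or.inl rfl⟩

theorem isOpen_dom_compl {e : S} (he : e * e = e) : IsOpen (dom e)ᶜ :=
  TopologicalSpace.isOpen_generateFrom_of_mem ⟨e, he, Or.inr rfl⟩

end TightFilter

/-! ### Germs and their bisections. -/

namespace TightGroupoid

open TightFilter

theorem exists_germ (c : TightGroupoid S) : ∃ (s : S) (ξ : TightFilter S)
    (hs : star s * s ∈ ξ.carrier), c = germ s ξ hs := by
  obtain ⟨⟨s, ξ, hs⟩, rfl⟩ := Quotient.exists_rep c
  exact ⟨s, ξ, hs, rfl⟩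

theorem germ_mem_Θ {s t : S} {ξ : TightFilter S} {hs : star s * s ∈ ξ.carrier}
    {U : Set (TightFilter S)} :
    germ s ξ hs ∈ Θ t U ↔ star t * t ∈ ξ.carrier ∧ ξ ∈ U ∧ ∃ e ∈ ξ.carrier, s * e = t * e := by
  constructor
  · rintro ⟨η, ht, hU, h⟩
    obtain ⟨rfl, h'⟩ := germ_eq_iff.1 h
    exact ⟨ht, hU, h'⟩
  · rintro ⟨ht, hU, h⟩
    exact ⟨ξ, ht, hU, germ_eq_iff.2 ⟨rfl, h⟩⟩

/-- The bisection of all germs of `t`. -/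
def bisection (t : S) : Set (TightGroupoid S) := Θ t (dom (star t * t))

theorem germ_mem_bisection {s t : S} {ξ : TightFilter S} {hs : star s * s ∈ ξ.carrier} :
    germ s ξ hs ∈ bisection t ↔ star t * t ∈ ξ.carrier ∧ ∃ e ∈ ξ.carrier, s * e = t * e := by
  rw [bisection, germ_mem_Θ]
  exact ⟨fun h => ⟨h.1, h.2.2⟩, fun h => ⟨h.1, h.1, h.2⟩⟩

/-! ### The left regular representation -/

section regular

variable {R : Type*}

theorem left_mul_congr {r s t e : S} (h : s * e = t * e) :
    r * s * e = r * t * e := by rw [mul_assoc, h, mul_assoc]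

open Classical in
/-- Left translation of functions on the tight groupoid by an element of `S`. -/
noncomputable def translate [Zero R] (t : S) (g : TightGroupoid S → R) : TightGroupoid S → R :=
  Quotient.lift (fun x : PreGerm S =>
    -- The value at $[s,\xi]$ is taken from $[t^*s,\xi]$. It is 0 where this germ does not exist,
    -- that is, where the range of $[s,\xi]$ is outside the domain of $t^*$.
    if h : star (star t * x.elt) * (star t * x.elt) ∈ x.point.carrier then
      g (germ (star t * x.elt) x.point h) else 0) (by
    rintro ⟨s, ξ, hs⟩ ⟨r, η, hr⟩ ⟨h, e, he, h2⟩
    simp only at h he h2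
    subst h
    have h3 : star t * s * e = star t * r * e := left_mul_congr h2
    by_cases h4 : star (star t * s) * (star t * s) ∈ ξ.carrier
    · have h5 := ξ.star_mul_self_mem_of_mul_eq h4 he h3.symm
      simp only [dif_pos h4, dif_pos h5]
      congr 1
      exact germ_eq_iff.2 ⟨rfl, e, he, h3⟩
    · have h5 : star (star t * r) * (star t * r) ∉ ξ.carrier := fun h5 =>
        h4 (ξ.star_mul_self_mem_of_mul_eq h5 he h3)
      simp only [dif_neg h4, dif_neg h5])

theorem translate_germ_pos [Zero R] (t : S) (g : TightGroupoid S → R) {s : S} {ξ : TightFilter S}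
    {hs : star s * s ∈ ξ.carrier} (h : star (star t * s) * (star t * s) ∈ ξ.carrier) :
    translate t g (germ s ξ hs) = g (germ (star t * s) ξ h) := dif_pos h

theorem translate_germ_neg [Zero R] (t : S) (g : TightGroupoid S → R) {s : S} {ξ : TightFilter S}
    {hs : star s * s ∈ ξ.carrier} (h : star (star t * s) * (star t * s) ∉ ξ.carrier) :
    translate t g (germ s ξ hs) = 0 := dif_neg h

/-- The domain of $t^*r^*s$ is contained in that of $r^*s$, so the extensions by zero on the two
sides match. -/
theorem translate_mul [Zero R] (r t : S) (g : TightGroupoid S → R) :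
    translate (r * t) g = translate r (translate t g) := by
  funext c
  obtain ⟨s, ξ, hs, rfl⟩ := exists_germ c
  have h0 : star (r * t) * s = star t * (star r * s) := by rw [star_mul, mul_assoc]
  by_cases h1 : star (star (r * t) * s) * (star (r * t) * s) ∈ ξ.carrier
  · rw [translate_germ_pos _ _ h1]
    have h2 : star (star t * (star r * s)) * (star t * (star r * s)) ∈ ξ.carrier := h0 ▸ h1
    rw [translate_germ_pos _ _ (star_mul_mem h2), translate_germ_pos _ _ h2]
    congr 1
    exact germ_eq_iff.2 ⟨rfl, _, hs, by rw [h0]⟩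
  · rw [translate_germ_neg _ _ h1]
    by_cases h2 : star (star r * s) * (star r * s) ∈ ξ.carrier
    · rw [translate_germ_pos _ _ h2, translate_germ_neg _ _ (h0 ▸ h1)]
    · rw [translate_germ_neg _ _ h2]

theorem translate_zero [Zero R] (g : TightGroupoid S → R) : translate 0 g = 0 := by
  funext c
  obtain ⟨s, ξ, hs, rfl⟩ := exists_germ c
  refine translate_germ_neg _ _ fun h => ξ.zero_notMem ?_
  have h0 : star (0 : S) = 0 := idem_star_eq zero_idem
  rwa [h0, zero_mul, mul_zero] at h

open Classical in
-- The elements $es$ and $s$ agree on the idempotent $s^*es$, which lies in $\xi$ exactly when $e$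
-- lies in $s\cdot\xi$. Hence relations among idempotents can be checked filter by filter.
theorem translate_idem [Zero R] {e : S} (he : e * e = e) (g : TightGroupoid S → R)
    (c : TightGroupoid S) : translate e g c = if e ∈ (range c).carrier then g c else 0 := by
  obtain ⟨s, ξ, hs, rfl⟩ := exists_germ c
  have key : star (star e * s) * (star e * s) = star s * e * s := by
    rw [idem_star_eq he, star_mul, idem_star_eq he, mul_assoc (star s), ← mul_assoc e e, he,
      ← mul_assoc]
  change _ = if e ∈ (ξ.act s hs).carrier then _ else _
  by_cases h : star s * e * s ∈ ξ.carrier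
  · rw [if_pos (show e ∈ (ξ.act s hs).carrier from ⟨he, h⟩),
      translate_germ_pos _ _ (by rwa [key])]
    congr 1
    refine germ_eq_iff.2 ⟨rfl, _, h, ?_⟩
    have hss := mul_star_self_idem s
    rw [idem_star_eq he]
    calc e * s * (star s * e * s) = e * (s * star s) * (e * s) := by simp only [mul_assoc]
      _ = s * star s * (e * (e * s)) := by rw [idem_comm e _ he hss]; simp only [mul_assoc]
      _ = s * (star s * e * s) := by rw [← mul_assoc e e, he]; simp only [mul_assoc]
  · rw [if_neg (fun h' : e ∈ (ξ.act s hs).carrier => h h'.2),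
      translate_germ_neg _ _ (by rwa [key])]

variable [CommRing R]

theorem translate_add (t : S) (f g : TightGroupoid S → R) :
    translate t (f + g) = translate t f + translate t g := by
  funext c
  obtain ⟨s, ξ, hs, rfl⟩ := exists_germ c
  by_cases h : star (star t * s) * (star t * s) ∈ ξ.carrier
  · simp only [Pi.add_apply, translate_germ_pos _ _ h]
  · simp only [Pi.add_apply, translate_germ_neg _ _ h, add_zero]

theorem translate_smul (t : S) (r : R) (g : TightGroupoid S → R) :
    translate t (r • g) = r • translate t g := by
  funext c
  obtain ⟨s, ξ, hs, rfl⟩ := exists_germ c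
  by_cases h : star (star t * s) * (star t * s) ∈ ξ.carrier
  · simp only [Pi.smul_apply, translate_germ_pos _ _ h]
  · simp only [Pi.smul_apply, translate_germ_neg _ _ h, smul_zero]

variable (R) in
/-- The left regular representation of `S` on the functions on its tight groupoid. -/
noncomputable def leftRegular (t : S) : Module.End R (TightGroupoid S → R) where
  toFun := translate t
  map_add' := translate_add t
  map_smul' := translate_smul t

theorem leftRegular_apply (t : S) (g : TightGroupoid S → R) :
    leftRegular R t g = translate t g := rfl

theorem leftRegular_mul (r t : S) :
    leftRegular R (r * t) = leftRegular R r * leftRegular R t :=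
  LinearMap.ext fun g => translate_mul r t g

theorem leftRegular_zero : leftRegular R (0 : S) = 0 :=
  LinearMap.ext fun g => translate_zero g

variable (S) in
/-- The set of the units of the tight groupoid. -/
def units : Set (TightGroupoid S) :=
  {c | ∃ (ξ : TightFilter S) (e : S) (he : star e * e ∈ ξ.carrier), e * e = e ∧ c = germ e ξ he}

theorem germ_mem_units {s : S} {ξ : TightFilter S} {hs : star s * s ∈ ξ.carrier} :
    germ s ξ hs ∈ units S ↔ ∃ e ∈ ξ.carrier, s * e = e := by
  constructor
  · rintro ⟨η, e, he, hei, h⟩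
    obtain ⟨rfl, f, hf, h⟩ := germ_eq_iff.1 h
    rw [idem_star_eq hei, hei] at he
    have hfi := ξ.idem f hf
    refine ⟨e * f, ξ.mul_mem _ he _ hf, ?_⟩
    rw [idem_comm e f hei hfi, ← mul_assoc, h, mul_assoc, ← idem_comm e f hei hfi, ← mul_assoc, hei]
  · rintro ⟨e, he, h⟩
    have hei := ξ.idem e he
    exact ⟨ξ, e, by rwa [idem_star_eq hei, hei], hei, germ_eq_iff.2 ⟨rfl, e, he, by rw [h, hei]⟩⟩

/-- In groupoid terms, $[t,\cdot]^{-1}[s,\xi]$ is a unit exactly when $[s,\xi]$ is a germ of $t$. -/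
theorem germ_star_mul_mem_units {s t : S} {ξ : TightFilter S} (hs : star s * s ∈ ξ.carrier) :
    (∃ h : star (star t * s) * (star t * s) ∈ ξ.carrier, germ (star t * s) ξ h ∈ units S) ↔
      germ s ξ hs ∈ bisection t := by
  rw [germ_mem_bisection]
  constructor
  · rintro ⟨h, hu⟩
    obtain ⟨e, he, h1⟩ := germ_mem_units.1 hu
    have hei := ξ.idem e he
    -- The idempotent $e$ lies below $s^*tt^*s$, so $tt^*$ may be inserted in front of $se$; then
    -- $t^*se=e$ turns $se$ into $te$.
    have h2 : star s * t * star t * s * e = e := by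
      have h3 : e * (star s * t) = e := by
        have := congrArg star h1
        simpa [star_mul, idem_star_eq hei] using this
      have h4 := conj_idem s (mul_star_self_idem t)
      have h5 : star s * (t * star t) * s * e = e * (star s * (t * star t) * s) :=
        idem_comm _ _ h4 hei
      calc star s * t * star t * s * e = star s * (t * star t) * s * e := by simp only [mul_assoc]
        _ = e * e * (star s * (t * star t) * s) := by rw [h5, hei]
        _ = e * (star s * (t * star t) * s * e) := by rw [h5, mul_assoc]
        _ = e * (star s * t) * (star t * s * e) := by simp only [mul_assoc]
        _ = e := by rw [h3, h1, hei]
    refine ⟨ξ.upward e he _ (star_mul_self_idem t) ?_, e, he, ?_⟩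
    · rw [idem_comm e _ hei (star_mul_self_idem t)]
      calc star t * t * e = star t * t * (star t * s * e) := by rw [h1]
        _ = (star t * t * star t) * s * e := by simp only [mul_assoc]
        _ = e := by rw [star_mul_self_mul_star, h1]
    · calc s * e = s * star s * (t * star t) * s * e := by
            conv_lhs => rw [← h2]
            simp only [mul_assoc]
        _ = t * star t * (s * star s * s) * e := by
            rw [idem_comm _ _ (mul_star_self_idem s) (mul_star_self_idem t)]
            simp only [mul_assoc]
        _ = t * (star t * s * e) := by rw [mul_star_mul]; simp only [mul_assoc]
        _ = t * e := by rw [h1]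
  · rintro ⟨ht, e, he, h⟩
    have hei := ξ.idem e he
    have hti := star_mul_self_idem t
    have h1 : star t * s * (e * (star t * t)) = e * (star t * t) := by
      calc star t * s * (e * (star t * t)) = star t * (s * e) * (star t * t) := by
            simp only [mul_assoc]
        _ = star t * t * e * (star t * t) := by rw [h]; simp only [mul_assoc]
        _ = e * (star t * t) := by rw [← idem_comm e _ hei hti, mul_assoc, hti]
    have hm := ξ.mul_mem _ he _ ht
    have hmi := ξ.idem _ hm
    have h2 : star (star t * s) * (star t * s) ∈ ξ.carrier :=
      ξ.star_mul_self_mem_of_mul_eq (t := e * (star t * t)) (e := e * (star t * t))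
        (by rw [idem_star_eq hmi, hmi]; exact hm) hm (by rw [h1, hmi])
    exact ⟨h2, germ_mem_units.2 ⟨_, hm, h1⟩⟩

theorem leftRegular_indicator_units (t : S) :
    leftRegular R t ((units S).indicator 1) = (bisection t).indicator 1 := by
  classical
  funext c
  obtain ⟨s, ξ, hs, rfl⟩ := exists_germ c
  rw [leftRegular_apply]
  by_cases h : germ s ξ hs ∈ bisection t
  · obtain ⟨h1, h2⟩ := (germ_star_mul_mem_units hs).2 h
    rw [translate_germ_pos _ _ h1, Set.indicator_of_mem h2, Set.indicator_of_mem h]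
    rfl
  · rw [Set.indicator_of_notMem h]
    by_cases h1 : star (star t * s) * (star t * s) ∈ ξ.carrier
    · rw [translate_germ_pos _ _ h1, Set.indicator_of_notMem]
      exact fun h2 => h ((germ_star_mul_mem_units hs).1 ⟨h1, h2⟩)
    · exact translate_germ_neg _ _ h1

/-! ### Convolution with the characteristic function of a bisection -/

/-- A bisection contains at most one germ with a given range, so in a factorization of $[s,\xi]$ a
first factor from the bisection of $t$ determines both factors. -/
theorem IsComp.eq_germ {a b : TightGroupoid S} {s t : S} {ξ : TightFilter S}
    {hs : star s * s ∈ ξ.carrier} (h : IsComp a b (germ s ξ hs)) (ha : a ∈ bisection t) :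
    ∃ (h1 : star (star t * s) * (star t * s) ∈ ξ.carrier)
      (h2 : star t * t ∈ (ξ.act _ h1).carrier),
      a = germ t (ξ.act _ h1) h2 ∧ b = germ (star t * s) ξ h1 := by
  obtain ⟨s', t', ξ', ht', hs', rfl, rfl, h3⟩ := h
  obtain ⟨rfl, f, hf, h3⟩ := germ_eq_iff.1 h3
  obtain ⟨ht, e, he, h4⟩ := germ_mem_bisection.1 ha
  have hei := TightFilter.idem _ e he
  have hti := star_mul_self_idem t
  have hm : star t' * (star t * t * e) * t' ∈ ξ.carrier :=
    (TightFilter.mul_mem _ _ ht _ he).2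
  -- Conjugation by $t'$ pulls an idempotent of the filter $t'\cdot\xi$ back to $\xi$, where it can
  -- be combined with $f$.
  set e' := star t' * (star t * t * e) * t' with he'
  have hte : t' * e' = star t * t * e * t' := by
    have h5 := idem_mul_idem hti hei
    calc t' * e' = t' * star t' * (star t * t * e) * t' := by rw [he']; simp only [mul_assoc]
      _ = star t * t * e * (t' * star t' * t') := by
        rw [idem_comm _ _ (mul_star_self_idem t') h5]; simp only [mul_assoc]
      _ = _ := by rw [mul_star_mul]
  have hse : s' * t' * e' = t * e * t' := by
    calc s' * t' * e' = s' * (star t * t * e) * t' := by rw [mul_assoc, hte]; simp only [mul_assoc]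
      _ = s' * e * (star t * t) * t' := by rw [← idem_comm e _ hei hti]; simp only [mul_assoc]
      _ = t * (e * (star t * t)) * t' := by rw [h4]; simp only [mul_assoc]
      _ = t * star t * t * e * t' := by rw [idem_comm e _ hei hti]; simp only [mul_assoc]
      _ = _ := by rw [mul_star_mul]
  have hfi := ξ.idem _ hf
  have hei' := ξ.idem _ hm
  have key : star t * s * (e' * f) = t' * (e' * f) := by
    calc star t * s * (e' * f) = star t * (s * f) * e' := by
          rw [idem_comm _ _ hei' hfi]; simp only [mul_assoc]
      _ = star t * (s' * t' * e') * f := by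
          rw [h3]; simp only [mul_assoc]; rw [← idem_comm e' f hei' hfi]
      _ = t' * (e' * f) := by rw [hse, ← mul_assoc t', hte]; simp only [mul_assoc]
  have hmf := ξ.mul_mem _ hm _ hf
  have h1 := ξ.star_mul_self_mem_of_mul_eq ht' hmf key
  have hact : ξ.act t' ht' = ξ.act (star t * s) h1 := act_congr hmf key.symm
  refine ⟨h1, hact ▸ ht, ?_, germ_eq_iff.2 ⟨rfl, _, hmf, key.symm⟩⟩
  exact germ_eq_iff.2 ⟨hact, e, he, h4⟩

theorem isComp_germ {s t : S} {ξ : TightFilter S} {hs : star s * s ∈ ξ.carrier}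
    (h1 : star (star t * s) * (star t * s) ∈ ξ.carrier) :
    ∃ h2 : star t * t ∈ (ξ.act _ h1).carrier,
      IsComp (germ t (ξ.act _ h1) h2) (germ (star t * s) ξ h1) (germ s ξ hs) := by
  have h2 : star t * t ∈ (ξ.act _ h1).carrier := by
    refine ⟨star_mul_self_idem t, ?_⟩
    have : star (star t * s) * (star t * t) * (star t * s) =
        star (star t * s) * (star t * s) := by
      calc _ = star (star t * s) * ((star t * t * star t) * s) := by simp only [mul_assoc]
        _ = _ := by rw [star_mul_self_mul_star]
    rwa [this]
  refine ⟨h2, t, star t * s, ξ, h1, h2, rfl, rfl, ?_⟩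
  refine germ_eq_iff.2 ⟨rfl, _, h1, ?_⟩
  have : s * (star (star t * s) * (star t * s)) = t * star t * s := by
    calc _ = s * star s * (t * star t) * s := by
          rw [star_mul, star_star]; simp only [mul_assoc]
      _ = t * star t * (s * star s * s) := by
          rw [idem_comm _ _ (mul_star_self_idem s) (mul_star_self_idem t)]; simp only [mul_assoc]
      _ = _ := by rw [mul_star_mul]
  rw [this]
  calc t * star t * s = t * star t * (s * (star (star t * s) * (star t * s))) := by
        rw [this, ← mul_assoc, mul_star_self_idem]
    _ = _ := by simp only [mul_assoc]

theorem subsingleton_isComp_bisection (t : S) (c : TightGroupoid S) :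
    {x : {x : TightGroupoid S × TightGroupoid S // IsComp x.1 x.2 c} |
      x.1.1 ∈ bisection t}.Subsingleton := by
  obtain ⟨s, ξ, hs, rfl⟩ := exists_germ c
  rintro ⟨⟨a, b⟩, hx⟩ ha ⟨⟨a', b'⟩, hx'⟩ ha'
  obtain ⟨h1, h2, h3, h4⟩ := hx.eq_germ ha
  obtain ⟨h1', h2', h3', h4'⟩ := hx'.eq_germ ha'
  simp only at h3 h4 h3' h4'
  subst h3 h4 h3' h4'
  rfl

/-- The convolution sum has at most one nonzero term, that of the factorization through
$[t^*s,\xi]$, and none when this germ is undefined. This links convolution with the left regular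
representation. -/
theorem convolution_indicator_bisection (t : S) (g : TightGroupoid S → R) :
    convolution ((bisection t).indicator 1) g = leftRegular R t g := by
  funext c
  have hsub := subsingleton_isComp_bisection t c
  obtain ⟨s, ξ, hs, rfl⟩ := exists_germ c
  rw [leftRegular_apply, convolution]
  by_cases h1 : star (star t * s) * (star t * s) ∈ ξ.carrier
  · obtain ⟨h2, hc⟩ := isComp_germ (hs := hs) h1
    rw [translate_germ_pos _ _ h1]
    generalize hb : germ (star t * s) ξ h1 = b at hc
    have hmem : germ t (ξ.act _ h1) h2 ∈ bisection t := ⟨_, h2, h2, rfl⟩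
    generalize germ t (ξ.act _ h1) h2 = a at hc hmem
    rw [finsum_eq_single _ ⟨(a, b), hc⟩]
    · rw [Set.indicator_of_mem hmem, Pi.one_apply, one_mul]
    intro x hx
    rw [Set.indicator_of_notMem, zero_mul]
    exact fun hx' => hx (hsub hx' hmem)
  · rw [translate_germ_neg _ _ h1]
    refine finsum_eq_zero_of_forall_eq_zero fun x => ?_
    rw [Set.indicator_of_notMem, zero_mul]
    exact fun hx => h1 (x.2.eq_germ hx).1

variable (S R) in
/-- The linear span of the characteristic functions of the bisections. -/
def bisectionSpan : Submodule R (TightGroupoid S → R) :=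
  Submodule.span R (Set.range fun t : S => (bisection t).indicator 1)

theorem indicator_bisection_mem (t : S) : (bisection t).indicator 1 ∈ bisectionSpan S R :=
  Submodule.subset_span ⟨t, rfl⟩

/-- A `finsum` with infinite support is 0 by convention and so is not additive in general. This
finiteness makes convolution linear in its left argument. -/
theorem finite_isComp_of_mem_bisectionSpan {f : TightGroupoid S → R} (hf : f ∈ bisectionSpan S R)
    (c : TightGroupoid S) :
    {x : {x : TightGroupoid S × TightGroupoid S // IsComp x.1 x.2 c} | f x.1.1 ≠ 0}.Finite := by
  refine Submodule.span_induction ?_ ?_ ?_ ?_ hf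
  · rintro _ ⟨t, rfl⟩
    refine ((subsingleton_isComp_bisection t c).finite).subset fun x hx => ?_
    by_contra h
    exact hx (Set.indicator_of_notMem (s := bisection t) h _)
  · simp
  · intro f g _ _ h1 h2
    refine (h1.union h2).subset fun x hx => ?_
    by_contra h
    simp only [Set.mem_union, Set.mem_ofPred_eq, not_or, not_not] at h
    exact hx (by simp [h.1, h.2])
  · intro r f _ h1
    refine h1.subset fun x hx h => hx ?_
    simp [h]

theorem convolution_add_left {f f' : TightGroupoid S → R} (hf : f ∈ bisectionSpan S R)
    (hf' : f' ∈ bisectionSpan S R) (g : TightGroupoid S → R) :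
    convolution (f + f') g = convolution f g + convolution f' g := by
  funext c
  simp only [convolution, Pi.add_apply, add_mul]
  refine finsum_add_distrib ?_ ?_
  · exact (finite_isComp_of_mem_bisectionSpan hf c).subset fun x hx h => hx (by simp [h])
  · exact (finite_isComp_of_mem_bisectionSpan hf' c).subset fun x hx h => hx (by simp [h])

theorem convolution_smul_left {f : TightGroupoid S → R} (hf : f ∈ bisectionSpan S R) (r : R)
    (g : TightGroupoid S → R) : convolution (r • f) g = r • convolution f g := by
  funext c
  simp only [convolution, Pi.smul_apply, smul_mul_assoc]
  exact (smul_finsum' r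
    ((finite_isComp_of_mem_bisectionSpan hf c).subset fun x hx h => hx (by simp [h]))).symm

theorem convolution_zero_left (g : TightGroupoid S → R) : convolution 0 g = 0 := by
  funext c
  simp [convolution]

end regular

/-! ### Topology of the bisections of an $E^*$-unitary inverse semigroup. -/

theorem Θ_eq_inter (t : S) (U : Set (TightFilter S)) :
    Θ t U = bisection t ∩ source ⁻¹' U := by
  ext c
  obtain ⟨s, ξ, hs, rfl⟩ := exists_germ c
  rw [Set.mem_inter_iff, germ_mem_Θ, germ_mem_bisection, Set.mem_preimage]
  exact ⟨fun h => ⟨⟨h.1, h.2.2⟩, h.2.1⟩, fun h => ⟨h.1.1, h.2, h.1.2⟩⟩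

theorem isOpen_Θ (t : S) {U : Set (TightFilter S)} (hU : IsOpen U) : IsOpen (Θ t U) := by
  refine TopologicalSpace.isOpen_generateFrom_of_mem
    ⟨t, U ∩ dom (star t * t), hU.inter (isOpen_dom (star_mul_self_idem t)),
      Set.inter_subset_right, ?_⟩
  ext c
  exact ⟨fun ⟨ξ, h1, h2, h3⟩ => ⟨ξ, h1, ⟨h2, h1⟩, h3⟩, fun ⟨ξ, h1, h2, h3⟩ => ⟨ξ, h1, h2.1, h3⟩⟩

/-- Cutting a bisection down to a basic clopen set of sources stays inside the family of bisections.
-/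
theorem bisection_mul_idem (t : S) {e : S} (he : e * e = e) :
    bisection (t * e) = Θ t (dom e) := by
  ext c
  obtain ⟨s, ξ, hs, rfl⟩ := exists_germ c
  rw [germ_mem_bisection, germ_mem_Θ, star_mul_self_mul_idem t he,
    ξ.mul_mem_iff (star_mul_self_idem t) he]
  constructor
  · rintro ⟨⟨h1, h2⟩, f, hf, h⟩
    refine ⟨h1, h2, e * f, ξ.mul_mem _ h2 _ hf, ?_⟩
    rw [idem_comm e f he (ξ.idem f hf), ← mul_assoc, h, mul_assoc t,
      idem_comm e f he (ξ.idem f hf), mul_assoc t, mul_assoc f, he]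
  · rintro ⟨h1, h2, f, hf, h⟩
    refine ⟨⟨h1, h2⟩, f * e, ξ.mul_mem _ hf _ h2, ?_⟩
    rw [← mul_assoc, h, mul_assoc, mul_assoc, ← idem_comm e f he (ξ.idem f hf), ← mul_assoc e, he]

/-- In an `E*`-unitary inverse semigroup, any two elements have a greatest lower bound. -/
theorem exists_bisection_inter (hS : IsEStarUnitary S) (s t : S) :
    ∃ m : S, bisection s ∩ bisection t = bisection m ∧ ∃ h, h * h = h ∧ m = s * h := by
  -- If $t^*s$ is idempotent, the meet is $tt^*s$. If not, $s$ and $t$ have no common germ, since a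
  -- common germ puts a nonzero idempotent below $t^*s$.
  by_cases h : star t * s * (star t * s) = star t * s
  · have hh : star (star t * s) = star t * s := idem_star_eq h
    rw [star_mul, star_star] at hh
    refine ⟨t * star t * s, ?_, star s * (t * star t) * s, conj_idem s (mul_star_self_idem t), ?_⟩
    swap
    · calc t * star t * s = t * star t * (s * star s * s) := by rw [mul_star_mul]
        _ = s * star s * (t * star t) * s := by
          rw [idem_comm _ _ (mul_star_self_idem s) (mul_star_self_idem t)]; simp only [mul_assoc]
        _ = _ := by simp only [mul_assoc]
    have hts : t * star t * s = t * (star t * s) := mul_assoc _ _ _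
    ext c
    obtain ⟨r, ξ, hr, rfl⟩ := exists_germ c
    rw [Set.mem_inter_iff, germ_mem_bisection, germ_mem_bisection, germ_mem_bisection, hts,
      star_mul_self_mul_idem t h, ξ.mul_mem_iff (star_mul_self_idem t) h]
    constructor
    · rintro ⟨⟨h1, e, he, h2⟩, h3, f, hf, h4⟩
      have hei := ξ.idem e he
      have hfi := ξ.idem f hf
      have hst : s * (e * f) = t * (e * f) := by
        calc s * (e * f) = r * e * f := by rw [h2, mul_assoc]
          _ = r * f * e := by rw [mul_assoc, idem_comm e f hei hfi, mul_assoc]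
          _ = t * (e * f) := by rw [h4, idem_comm e f hei hfi, mul_assoc]
      have hm := ξ.mul_mem _ he _ hf
      have h5 : star t * s * (e * f) = star t * t * (e * f) := left_mul_congr hst |>.trans rfl
      refine ⟨⟨h3, ?_⟩, e * f, hm, ?_⟩
      · refine mem_of_mul_mem h (idem_mul_idem hei hfi) ?_
        rw [h5]
        exact ξ.mul_mem _ h3 _ hm
      · calc r * (e * f) = s * (e * f) := by rw [← mul_assoc, h2, mul_assoc]
          _ = t * (star t * t * (e * f)) := by
            rw [hst, ← mul_assoc t (star t * t), ← mul_assoc t (star t), mul_star_mul]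
          _ = t * (star t * s) * (e * f) := by rw [← h5]; simp only [mul_assoc]
    · rintro ⟨⟨h1, h2⟩, e, he, h3⟩
      have hei := ξ.idem e he
      have hm := ξ.mul_mem _ h2 _ he
      have hse : star s * s * (star t * s) = star t * s := by
        calc star s * s * (star t * s) = star s * s * (star s * t) := by rw [hh]
          _ = star s * s * star s * t := by rw [← mul_assoc]
          _ = _ := by rw [star_mul_self_mul_star, hh]
      refine ⟨⟨ξ.upward _ h2 _ (star_mul_self_idem s) ?_, star t * s * e, hm, ?_⟩,
        h1, star t * s * e, hm, ?_⟩
      · rw [idem_comm _ _ h (star_mul_self_idem s), hse]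
      · calc r * (star t * s * e) = r * e * (star t * s) := by
              rw [idem_comm _ _ h hei, mul_assoc]
          _ = t * (star t * s * e) * (star t * s) := by rw [h3]; simp only [mul_assoc]
          _ = t * (star t * s * (star t * s)) * e := by
            rw [mul_assoc, mul_assoc (star t * s) e, ← idem_comm _ _ h hei]
            simp only [mul_assoc]
          _ = s * star s * (t * star t) * s * e := by
            rw [h, ← hts, idem_comm _ _ (mul_star_self_idem s) (mul_star_self_idem t),
              mul_assoc (t * star t) (s * star s), mul_star_mul]
          _ = s * (star s * t * (star t * s)) * e := by simp only [mul_assoc]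
          _ = s * (star t * s * e) := by rw [hh, h]; simp only [mul_assoc]
      · calc r * (star t * s * e) = r * e * (star t * s) := by
              rw [idem_comm _ _ h hei, mul_assoc]
          _ = t * (star t * s * e) * (star t * s) := by rw [h3]; simp only [mul_assoc]
          _ = t * (star t * s * (star t * s)) * e := by
            rw [mul_assoc, mul_assoc (star t * s) e, ← idem_comm _ _ h hei]
            simp only [mul_assoc]
          _ = t * (star t * s * e) := by rw [h, mul_assoc]
  · refine ⟨0, ?_, 0, zero_idem, (mul_zero s).symm⟩
    rw [Set.eq_empty_of_forall_notMem (s := bisection (0 : S)), Set.eq_empty_iff_forall_notMem]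
    · intro c
      obtain ⟨r, ξ, hr, rfl⟩ := exists_germ c
      rw [Set.mem_inter_iff, germ_mem_bisection, germ_mem_bisection]
      rintro ⟨⟨h1, e, he, h2⟩, h3, f, hf, h4⟩
      have hei := ξ.idem e he
      have hfi := ξ.idem f hf
      have hst : s * (e * f) = t * (e * f) := by
        calc s * (e * f) = r * e * f := by rw [h2, mul_assoc]
          _ = r * f * e := by rw [mul_assoc, idem_comm e f hei hfi, mul_assoc]
          _ = t * (e * f) := by rw [h4, idem_comm e f hei hfi, mul_assoc]
      have hm := ξ.mul_mem _ h3 _ (ξ.mul_mem _ he _ hf)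
      have hti := star_mul_self_idem t
      refine h (hS _ _ (ξ.idem _ hm) (fun h0 => ξ.zero_notMem (h0 ▸ hm)) ?_)
      have hc := idem_comm _ _ hti (idem_mul_idem hei hfi)
      calc star t * s * (star t * t * (e * f)) = star t * s * (e * f) * (star t * t) := by
            rw [hc, mul_assoc (star t * s)]
        _ = star t * t * (star t * t * (e * f)) := by
            rw [left_mul_congr hst, mul_assoc (star t * t), ← hc]
        _ = star t * t * (e * f) := by rw [← mul_assoc (star t * t), hti]
    · rintro _ ⟨ξ, h0, -, -⟩
      rw [mul_zero] at h0
      exact ξ.zero_notMem h0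

/-- The bisection of $t$ meets that of $s$ in the germs over a clopen set `dom h`. The remaining
germs of $s$ are an open set, which is a neighbourhood of every germ of $s$ that is not one of $t$.
-/
theorem isClosed_bisection (hS : IsEStarUnitary S) (t : S) : IsClosed (bisection t) := by
  rw [← isOpen_compl_iff, isOpen_iff_forall_mem_open]
  intro c hc
  obtain ⟨s, ξ, hs, rfl⟩ := exists_germ c
  obtain ⟨m, hm, h, hh, rfl⟩ := exists_bisection_inter hS s t
  rw [bisection_mul_idem s hh] at hm
  have hmem : germ s ξ hs ∈ bisection s := ⟨ξ, hs, hs, rfl⟩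
  refine ⟨Θ s (dom h)ᶜ, ?_, isOpen_Θ s (isOpen_dom_compl hh), ?_⟩
  · intro c hc' hct
    rw [Θ_eq_inter] at hc' hm
    exact hc'.2 (hm.subset ⟨hc'.1, hct⟩).2
  · rw [Θ_eq_inter]
    refine ⟨hmem, fun hd => hc ?_⟩
    have : germ s ξ hs ∈ bisection s ∩ bisection t := by
      rw [hm, Θ_eq_inter]
      exact ⟨hmem, hd⟩
    exact this.2

theorem isOpen_bisection (t : S) : IsOpen (bisection t) :=
  isOpen_Θ t (isOpen_dom (star_mul_self_idem t))

/-- The map $\xi\mapsto[t,\xi]$ sends the compact domain of $t$ onto the bisection. It is continuous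
because the preimage of $\Theta(s,U)$ is cut out by $U$ and the open set `dom h` over which $s$ and
$t$ have the same germs. -/
theorem isCompact_bisection (hS : IsEStarUnitary S) (t : S) : IsCompact (bisection t) := by
  have hc : Continuous fun ξ : dom (star t * t) => germ t ξ.1 ξ.2 := by
    refine continuous_generateFrom_iff.2 ?_
    rintro _ ⟨s, U, hU, -, rfl⟩
    obtain ⟨m, hm, h, hh, rfl⟩ := exists_bisection_inter hS t s
    rw [bisection_mul_idem t hh, Θ_eq_inter] at hm
    have : (fun ξ : dom (star t * t) => germ t ξ.1 ξ.2) ⁻¹' Θ s U =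
        Subtype.val ⁻¹' (dom h ∩ U) := by
      ext ξ
      have hmem : germ t ξ.1 ξ.2 ∈ bisection t := ⟨ξ.1, ξ.2, ξ.2, rfl⟩
      rw [Θ_eq_inter]
      constructor
      · rintro ⟨h1, h2⟩
        exact ⟨(hm.subset ⟨hmem, h1⟩).2, h2⟩
      · rintro ⟨h1, h2⟩
        have : germ t ξ.1 ξ.2 ∈ bisection t ∩ bisection s := by
          rw [hm]
          exact ⟨hmem, h1⟩
        exact ⟨this.2, h2⟩
    rw [this]
    exact ((isOpen_dom hh).inter hU).preimage continuous_subtype_val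
  have : bisection t = Set.range fun ξ : dom (star t * t) => germ t ξ.1 ξ.2 := by
    ext c
    constructor
    · rintro ⟨ξ, h1, -, rfl⟩
      exact ⟨⟨ξ, h1⟩, rfl⟩
    · rintro ⟨ξ, rfl⟩
      exact ⟨ξ.1, ξ.2, ξ.2, rfl⟩
  rw [this]
  have := isCompact_iff_compactSpace.1 (isCompact_dom (star t * t))
  exact isCompact_range hc

/-! ### The Steinberg algebra as the span of the bisections. -/

section steinberg

variable {R : Type*} [CommRing R]

theorem indicator_mem_steinbergAlgebra (hS : IsEStarUnitary S) (t : S) :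
    (bisection t).indicator 1 ∈ SteinbergAlgebra R S := by
  have h1 : IsLocallyConstant ((bisection t).indicator (1 : TightGroupoid S → R)) :=
    (LocallyConstant.indicator 1 ⟨isClosed_bisection hS t, isOpen_bisection t⟩).isLocallyConstant
  exact ⟨h1, (isCompact_bisection hS t).of_isClosed_subset
    ((h1.isOpen_fiber 0).isClosed_compl) Set.support_indicator_subset⟩

/-- This is the pointwise product, not the convolution. It serves to intersect neighbourhoods and to
make covers disjoint. -/
theorem bisectionSpan_mul_mem (hS : IsEStarUnitary S) {f g : TightGroupoid S → R}
    (hf : f ∈ bisectionSpan S R) (hg : g ∈ bisectionSpan S R) : f * g ∈ bisectionSpan S R := by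
  refine Submodule.span_induction ?_ ?_ ?_ ?_ hf
  · rintro _ ⟨s, rfl⟩
    refine Submodule.span_induction ?_ ?_ ?_ ?_ hg
    · rintro _ ⟨t, rfl⟩
      obtain ⟨m, hm, -⟩ := exists_bisection_inter hS s t
      have : (bisection s).indicator (1 : TightGroupoid S → R) * (bisection t).indicator 1 =
          (bisection m).indicator 1 := by
        rw [← hm, Set.inter_indicator_one]
      exact this ▸ indicator_bisection_mem m
    · rw [mul_zero]; exact zero_mem _
    · intro a b _ _ h1 h2
      rw [mul_add]; exact add_mem h1 h2
    · intro r a _ h1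
      rw [mul_smul_comm]; exact Submodule.smul_mem _ r h1
  · rw [zero_mul]; exact zero_mem _
  · intro a b _ _ h1 h2
    rw [add_mul]; exact add_mem h1 h2
  · intro r a _ h1
    rw [smul_mul_assoc]; exact Submodule.smul_mem _ r h1

/-- Both kinds of subbasic sets qualify: `dom e` through the bisection of $te$, and its complement
through a difference. Intersections are handled by pointwise products. -/
theorem exists_Θ_indicator_mem (hS : IsEStarUnitary S) {U : Set (TightFilter S)} (hU : IsOpen U)
    {t : S} {ξ : TightFilter S} (hξ : ξ ∈ U) :
    ∃ V ⊆ U, IsOpen V ∧ ξ ∈ V ∧ (Θ t V).indicator 1 ∈ bisectionSpan S R := by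
  induction hU with
  | basic U hU =>
    obtain ⟨e, he, rfl | rfl⟩ := hU
    · refine ⟨_, subset_rfl, isOpen_dom he, hξ, ?_⟩
      rw [← bisection_mul_idem t he]
      exact indicator_bisection_mem _
    · refine ⟨_, subset_rfl, isOpen_dom_compl he, hξ, ?_⟩
      have : (Θ t (dom e)ᶜ).indicator (1 : TightGroupoid S → R) =
          (bisection t).indicator 1 - (bisection (t * e)).indicator 1 := by
        rw [bisection_mul_idem t he, Θ_eq_inter, Θ_eq_inter]
        funext c
        by_cases h1 : c ∈ bisection t <;> by_cases h2 : source c ∈ dom e <;>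
          simp [Set.indicator, h1, h2]
      rw [this]
      exact sub_mem (indicator_bisection_mem _) (indicator_bisection_mem _)
  | univ =>
    refine ⟨_, subset_rfl, isOpen_univ, hξ, ?_⟩
    rw [Θ_eq_inter, Set.preimage_univ, Set.inter_univ]
    exact indicator_bisection_mem _
  | inter U U' _ _ h1 h2 =>
    obtain ⟨V, hV1, hV2, hV3, hV4⟩ := h1 hξ.1
    obtain ⟨V', hV1', hV2', hV3', hV4'⟩ := h2 hξ.2
    refine ⟨V ∩ V', Set.inter_subset_inter hV1 hV1', hV2.inter hV2', ⟨hV3, hV3'⟩, ?_⟩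
    have : Θ t (V ∩ V') = Θ t V ∩ Θ t V' := by
      rw [Θ_eq_inter, Θ_eq_inter, Θ_eq_inter, Set.preimage_inter, Set.inter_inter_distrib_left]
    rw [this, Set.inter_indicator_one]
    exact bisectionSpan_mul_mem hS hV4 hV4'
  | sUnion 𝒰 _ h =>
    obtain ⟨U, hU, hξ'⟩ := hξ
    obtain ⟨V, hV1, hV2⟩ := h U hU hξ'
    exact ⟨V, hV1.trans (Set.subset_sUnion_of_mem hU), hV2⟩

theorem exists_indicator_mem (hS : IsEStarUnitary S) {W : Set (TightGroupoid S)} (hW : IsOpen W)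
    {c : TightGroupoid S} (hc : c ∈ W) :
    ∃ V ⊆ W, IsOpen V ∧ c ∈ V ∧ V.indicator 1 ∈ bisectionSpan S R := by
  induction hW with
  | basic W hW =>
    obtain ⟨t, U, hU, -, rfl⟩ := hW
    obtain ⟨h1, h2⟩ := (Θ_eq_inter t U).subset hc
    obtain ⟨V, hV1, hV2, hV3, hV4⟩ := exists_Θ_indicator_mem (R := R) (t := t) hS hU h2
    refine ⟨Θ t V, ?_, isOpen_Θ t hV2, ?_, hV4⟩
    · rw [Θ_eq_inter, Θ_eq_inter]
      exact Set.inter_subset_inter_right _ (Set.preimage_mono hV1)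
    · rw [Θ_eq_inter]
      exact ⟨h1, hV3⟩
  | univ =>
    obtain ⟨s, ξ, hs, rfl⟩ := exists_germ c
    exact ⟨bisection s, Set.subset_univ _, isOpen_bisection s, ⟨ξ, hs, hs, rfl⟩,
      indicator_bisection_mem s⟩
  | inter U U' _ _ h1 h2 =>
    obtain ⟨V, hV1, hV2, hV3, hV4⟩ := h1 hc.1
    obtain ⟨V', hV1', hV2', hV3', hV4'⟩ := h2 hc.2
    refine ⟨V ∩ V', Set.inter_subset_inter hV1 hV1', hV2.inter hV2', ⟨hV3, hV3'⟩, ?_⟩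
    rw [Set.inter_indicator_one]
    exact bisectionSpan_mul_mem hS hV4 hV4'
  | sUnion 𝒰 _ h =>
    obtain ⟨U, hU, hξ'⟩ := hc
    obtain ⟨V, hV1, hV2⟩ := h U hU hξ'
    exact ⟨V, hV1.trans (Set.subset_sUnion_of_mem hU), hV2⟩

/-- Split off $f\,1_V$ for one member $V$ of the cover: the difference $f-f\,1_V$ vanishes on $V$
and is covered by the other members. -/
theorem mem_bisectionSpan_of_finite_cover (hS : IsEStarUnitary S)
    (𝒱 : Finset (Set (TightGroupoid S))) :
    ∀ f : TightGroupoid S → R,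
      (∀ V ∈ 𝒱, V.indicator 1 ∈ bisectionSpan S R ∧ f * V.indicator 1 ∈ bisectionSpan S R) →
      (∀ c, f c ≠ 0 → ∃ V ∈ 𝒱, c ∈ V) → f ∈ bisectionSpan S R := by
  classical
  induction 𝒱 using Finset.induction_on with
  | empty =>
    intro f _ h
    have : f = 0 := by
      funext c
      by_contra hc
      simpa using h c hc
    exact this ▸ zero_mem _
  | insert V 𝒱 _ ih =>
    intro f h1 h2
    have hV := h1 V (Finset.mem_insert_self _ _)
    have key : f - f * V.indicator 1 ∈ bisectionSpan S R := by
      refine ih _ (fun V' hV' => ?_) fun c hc => ?_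
      · have h3 := h1 V' (Finset.mem_insert_of_mem hV')
        refine ⟨h3.1, ?_⟩
        rw [sub_mul, mul_right_comm]
        exact sub_mem h3.2 (bisectionSpan_mul_mem hS h3.2 hV.1)
      · have hcV : c ∉ V := fun h => hc (by simp [h])
        obtain ⟨V', hV', h4⟩ := h2 c (fun h => hc (by simp [h]))
        rcases Finset.mem_insert.1 hV' with rfl | h5
        · exact absurd h4 hcV
        · exact ⟨V', h5, h4⟩
    simpa using add_mem key hV.2

theorem bisectionSpan_eq_steinbergAlgebra (hS : IsEStarUnitary S) :
    bisectionSpan S R = SteinbergAlgebra R S := by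
  refine le_antisymm ?_ ?_
  · refine Submodule.span_le.2 ?_
    rintro _ ⟨t, rfl⟩
    exact indicator_mem_steinbergAlgebra hS t
  · rintro f ⟨hf, hf'⟩
    -- Each point gets an open neighbourhood inside its fiber, so that $f\,1_V$ is a scalar multiple
    -- of $1_V$; compactness of the support leaves finitely many.
    choose V hV1 hV2 hV3 hV4 using fun c : TightGroupoid S =>
      exists_indicator_mem (R := R) hS (hf.isOpen_fiber (f c)) (c := c) rfl
    obtain ⟨F, -, hF⟩ := hf'.elim_nhds_subcover V fun c _ => (hV2 c).mem_nhds (hV3 c)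
    classical
    refine mem_bisectionSpan_of_finite_cover hS (F.image V) f ?_ ?_
    · intro W hW
      obtain ⟨c, hc, rfl⟩ := Finset.mem_image.1 hW
      refine ⟨hV4 c, ?_⟩
      have : f * (V c).indicator 1 = f c • (V c).indicator 1 := by
        funext d
        by_cases hd : d ∈ V c
        · have : f d = f c := hV1 c hd
          simp [hd, this]
        · simp [hd]
      rw [this]
      exact Submodule.smul_mem _ _ (hV4 c)
    · intro c hc
      obtain ⟨d, hd, hcd⟩ := Set.mem_iUnion₂.1 (hF hc)
      exact ⟨V d, Finset.mem_image_of_mem V hd, hcd⟩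

end steinberg

end TightGroupoid

/-! ### Tight representations -/

/-- A representation of `S` in an algebra that sends finite covers to joins. -/
structure IsTightRepresentation {A : Type*} [Ring A] (π : S → A) : Prop where
  map_zero : π 0 = 0
  map_mul : ∀ s t, π (s * t) = π s * π t
  -- Stated with an arbitrary left factor $y$ instead of a join. The choice $y=\prod_{z}(1-\pi(z))$
  -- shows that $\pi(e)$ lies below the join of the $\pi(z)$.
  tight : ∀ e : S, e * e = e → ∀ Z : Set S, Z.Finite → (∀ z ∈ Z, z * z = z) →
    (∀ f, f * f = f → f * e = f → f ≠ 0 → ∃ z ∈ Z, f * z ≠ 0) →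
    ∀ y : A, (∀ z ∈ Z, y * π z = 0) → y * π e = 0

namespace IsTightRepresentation

variable {R : Type*} [CommRing R] {A : Type*} [Ring A] [Algebra R A] {π : S → A}

/-- The images of the idempotents lie in a commutative ring. -/
theorem exists_diagonal (hπ : IsTightRepresentation π) :
    ∃ (C : Subring A) (_ : IsMulCommutative C), ∀ e, e * e = e → π e ∈ C := by
  refine ⟨Subring.closure (π '' {e | e * e = e}), Subring.isMulCommutative_closure ?_,
    fun e he => Subring.subset_closure ⟨e, he, rfl⟩⟩
  rintro _ ⟨e, he, rfl⟩ _ ⟨f, hf, rfl⟩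
  rw [← hπ.map_mul, ← hπ.map_mul, idem_comm e f he hf]

variable {C : Type*} [CommRing C] {ι : C →+* A} {d : S → C}

theorem diag_mul (hπ : IsTightRepresentation π) (hι : Function.Injective ι)
    (hd : ∀ e, e * e = e → ι (d e) = π e) {e f : S} (he : e * e = e) (hf : f * f = f) :
    d (e * f) = d e * d f :=
  hι (by rw [_root_.map_mul, hd _ (idem_mul_idem he hf), hd _ he, hd _ hf, hπ.map_mul])

theorem one_sub_notMem {𝔪 : Ideal C} (h𝔪 : 𝔪.IsPrime) {x : C} (hx : x ∈ 𝔪) : 1 - x ∉ 𝔪 :=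
  fun h => h𝔪.ne_top ((Ideal.eq_top_iff_one _).2 (by simpa using add_mem h hx))

/-- The annihilator of an element in the diagonal. -/
def annihilator (ι : C →+* A) (x : A) : Ideal C where
  carrier := {q | x * ι q = 0}
  add_mem' := fun {p q} hp hq => by
    change x * ι (p + q) = 0
    rw [map_add, mul_add, hp, hq, add_zero]
  zero_mem' := by
    change x * ι 0 = 0
    rw [_root_.map_zero, mul_zero]
  smul_mem' := fun p q hq => by
    change x * ι (p * q) = 0
    rw [mul_comm, _root_.map_mul, ← mul_assoc, hq, zero_mul]

/-- A prime ideal of the diagonal that does not contain all idempotents defines a tight filter. -/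
def tightFilter (hπ : IsTightRepresentation π) (hι : Function.Injective ι)
    (hd : ∀ e, e * e = e → ι (d e) = π e) (𝔪 : Ideal C) (h𝔪 : 𝔪.IsPrime)
    (hne : ∃ e, e * e = e ∧ d e ∉ 𝔪) : TightFilter S :=
  { carrier := {e | e * e = e ∧ d e ∉ 𝔪}
    idem := fun _ h => h.1
    nonempty := hne
    zero_notMem := fun h => h.2 (by
      have : d (0 : S) = 0 := hι (by rw [hd _ zero_idem, hπ.map_zero, _root_.map_zero])
      rw [this]
      exact zero_mem _)
    mul_mem := fun e he f hf => ⟨idem_mul_idem he.1 hf.1, by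
      rw [hπ.diag_mul hι hd he.1 hf.1]
      exact fun h => (h𝔪.mem_or_mem h).elim he.2 hf.2⟩
    upward := fun e he f hf hef => ⟨hf, fun h => he.2 (by
      rw [← hef, hπ.diag_mul hι hd he.1 hf]
      exact Ideal.mul_mem_left _ _ h)⟩
    tight := by
      intro X Y Z hX hY hZ hXi hYi hc hXs hYs
      by_contra hcon
      push Not at hcon
      have hZi : ∀ z ∈ Z, z * z = z := fun z hz => (hc.1 hz).1
      obtain ⟨e₀, he₀, he₀'⟩ := hne
      -- the product of the elements of `X` and of one element of the filter
      have hprod : ∃ e, e * e = e ∧ d e ∉ 𝔪 ∧ ∀ x ∈ X, e * x = e := by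
        clear hc
        induction X, hX using Set.Finite.induction_on with
        | empty => exact ⟨e₀, he₀, he₀', by simp⟩
        | @insert x X _ _ ih =>
          obtain ⟨e, he, he', hex⟩ := ih (fun x hx => hXi x (Or.inr hx)) fun x hx => hXs (Or.inr hx)
          have hx := hXs (Set.mem_insert x X)
          refine ⟨e * x, idem_mul_idem he hx.1, ?_, ?_⟩
          · rw [hπ.diag_mul hι hd he hx.1]
            exact fun h => (h𝔪.mem_or_mem h).elim he' hx.2
          · rintro y (rfl | hy)
            · rw [mul_assoc, hx.1]
            · have hyi := hXi y (Or.inr hy)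
              rw [mul_assoc, idem_comm x y hx.1 hyi, ← mul_assoc, hex y hy]
      obtain ⟨e, he, he', hex⟩ := hprod
      classical
      have hfin := (hY.union hZ)
      have hZY : ∀ z ∈ Y ∪ Z, z * z = z := by
        rintro z (hz | hz)
        · exact hYi z hz
        · exact hZi z hz
      have hZm : ∀ z ∈ Y ∪ Z, d z ∈ 𝔪 := by
        rintro z (hz | hz)
        · by_contra h
          exact Set.disjoint_left.1 hYs hz ⟨hYi z hz, h⟩
        · by_contra h
          exact hcon z hz ⟨hZi z hz, h⟩
      -- An idempotent below $e$ is either orthogonal to `Y`, hence in $E^{X,Y}$ and met by `Z`, or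
      -- it meets `Y`. So `Y ∪ Z` covers `e`, and the forbidden set is absorbed into the cover.
      have hcov : ∀ f, f * f = f → f * e = f → f ≠ 0 → ∃ z ∈ Y ∪ Z, f * z ≠ 0 := by
        intro f hf hfe hf0
        by_contra hall
        push Not at hall
        obtain ⟨z, hz, h⟩ := hc.2 f ⟨hf, fun x hx => by rw [← hfe, mul_assoc, hex x hx],
          fun y hy => hall y (Or.inl hy)⟩ hf0
        exact h (hall z (Or.inr hz))
      -- The complement of the join of the cover. No factor lies in the prime ideal, and neither
      -- does `d e`, yet tightness makes their product 0.
      set q : C := ∏ z ∈ hfin.toFinset, (1 - d z) with hq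
      have hq0 : ∀ z ∈ Y ∪ Z, ι q * π z = 0 := by
        intro z hz
        have : q * d z = 0 := by
          rw [hq, ← Finset.mul_prod_erase _ _ (hfin.mem_toFinset.2 hz), mul_right_comm, sub_mul,
            ← hπ.diag_mul hι hd (hZY z hz) (hZY z hz), hZY z hz, one_mul, sub_self, zero_mul]
        have := congrArg ι this
        rwa [_root_.map_mul, hd z (hZY z hz), _root_.map_zero] at this
      have hqe : q * d e = 0 :=
        hι (by
          rw [_root_.map_mul, hd e he, _root_.map_zero]
          exact hπ.tight e he _ hfin hZY hcov _ hq0)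
      rcases h𝔪.mem_or_mem (show q * d e ∈ 𝔪 from hqe ▸ zero_mem _) with h | h
      · obtain ⟨z, hz, hz'⟩ := (Ideal.IsPrime.prod_mem_iff (hp := h𝔪)).1 h
        exact one_sub_notMem h𝔪 (hZm z (hfin.mem_toFinset.1 hz)) hz'
      · exact he' h }

open TightGroupoid in
open scoped IsMulCommutative in
/-- A tight representation of `S` factors through the linear span of the characteristic functions
of the bisections. -/
theorem sum_eq_zero (hπ : IsTightRepresentation π) (c : S →₀ R)
    (hc : c.sum (fun t r => r • (bisection t).indicator (1 : TightGroupoid S → R)) = 0) :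
    c.sum (fun t r => r • π t) = 0 := by
  classical
  obtain ⟨C, hC, hmemC⟩ := hπ.exists_diagonal
  let ι : C →+* A := C.subtype
  have hι : Function.Injective ι := Subtype.val_injective
  let d : S → C := fun e => if he : e * e = e then ⟨π e, hmemC e he⟩ else 0
  have hd : ∀ e, e * e = e → ι (d e) = π e := fun e he => by
    simp only [d, dif_pos he]
    rfl
  by_contra hx
  set x := c.sum (fun t r => r • π t) with hxdef
  -- As $x\ne0$, its annihilator in the diagonal is proper. The aim is an annihilator of $x$ outside
  -- `𝔪`.
  obtain ⟨𝔪, hmax, hle⟩ := Ideal.exists_le_maximal (annihilator ι x) (fun h => hx (by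
    have : x * ι 1 = 0 := (Ideal.eq_top_iff_one _).1 h
    rwa [map_one, mul_one] at this))
  have h𝔪 := hmax.isPrime
  have hterm : ∀ (t e : S), e * e = e → t * e = t → π t * (1 - π e) = 0 := by
    intro t e he h
    rw [mul_sub, mul_one, ← hπ.map_mul, h, sub_self]
  have hannih : ∀ q : C, x * ι q = 0 → q ∈ 𝔪 := fun q hq => hle hq
  have hxmul : ∀ q : A, x * q = c.sum fun t r => r • (π t * q) := by
    intro q
    rw [hxdef, Finsupp.sum_mul]
    simp only [smul_mul_assoc]
  have hti : ∀ t : S, t * (star t * t) = t := fun t => by rw [← mul_assoc, mul_star_mul]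
  have hne : ∃ e : S, e * e = e ∧ d e ∉ 𝔪 := by
    by_contra hcon
    push Not at hcon
    -- This product kills every term of $x$. If `𝔪` contained all idempotents, it would contain no
    -- factor of the product.
    have h1 : ∏ t ∈ c.support, (1 - d (star t * t)) ∈ 𝔪 := by
      refine hannih _ ?_
      rw [hxmul]
      refine Finset.sum_eq_zero fun t ht => ?_
      simp only
      rw [← Finset.mul_prod_erase _ _ ht, _root_.map_mul, ← mul_assoc, map_sub,
        hd _ (star_mul_self_idem t), map_one,
        hterm t _ (star_mul_self_idem t) (hti t), zero_mul, smul_zero]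
    obtain ⟨t, ht, h2⟩ := (Ideal.IsPrime.prod_mem_iff (hp := h𝔪)).1 h1
    exact one_sub_notMem h𝔪 (hcon _ (star_mul_self_idem t)) h2
  set ξ := hπ.tightFilter hι hd 𝔪 h𝔪 hne with hξ
  have hmem : ∀ e, e ∈ ξ.carrier ↔ e * e = e ∧ d e ∉ 𝔪 := fun e => Iff.rfl
  -- an element of the filter on which all germs at `ξ` that agree are equal
  have hsep : ∃ e ∈ ξ.carrier, ∀ s ∈ c.support, ∀ t ∈ c.support,
      (∃ f ∈ ξ.carrier, s * f = t * f) → s * e = t * e := by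
    choose! g hg using fun (p : S × S) (h : ∃ f ∈ ξ.carrier, p.1 * f = p.2 * f) => h
    have : ∀ F : Finset (S × S), ∃ e ∈ ξ.carrier, ∀ p ∈ F,
        (∃ f ∈ ξ.carrier, p.1 * f = p.2 * f) → p.1 * e = p.2 * e := by
      intro F
      induction F using Finset.induction_on with
      | empty => exact ⟨_, ξ.nonempty.choose_spec, by simp⟩
      | insert p F _ ih =>
        obtain ⟨e, he, h⟩ := ih
        by_cases hp : ∃ f ∈ ξ.carrier, p.1 * f = p.2 * f
        · obtain ⟨h1, h2⟩ := hg p hp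
          refine ⟨g p * e, ξ.mul_mem _ h1 _ he, fun p' hp' h3 => ?_⟩
          rcases Finset.mem_insert.1 hp' with rfl | hp'
          · rw [← mul_assoc, h2, mul_assoc]
          · rw [idem_comm _ _ (ξ.idem _ h1) (ξ.idem _ he), ← mul_assoc, h p' hp' h3, mul_assoc]
        · refine ⟨e, he, fun p' hp' h3 => ?_⟩
          rcases Finset.mem_insert.1 hp' with rfl | hp'
          · exact absurd h3 hp
          · exact h p' hp' h3
    obtain ⟨e, he, h⟩ := this (c.support ×ˢ c.support)
    exact ⟨e, he, fun s hs t ht hst => h (s, t) (Finset.mk_mem_product hs ht) hst⟩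
  obtain ⟨e, he, hsep⟩ := hsep
  have hei := ξ.idem e he
  -- the terms that are not defined at `ξ`
  set N := c.support.filter fun t => star t * t ∉ ξ.carrier with hN
  -- The factor `d e` makes terms with the same germ at `ξ` equal, and the product removes the terms
  -- with no germ at `ξ`. No factor lies in `𝔪`.
  set q : C := d e * ∏ t ∈ N, (1 - d (star t * t)) with hq
  have hqm : q ∉ 𝔪 := by
    intro h
    rcases h𝔪.mem_or_mem h with h | h
    · exact ((hmem e).1 he).2 h
    · obtain ⟨t, ht, h2⟩ := (Ideal.IsPrime.prod_mem_iff (hp := h𝔪)).1 h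
      have h3 : d (star t * t) ∈ 𝔪 := by
        by_contra h3
        exact (Finset.mem_filter.1 ht).2 ((hmem _).2 ⟨star_mul_self_idem t, h3⟩)
      exact one_sub_notMem h𝔪 h3 h2
  refine hqm (hannih q ?_)
  rw [hxmul]
  have hzero : ∀ t ∈ N, π t * ι q = 0 := by
    intro t ht
    rw [hq, ← Finset.mul_prod_erase _ _ ht, mul_left_comm, _root_.map_mul, ← mul_assoc, map_sub,
      hd _ (star_mul_self_idem t), map_one,
      hterm t _ (star_mul_self_idem t) (hti t), zero_mul]
  have hsame : ∀ s ∈ c.support, ∀ t ∈ c.support, (∃ f ∈ ξ.carrier, s * f = t * f) →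
      π s * ι q = π t * ι q := by
    intro s hs t ht hst
    rw [hq, _root_.map_mul, hd e hei, ← mul_assoc, ← mul_assoc, ← hπ.map_mul, ← hπ.map_mul,
      hsep s hs t ht hst]
  -- Evaluating the vanishing function at the germ $[s,\xi]$: the coefficients of the terms with
  -- this germ add up to 0.
  have hpt : ∀ (s : S) (hs : star s * s ∈ ξ.carrier),
      ∑ t ∈ c.support, (if germ s ξ hs ∈ bisection t then c t else 0) = 0 := by
    intro s hs
    have := congrFun hc (germ s ξ hs)
    rw [Finsupp.sum, Finset.sum_apply] at this
    refine Eq.trans ?_ this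
    refine Finset.sum_congr rfl fun t _ => ?_
    by_cases h : germ s ξ hs ∈ bisection t <;> simp [h]
  -- group the remaining terms by germs
  rw [Finsupp.sum, ← Finset.sum_filter_add_sum_filter_not c.support
    (fun t => star t * t ∉ ξ.carrier), Finset.sum_eq_zero (s := c.support.filter _), zero_add]
  swap
  · intro t ht
    rw [hzero t ht, smul_zero]
  let G : S → Option (TightGroupoid S) := fun t =>
    if ht : star t * t ∈ ξ.carrier then some (germ t ξ ht) else none
  rw [← Finset.sum_fiberwise_of_maps_to (t := Finset.image G c.support) (g := G)
    (fun t ht => Finset.mem_image_of_mem G (Finset.mem_filter.1 ht).1)]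
  refine Finset.sum_eq_zero fun γ hγ => ?_
  obtain ⟨s, hs, rfl⟩ := Finset.mem_image.1 hγ
  by_cases hsξ : star s * s ∈ ξ.carrier
  swap
  · refine Finset.sum_eq_zero fun t ht => ?_
    obtain ⟨ht1, ht2⟩ := Finset.mem_filter.1 ht
    have ht3 := not_not.1 (Finset.mem_filter.1 ht1).2
    simp [G, hsξ, ht3] at ht2
  have hiff : ∀ t ∈ c.support, (t ∈ ((c.support.filter fun t => ¬ star t * t ∉ ξ.carrier).filter
      fun t => G t = G s) ↔ germ s ξ hsξ ∈ bisection t) := by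
    intro t ht
    rw [Finset.mem_filter, Finset.mem_filter, germ_mem_bisection, not_not]
    constructor
    · rintro ⟨⟨-, h1⟩, h2⟩
      simp only [G, dif_pos h1, dif_pos hsξ, Option.some.injEq] at h2
      exact ⟨h1, (germ_eq_iff.1 h2.symm).2⟩
    · rintro ⟨h1, h2⟩
      refine ⟨⟨ht, h1⟩, ?_⟩
      simp only [G, dif_pos h1, dif_pos hsξ, Option.some.injEq]
      exact (germ_eq_iff.2 ⟨rfl, h2⟩ : germ s ξ hsξ = germ t ξ h1).symm
  have hall : ∀ t ∈ ((c.support.filter fun t => ¬ star t * t ∉ ξ.carrier).filter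
      fun t => G t = G s), c t • (π t * ι q) = c t • (π s * ι q) := by
    intro t ht
    have ht' := (Finset.mem_filter.1 (Finset.mem_filter.1 ht).1).1
    rw [hsame s hs t ht' (germ_mem_bisection.1 ((hiff t ht').1 ht)).2]
  rw [Finset.sum_congr rfl hall, ← Finset.sum_smul]
  have : ∑ t ∈ ((c.support.filter fun t => ¬ star t * t ∉ ξ.carrier).filter
      fun t => G t = G s), c t = 0 := by
    rw [← hpt s hsξ, ← Finset.sum_filter]
    refine Finset.sum_congr ?_ fun _ _ => rfl
    ext t
    by_cases ht : t ∈ c.support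
    · rw [hiff t ht, Finset.mem_filter]
      exact ⟨fun h => ⟨ht, h⟩, fun h => h.2⟩
    · exact ⟨fun h => absurd (Finset.mem_filter.1 (Finset.mem_filter.1 h).1).1 ht,
        fun h => absurd (Finset.mem_filter.1 h).1 ht⟩
  rw [this, zero_smul]

end IsTightRepresentation

end InverseSemigroup

/-! ### Operators on `ℓ²` given by partial bijections -/

namespace PEquiv

variable {Ω : Type*}

/-- By injectivity of `k` where it is defined, the nonzero summands are distinct summands of the
series for the norm of `f`. -/
theorem sum_norm_elim_le (k : Ω ≃. Ω) (f : lp (fun _ : Ω => ℂ) 2) (s : Finset Ω) :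
    ∑ ω ∈ s, ‖(k ω).elim 0 f‖ ^ (2 : ℝ≥0∞).toReal ≤ ‖f‖ ^ (2 : ℝ≥0∞).toReal := by
  classical
  have hp : 0 < (2 : ℝ≥0∞).toReal := by norm_num
  have hsome : ∀ ω, ‖(k ω).elim 0 f‖ ^ (2 : ℝ≥0∞).toReal ≠ 0 → (k ω).isSome := by
    intro ω h
    by_contra hn
    rw [Option.not_isSome_iff_eq_none] at hn
    rw [hn] at h
    exact h (by simp)
  refine le_trans (le_of_eq ?_) (lp.sum_rpow_le_norm_rpow hp f (s.image k).eraseNone)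
  refine Finset.sum_bij_ne_zero (fun ω _ h => (k ω).get (hsome ω h)) ?_ ?_ ?_ ?_
  · intro ω hω h
    rw [Finset.mem_eraseNone, Option.some_get]
    exact Finset.mem_image_of_mem _ hω
  · intro ω _ h ω' _ h' he
    exact k.inj (b := (k ω).get (hsome ω h)) (by simp) (by rw [he]; simp)
  · intro ω hω h
    rw [Finset.mem_eraseNone, Finset.mem_image] at hω
    obtain ⟨ω', h1, h2⟩ := hω
    exact ⟨ω', h1, by rw [h2]; exact h, by simp [h2]⟩
  · intro ω _ h
    obtain ⟨ω', h'⟩ := Option.isSome_iff_exists.1 (hsome ω h)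
    simp [h']

/-- The partial isometry of `ℓ²(Ω)` defined by a partial bijection of `Ω`. -/
noncomputable def toOperator (k : Ω ≃. Ω) :
    lp (fun _ : Ω => ℂ) 2 →L[ℂ] lp (fun _ : Ω => ℂ) 2 :=
  LinearMap.mkContinuous
    { toFun := fun f => ⟨fun ω => (k ω).elim 0 f, memℓp_gen' (k.sum_norm_elim_le f)⟩
      map_add' := fun f g => by
        ext ω
        change (k ω).elim 0 (f + g) = (k ω).elim 0 f + (k ω).elim 0 g
        cases k ω with
        | none => exact (add_zero 0).symm
        | some ω' => rfl
      map_smul' := fun c f => by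
        ext ω
        change (k ω).elim 0 (c • f) = c • (k ω).elim 0 f
        cases k ω <;> simp } 1 (fun f => by
    rw [one_mul]
    exact lp.norm_le_of_forall_sum_le (by norm_num) (norm_nonneg f) (k.sum_norm_elim_le f))

theorem toOperator_apply (k : Ω ≃. Ω) (f : lp (fun _ : Ω => ℂ) 2) (ω : Ω) :
    k.toOperator f ω = (k ω).elim 0 f := rfl

/-- The two inner products are sums over the domain and the range of `k`, and `k` itself matches
their nonzero terms. -/
theorem star_toOperator (k : Ω ≃. Ω) : star k.toOperator = k.symm.toOperator := by
  symm
  rw [ContinuousLinearMap.star_eq_adjoint, ContinuousLinearMap.eq_adjoint_iff]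
  intro x y
  rw [lp.inner_eq_tsum, lp.inner_eq_tsum]
  have hsome : ∀ ω : Function.support fun ω => inner ℂ (x ω) (k.toOperator y ω),
      (k ω.1).isSome := by
    rintro ⟨ω, h⟩
    by_contra hn
    rw [Option.not_isSome_iff_eq_none] at hn
    simp only [Function.mem_support, toOperator_apply, hn] at h
    exact h (by simp)
  refine tsum_eq_tsum_of_ne_zero_bij (fun ω => (k ω.1).get (hsome ω)) ?_ ?_ ?_
  · intro ω ω' he
    simp only at he
    exact Subtype.ext (k.inj (b := (k ω.1).get (hsome ω)) (by simp) (by rw [he]; simp))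
  · intro ω h
    cases h' : k.symm ω with
    | none =>
      simp only [Function.mem_support, toOperator_apply, h'] at h
      exact absurd (by simp) h
    | some ω' =>
      have h'' := k.eq_some_iff.1 h'
      refine ⟨⟨ω', ?_⟩, by simp [h'']⟩
      simp only [Function.mem_support, toOperator_apply, h', h'', Option.elim_some] at h ⊢
      exact h
  · intro ω
    obtain ⟨ω', h'⟩ := Option.isSome_iff_exists.1 (hsome ω)
    have h'' := k.eq_some_iff.2 h'
    simp [toOperator_apply, h', h'']

end PEquiv

namespace BooleanDynamicalSystem

variable {B : Type u} {L : Type v} [GeneralizedBooleanAlgebra B]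

/-! ### Prime filters -/

/-- Prime filters of a generalized Boolean algebra. -/
structure IsPrimeFilter (χ : Set B) : Prop where
  nonempty : χ.Nonempty
  bot_notMem : ⊥ ∉ χ
  inf_mem_iff : ∀ X Y, X ⊓ Y ∈ χ ↔ X ∈ χ ∧ Y ∈ χ
  sup_mem_iff : ∀ X Y, X ⊔ Y ∈ χ ↔ X ∈ χ ∨ Y ∈ χ

theorem IsPrimeFilter.mem_of_le {χ : Set B} (h : IsPrimeFilter χ) {X Y : B} (hX : X ∈ χ)
    (hXY : X ≤ Y) : Y ∈ χ :=
  ((h.inf_mem_iff X Y).1 (by rwa [inf_eq_left.2 hXY])).2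

/-- Prime filters are maximal: a member $Y$ of $\chi$ splits into $Y\cap X$ and $Y\setminus X$, and
the second part cannot lie in a proper filter that contains $X$. -/
theorem IsPrimeFilter.eq_of_subset {χ χ' : Set B} (h : IsPrimeFilter χ) (h' : IsPrimeFilter χ')
    (hsub : χ ⊆ χ') : χ = χ' := by
  refine hsub.antisymm fun X hX => ?_
  obtain ⟨Y, hY⟩ := h.nonempty
  rw [← sup_inf_sdiff Y X] at hY
  rcases (h.sup_mem_iff _ _).1 hY with h1 | h1
  · exact ((h.inf_mem_iff _ _).1 h1).2
  · refine absurd ((h'.inf_mem_iff _ _).2 ⟨hX, hsub h1⟩) ?_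
    rw [inf_sdiff_self_right]
    exact h'.bot_notMem

/-- The complement of a prime ideal that is disjoint from the filter generated by `F`. Nonemptiness
of `F` replaces the missing top element. -/
theorem exists_isPrimeFilter {F : Set B} (hne : F.Nonempty) (hbot : ⊥ ∉ F)
    (hinf : ∀ X ∈ F, ∀ Y ∈ F, X ⊓ Y ∈ F) : ∃ χ, IsPrimeFilter χ ∧ F ⊆ χ := by
  have hF : Order.IsPFilter {Y | ∃ X ∈ F, X ≤ Y} := by
    refine Order.IsPFilter.of_def ?_ ?_ ?_
    · obtain ⟨X, hX⟩ := hne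
      exact ⟨X, X, hX, le_rfl⟩
    · rintro X ⟨X', h1, h2⟩ Y ⟨Y', h3, h4⟩
      exact ⟨X ⊓ Y, ⟨_, hinf _ h1 _ h3, inf_le_inf h2 h4⟩, inf_le_left, inf_le_right⟩
    · rintro X Y hXY ⟨X', h1, h2⟩
      exact ⟨X', h1, h2.trans hXY⟩
  have hFm : ∀ X, X ∈ hF.toPFilter ↔ ∃ X' ∈ F, X' ≤ X := fun X => Iff.rfl
  obtain ⟨J, hJ, -, hdis⟩ := DistribLattice.prime_ideal_of_disjoint_filter_ideal
    (F := hF.toPFilter) (I := Order.Ideal.principal (⊥ : B)) (by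
      rw [Set.disjoint_left]
      rintro X ⟨X', h1, h2⟩ h3
      have : X' = ⊥ := le_bot_iff.1 (h2.trans h3)
      exact hbot (this ▸ h1))
  have hsub : F ⊆ (J : Set B)ᶜ := fun X hX => Set.disjoint_left.1 hdis ((hFm X).2 ⟨X, hX, le_rfl⟩)
  refine ⟨(J : Set B)ᶜ, ⟨hne.mono hsub, ?_, fun X Y => ?_, fun X Y => ?_⟩, hsub⟩
  · exact fun h => h J.bot_mem
  · simp only [Set.mem_compl_iff, SetLike.mem_coe, ← not_or, not_iff_not]
    exact ⟨hJ.mem_or_mem, fun h => h.elim (fun h => J.lower inf_le_left h)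
      (fun h => J.lower inf_le_right h)⟩
  · simp only [Set.mem_compl_iff, SetLike.mem_coe, ← not_and_or, not_iff_not]
    exact Order.Ideal.sup_mem_iff

variable (D : BooleanDynamicalSystem B L)

theorem θ_le_rng (a : L) (X : B) : D.θ a X ≤ D.rng [a] :=
  (D.isLUB_rng (α := [a]) (by simp)).1 ⟨X, rfl⟩

theorem exists_θ_eq_rng (a : L) : ∃ X, D.θ a X = D.rng [a] := by
  refine ⟨(D.exists_domain [a] (by simp)).choose, ?_⟩
  rw [rng, dif_pos (by simp)]
  rfl

/-- Nonemptiness is the only point at issue: it holds because $\mathcal R_a$ is itself a value of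
$\theta_a$. -/
theorem IsPrimeFilter.preimage_θ {χ : Set B} (h : IsPrimeFilter χ) {a : L} (ha : D.rng [a] ∈ χ) :
    IsPrimeFilter (D.θ a ⁻¹' χ) where
  nonempty := by
    obtain ⟨X, hX⟩ := D.exists_θ_eq_rng a
    exact ⟨X, by rwa [Set.mem_preimage, hX]⟩
  bot_notMem := by
    rw [Set.mem_preimage, D.map_bot]
    exact h.bot_notMem
  inf_mem_iff X Y := by
    rw [Set.mem_preimage, D.map_inf]
    exact h.inf_mem_iff _ _
  sup_mem_iff X Y := by
    rw [Set.mem_preimage, D.map_sup]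
    exact h.sup_mem_iff _ _

/-- A prime filter that contains a regular set is the preimage of a prime filter. -/
theorem IsPrimeFilter.exists_preimage_θ_eq {χ : Set B} (h : IsPrimeFilter χ) {X : B} (hX : X ∈ χ)
    (hreg : D.IsRegular X) : ∃ (a : L) (χ' : Set B), IsPrimeFilter χ' ∧ D.θ a ⁻¹' χ' = χ := by
  have hX0 : X ≠ ⊥ := fun h0 => h.bot_notMem (h0 ▸ hX)
  -- Otherwise each of the finitely many letters of $X$ kills some member of $\chi$. Intersecting
  -- these members with $X$ gives a nonempty subset of $X$ without letters, against regularity.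
  have ha : ∃ a, ∀ Y ∈ χ, D.θ a Y ≠ ⊥ := by
    by_contra hcon
    push Not at hcon
    choose Z hZ hZ0 using hcon
    have hfin := (hreg X hX0 le_rfl).2
    have key : ∀ F : Set L, F.Finite → ∃ Y ∈ χ, Y ≤ X ∧ ∀ a ∈ F, D.θ a Y = ⊥ := by
      intro F hF
      induction F, hF using Set.Finite.induction_on with
      | empty => exact ⟨X, hX, le_rfl, by simp⟩
      | @insert a F _ _ ih =>
        obtain ⟨Y, h1, h2, h3⟩ := ih
        refine ⟨Y ⊓ Z a, (h.inf_mem_iff _ _).2 ⟨h1, hZ a⟩, inf_le_left.trans h2, ?_⟩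
        rintro b (rfl | hb)
        · rw [D.map_inf, hZ0, inf_bot_eq]
        · rw [D.map_inf, h3 b hb, bot_inf_eq]
    obtain ⟨Y, h1, h2, h3⟩ := key _ hfin
    obtain ⟨a, ha⟩ := (hreg Y (fun h0 => h.bot_notMem (h0 ▸ h1)) h2).1
    refine ha (h3 a fun h4 => ha ?_)
    exact le_bot_iff.1 ((D.θ_mono a h2).trans h4.le)
  obtain ⟨a, ha⟩ := ha
  obtain ⟨χ', h', hsub⟩ := exists_isPrimeFilter (F := D.θ a '' χ) (h.nonempty.image _)
    (by rintro ⟨Y, hY, h0⟩; exact ha Y hY h0)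
    (by
      rintro _ ⟨Y, hY, rfl⟩ _ ⟨Z, hZ, rfl⟩
      exact ⟨Y ⊓ Z, (h.inf_mem_iff _ _).2 ⟨hY, hZ⟩, D.map_inf a Y Z⟩)
  refine ⟨a, χ', h', (h.eq_of_subset (h'.preimage_θ D ?_) ?_).symm⟩
  · exact h'.mem_of_le (hsub ⟨X, hX, rfl⟩) (D.θ_le_rng a X)
  · exact Set.image_subset_iff.1 hsub

/-! ### Boundary paths -/

/-- The transitions of a boundary path: along a letter, or stopping at a prime filter that
contains no regular set. -/
def Step (x y : Set B × Option L) : Prop :=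
  (∃ a, x.2 = some a ∧ D.θ a ⁻¹' y.1 = x.1) ∨
    (x.2 = none ∧ (∀ X ∈ x.1, ¬ D.IsRegular X) ∧ y = x)

/-- Boundary paths, as infinite sequences that become constant where the path stops. -/
def BoundaryPath : Type (max u v) :=
  {f : ℕ → Set B × Option L // ∀ n, IsPrimeFilter (f n).1 ∧ D.Step (f n) (f (n + 1))}

namespace BoundaryPath

variable {D}

/-- The prime filter at the start of a path. -/
def base (ω : D.BoundaryPath) : Set B := (ω.1 0).1

/-- The first letter of a path. -/
def label (ω : D.BoundaryPath) : Option L := (ω.1 0).2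

/-- The path without its first letter. -/
def tail (ω : D.BoundaryPath) : D.BoundaryPath := ⟨fun n => ω.1 (n + 1), fun n => ω.2 (n + 1)⟩

/-- The path with a letter prepended. -/
def cons (a : L) (ω : D.BoundaryPath) (h : D.rng [a] ∈ ω.base) : D.BoundaryPath :=
  ⟨fun n => Nat.casesOn n (D.θ a ⁻¹' ω.base, some a) ω.1, fun n => by
    cases n with
    | zero => exact ⟨(ω.2 0).1.preimage_θ D h, Or.inl ⟨a, rfl, rfl⟩⟩
    | succ n => exact ω.2 n⟩

theorem isPrimeFilter_base (ω : D.BoundaryPath) : IsPrimeFilter ω.base := (ω.2 0).1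

theorem base_cons (a : L) (ω : D.BoundaryPath) (h : D.rng [a] ∈ ω.base) :
    (cons a ω h).base = D.θ a ⁻¹' ω.base := rfl

theorem label_cons (a : L) (ω : D.BoundaryPath) (h : D.rng [a] ∈ ω.base) :
    (cons a ω h).label = some a := rfl

theorem tail_cons (a : L) (ω : D.BoundaryPath) (h : D.rng [a] ∈ ω.base) :
    (cons a ω h).tail = ω := rfl

theorem base_eq_preimage {ω : D.BoundaryPath} {a : L} (h : ω.label = some a) :
    ω.base = D.θ a ⁻¹' ω.tail.base := by
  rcases (ω.2 0).2 with ⟨b, h1, h2⟩ | ⟨h1, -⟩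
  · have : a = b := Option.some_injective _ (h.symm.trans h1)
    subst this
    exact h2.symm
  · exact absurd (h.symm.trans h1) (by simp)

theorem rng_mem_base_tail {ω : D.BoundaryPath} {a : L} (h : ω.label = some a) :
    D.rng [a] ∈ ω.tail.base := by
  obtain ⟨X, hX⟩ := ω.isPrimeFilter_base.nonempty
  rw [base_eq_preimage h] at hX
  exact ω.tail.isPrimeFilter_base.mem_of_le hX (D.θ_le_rng a X)

theorem cons_tail {ω : D.BoundaryPath} {a : L} (h : ω.label = some a) :
    cons a ω.tail (rng_mem_base_tail h) = ω := by
  refine Subtype.ext (funext fun n => ?_)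
  cases n with
  | zero => exact (Prod.ext (base_eq_preimage h) h : ω.1 0 = (_, some a)).symm
  | succ n => rfl

theorem exists_label {ω : D.BoundaryPath} {X : B} (hX : X ∈ ω.base) (hreg : D.IsRegular X) :
    ∃ a, ω.label = some a := by
  rcases (ω.2 0).2 with ⟨b, h1, -⟩ | ⟨-, h1, -⟩
  · exact ⟨b, h1⟩
  · exact absurd hreg (h1 X hX)

variable (D) in
-- Start at a prime filter that contains $X$ and iterate: a prime filter with a regular member has a
-- successor along some letter, and at any other one the path may stop.
theorem exists_mem_base {X : B} (hX : X ≠ ⊥) : ∃ ω : D.BoundaryPath, X ∈ ω.base := by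
  classical
  obtain ⟨χ, hχ, hXχ⟩ := exists_isPrimeFilter (F := {X}) (by simp) (by simpa using hX.symm)
    (by simp)
  have hstep : ∀ χ : {χ : Set B // IsPrimeFilter χ}, ∃ (o : Option L)
      (χ' : {χ : Set B // IsPrimeFilter χ}), (∃ a, o = some a ∧ D.θ a ⁻¹' χ'.1 = χ.1) ∨
        (o = none ∧ (∀ X ∈ χ.1, ¬ D.IsRegular X) ∧ χ' = χ) := by
    intro χ
    by_cases h : ∃ X ∈ χ.1, D.IsRegular X
    · obtain ⟨X, h1, h2⟩ := h
      obtain ⟨a, χ', h3, h4⟩ := χ.2.exists_preimage_θ_eq D h1 h2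
      exact ⟨some a, ⟨χ', h3⟩, Or.inl ⟨a, rfl, h4⟩⟩
    · push Not at h
      exact ⟨none, χ, Or.inr ⟨rfl, h, rfl⟩⟩
  choose o next hnext using hstep
  let f : ℕ → {χ : Set B // IsPrimeFilter χ} := fun n => next^[n] ⟨χ, hχ⟩
  have hf : ∀ n, f (n + 1) = next (f n) := fun n => Function.iterate_succ_apply' _ _ _
  refine ⟨⟨fun n => ((f n).1, o (f n)), fun n => ⟨(f n).2, ?_⟩⟩, hXχ rfl⟩
  rcases hnext (f n) with ⟨a, h1, h2⟩ | ⟨h1, h2, h3⟩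
  · exact Or.inl ⟨a, h1, by simp only [hf]; exact h2⟩
  · exact Or.inr ⟨h1, h2, by simp only [hf, h3]⟩

open Classical in
/-- The partial bijection that removes the first letter `a`. -/
noncomputable def drop (a : L) : D.BoundaryPath ≃. D.BoundaryPath where
  toFun ω := if ω.label = some a then some ω.tail else none
  invFun ω := if h : D.rng [a] ∈ ω.base then some (cons a ω h) else none
  inv ω ω' := by
    constructor
    · intro h
      by_cases h1 : D.rng [a] ∈ ω'.base
      · rw [dif_pos h1] at h
        obtain rfl := Option.mem_some_iff.1 h
        rw [if_pos (label_cons a ω' h1)]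
        rfl
      · rw [dif_neg h1] at h
        exact absurd h (by simp)
    · intro h
      by_cases h1 : ω.label = some a
      · rw [if_pos h1] at h
        obtain rfl := Option.mem_some_iff.1 h
        rw [dif_pos (rng_mem_base_tail h1), cons_tail h1]
      · rw [if_neg h1] at h
        exact absurd h (by simp)

open Classical in
theorem drop_apply (a : L) (ω : D.BoundaryPath) :
    drop a ω = if ω.label = some a then some ω.tail else none := rfl

open Classical in
theorem drop_symm_apply (a : L) (ω : D.BoundaryPath) :
    (drop a).symm ω = if h : D.rng [a] ∈ ω.base then some (cons a ω h) else none := rfl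

open Classical in
/-- The partial identity on the paths that start in `X`. -/
noncomputable def restrict (X : B) : D.BoundaryPath ≃. D.BoundaryPath :=
  PEquiv.ofSet {ω | X ∈ ω.base}

open Classical in
theorem restrict_apply (X : B) (ω : D.BoundaryPath) :
    restrict X ω = if X ∈ ω.base then some ω else none := rfl

open Classical in
theorem restrict_toOperator_apply (X : B) (f : lp (fun _ : D.BoundaryPath => ℂ) 2)
    (ω : D.BoundaryPath) :
    (restrict X).toOperator f ω = if X ∈ ω.base then f ω else 0 := by
  rw [PEquiv.toOperator_apply, restrict_apply]
  split_ifs <;> rfl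

open Classical in
theorem drop_toOperator_apply (a : L) (f : lp (fun _ : D.BoundaryPath => ℂ) 2)
    (ω : D.BoundaryPath) :
    (drop a).toOperator f ω = if ω.label = some a then f ω.tail else 0 := by
  rw [PEquiv.toOperator_apply, drop_apply]
  split_ifs <;> rfl

open Classical in
theorem drop_symm_toOperator_apply (a : L) (f : lp (fun _ : D.BoundaryPath => ℂ) 2)
    (ω : D.BoundaryPath) :
    (drop a).symm.toOperator f ω =
      if h : D.rng [a] ∈ ω.base then f (cons a ω h) else 0 := by
  rw [PEquiv.toOperator_apply, drop_symm_apply]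
  split_ifs <;> rfl

/-- All relations are checked pointwise on paths. Primality of the base gives the relations for
unions and intersections, and the stopping rule gives the one for regular sets. -/
theorem isCKFamily : D.IsCKFamily
    (fun X => (restrict (D := D) X).toOperator) (fun a => (drop (D := D) a).toOperator)
    (fun a => (drop (D := D) a).symm.toOperator) := by
  classical
  have hsource : ∀ a, (drop (D := D) a).symm.toOperator * (drop a).toOperator =
      (restrict (D.rng [a])).toOperator := by
    intro a
    ext f ω
    change (drop (D := D) a).symm.toOperator ((drop a).toOperator f) ω = _
    rw [drop_symm_toOperator_apply, restrict_toOperator_apply]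
    split_ifs with h
    · rw [drop_toOperator_apply, if_pos (label_cons a ω h), tail_cons]
    · rfl
  constructor
  · ext f ω
    rw [restrict_toOperator_apply, if_neg ω.isPrimeFilter_base.bot_notMem]
    rfl
  · intro X Y
    ext f ω
    change _ = (restrict X).toOperator ((restrict Y).toOperator f) ω
    simp only [restrict_toOperator_apply, ω.isPrimeFilter_base.inf_mem_iff]
    by_cases h1 : X ∈ ω.base <;> by_cases h2 : Y ∈ ω.base <;> simp [h1, h2]
  · intro X Y
    ext f ω
    change _ = (restrict X).toOperator f ω + (restrict Y).toOperator f ω -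
      (restrict (X ⊓ Y)).toOperator f ω
    simp only [restrict_toOperator_apply, ω.isPrimeFilter_base.inf_mem_iff,
      ω.isPrimeFilter_base.sup_mem_iff]
    by_cases h1 : X ∈ ω.base <;> by_cases h2 : Y ∈ ω.base <;> simp [h1, h2]
  · intro a
    rw [mul_assoc, hsource]
    ext f ω
    change (drop a).toOperator ((restrict _).toOperator f) ω = _
    simp only [drop_toOperator_apply, restrict_toOperator_apply]
    by_cases h : ω.label = some a
    · simp [h, rng_mem_base_tail h]
    · simp [h]
  · intro a
    rw [hsource]
    ext f ω
    change (restrict _).toOperator ((drop a).symm.toOperator f) ω = _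
    simp only [drop_symm_toOperator_apply, restrict_toOperator_apply]
    by_cases h : D.rng [a] ∈ ω.base <;> simp [h]
  · intro a X
    ext f ω
    change (restrict _).toOperator ((drop a).toOperator f) ω =
      (drop a).toOperator ((restrict _).toOperator f) ω
    simp only [drop_toOperator_apply, restrict_toOperator_apply]
    by_cases h : ω.label = some a
    · simp [h, base_eq_preimage h]
    · simp [h]
  · intro a X
    ext f ω
    change (drop a).symm.toOperator ((restrict _).toOperator f) ω =
      (restrict _).toOperator ((drop a).symm.toOperator f) ω
    simp only [drop_symm_toOperator_apply, restrict_toOperator_apply]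
    by_cases h : D.rng [a] ∈ ω.base
    · simp [h, base_cons]
    · simp [h]
  · exact hsource
  · intro a b hab
    ext f ω
    change (drop a).symm.toOperator ((drop b).toOperator f) ω = 0
    rw [drop_symm_toOperator_apply]
    split_ifs with h
    · rw [drop_toOperator_apply, label_cons, if_neg (by simpa using hab)]
    · rfl
  · intro X hX F hF
    ext f ω
    have hterm : ∀ a, ((drop (D := D) a).toOperator * (restrict (D := D) (D.θ a X)).toOperator *
        (drop (D := D) a).symm.toOperator) f ω =
          if ω.label = some a ∧ X ∈ ω.base then f ω else 0 := by
      intro a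
      change (drop a).toOperator ((restrict _).toOperator ((drop a).symm.toOperator f)) ω = _
      simp only [drop_toOperator_apply, restrict_toOperator_apply, drop_symm_toOperator_apply]
      by_cases h : ω.label = some a
      · simp [h, base_eq_preimage h, rng_mem_base_tail h, cons_tail h]
      · simp [h]
    rw [sum_apply, restrict_toOperator_apply]
    have hcoe : ∀ g : L → lp (fun _ : D.BoundaryPath => ℂ) 2,
        (∑ a ∈ F, g a) ω = ∑ a ∈ F, g a ω := by
      intro g
      rw [lp.coeFn_sum, Finset.sum_apply]
    rw [hcoe]
    simp only [hterm]
    -- A path that starts in a regular set cannot stop at once, so exactly one summand survives,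
    -- that of its first letter.
    by_cases h : X ∈ ω.base
    · obtain ⟨a, ha⟩ := exists_label h hX
      have haF : a ∈ F := by
        rw [← Finset.mem_coe, hF]
        intro h0
        rw [base_eq_preimage ha, Set.mem_preimage, h0] at h
        exact ω.tail.isPrimeFilter_base.bot_notMem h
      rw [Finset.sum_eq_single a]
      · simp [h, ha]
      · intro b _ hb
        rw [if_neg]
        rintro ⟨h1, -⟩
        exact hb (Option.some_injective _ (h1.symm.trans ha))
      · exact fun h => absurd haF h
    · simp [h]

variable (D) in
/-- The Cuntz-Krieger representation on the boundary paths. -/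
noncomputable def representation : Representation D where
  alg := lp (fun _ : D.BoundaryPath => ℂ) 2 →L[ℂ] lp (fun _ : D.BoundaryPath => ℂ) 2
  P X := (restrict X).toOperator
  S a := (drop a).toOperator
  isCK :=
    { projection := fun X =>
        ⟨by
          change (restrict X).toOperator * (restrict X).toOperator = _
          rw [← isCKFamily.inf, inf_idem], by
          change star (restrict X).toOperator = _
          rw [PEquiv.star_toOperator, restrict, PEquiv.ofSet_symm]⟩
      family := by
        simp only [PEquiv.star_toOperator]
        exact isCKFamily }

end BoundaryPath

/-- In the boundary path representation, $p_X$ fixes the point mass at a path that starts in $X$. -/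
theorem univP_ne_zero {X : B} (hX : X ≠ ⊥) : D.univP X ≠ 0 := by
  classical
  intro h0
  obtain ⟨ω, hω⟩ := BoundaryPath.exists_mem_base D hX
  have h1 : (BoundaryPath.restrict (D := D) X).toOperator = 0 := by
    have := D.toRep_univP (BoundaryPath.representation D) X
    rw [h0, map_zero] at this
    exact this.symm
  have h2 := BoundaryPath.restrict_toOperator_apply X (lp.single 2 ω 1) ω
  rw [h1, if_pos hω] at h2
  simp at h2

/-! ### Products of monomials -/

theorem map_monomial {B : Type u} {A A' : Type*} [Mul A] [Mul A'] (f : A → A')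
    (hf : ∀ x y, f (x * y) = f x * f y) (P : B → A) (S Sd : L → A) (α β : List L) (X : B) :
    f (monomial P S Sd α X β) =
      monomial (fun X => f (P X)) (fun a => f (S a)) (fun a => f (Sd a)) α X β := by
  have h1 : ∀ (α : List L) (x : A), f (word S α x) = word (fun a => f (S a)) α (f x) := by
    intro α x
    induction α with
    | nil => rfl
    | cons a α ih => exact (hf _ _).trans (congrArg _ ih)
  have h2 : ∀ (α : List L) (x : A), f (wordStar Sd α x) = wordStar (fun a => f (Sd a)) α (f x) := by
    intro α x
    induction α with
    | nil => rfl
    | cons a α ih => exact (hf _ _).trans (congrArg (· * f (Sd a)) ih)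
  rw [monomial, h1, h2, monomial]

variable {D}

theorem act_bot (α : List L) : D.act α ⊥ = ⊥ := by
  induction α with
  | nil => rfl
  | cons a α ih => rw [act_cons, D.map_bot, ih]

theorem Below.nil (X : B) : D.Below [] X := fun h => absurd rfl h

theorem Below.of_append {α β : List L} {X : B} (h : D.Below (α ++ β) X) : D.Below β X := by
  induction α with
  | nil => exact h
  | cons a α ih => exact ih h.of_cons

namespace IsCKFamily

variable {A : Type*} [NonUnitalRing A] {P : B → A} {S Sd : L → A}

theorem P_sdiff (h : D.IsCKFamily P S Sd) (X Y : B) : P X = P (X ⊓ Y) + P (X \ Y) := by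
  have := h.sup (X ⊓ Y) (X \ Y)
  rwa [sup_inf_sdiff, inf_inf_sdiff, h.bot, sub_zero] at this

theorem P_mul_self (h : D.IsCKFamily P S Sd) (X : B) : P X * P X = P X := by
  rw [← h.inf, inf_idem]

theorem monomial_bot (h : D.IsCKFamily P S Sd) (α β : List L) : monomial P S Sd α ⊥ β = 0 := by
  rw [monomial, h.bot, wordStar_zero, word_zero]

/-- A deterministic version of `IsCKFamily.inner`: the result depends only on the words and sets, so
the same formula holds in every family. -/
theorem inner_append_right (h : D.IsCKFamily P S Sd) (β δ : List L) (X Y : B)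
    (hY : D.Below (β ++ δ) Y) :
    wordStar Sd β (P X) * word S (β ++ δ) (P Y) = word S δ (P (D.act δ X ⊓ Y)) := by
  induction β with
  | nil =>
    change P X * word S δ (P Y) = _
    rw [h.mul_word, h.inf]
  | cons b β ih => rw [List.cons_append, h.cons_cons b β (β ++ δ) X Y hY, ih hY.of_cons]

theorem inner_append_left (h : D.IsCKFamily P S Sd) (γ δ : List L) (X Y : B)
    (hY : D.Below γ Y) :
    wordStar Sd (γ ++ δ) (P X) * word S γ (P Y) = wordStar Sd δ (P (X ⊓ D.act δ Y)) := by
  induction γ with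
  | nil =>
    change wordStar Sd δ (P X) * P Y = _
    rw [h.wordStar_mul, h.inf]
  | cons b γ ih => rw [List.cons_append, h.cons_cons b (γ ++ δ) γ X Y hY, ih hY.of_cons]

theorem monomial_mul_append (h : D.IsCKFamily P S Sd) (α β γ δ : List L) (X Y : B)
    (hY : D.Below (β ++ δ) Y) :
    monomial P S Sd α X β * monomial P S Sd (β ++ δ) Y γ =
      monomial P S Sd (α ++ δ) (D.act δ X ⊓ Y) γ := by
  rw [monomial_mul_monomial, h.inner_append_right β δ X Y hY, monomial, word_append,
    word_wordStar S Sd δ]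

theorem monomial_append_mul (h : D.IsCKFamily P S Sd) (α β γ δ : List L) (X Y : B)
    (hY : D.Below β Y) :
    monomial P S Sd α X (β ++ δ) * monomial P S Sd β Y γ =
      monomial P S Sd α (X ⊓ D.act δ Y) (γ ++ δ) := by
  rw [monomial_mul_monomial, h.inner_append_left β δ X Y hY, monomial, wordStar_append]

theorem monomial_mul_same (h : D.IsCKFamily P S Sd) (α β γ : List L) (X Y : B)
    (hY : D.Below β Y) :
    monomial P S Sd α X β * monomial P S Sd β Y γ = monomial P S Sd α (X ⊓ Y) γ := by
  rw [monomial_mul_monomial, h.inner_self β X Y hY, monomial]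

theorem monomial_mul_eq_zero (h : D.IsCKFamily P S Sd) (α β γ δ : List L) (X Y : B)
    (hX : D.Below β X) (hY : D.Below γ Y) (h1 : ¬ ∃ ε, γ = β ++ ε) (h2 : ¬ ∃ ε, β = γ ++ ε) :
    monomial P S Sd α X β * monomial P S Sd γ Y δ = 0 := by
  rcases h.inner β γ X Y hX hY with ⟨ε, he, -⟩ | ⟨ε, he, -⟩ | h0
  · exact absurd ⟨ε, he⟩ h1
  · exact absurd ⟨ε, he⟩ h2
  · rw [monomial_mul_monomial, h0, wordStar_zero, word_zero]

/-- Recovers the middle projection from a monomial with known words. Equalities of monomials are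
thereby reduced to equalities of projections. -/
theorem compress (h : D.IsCKFamily P S Sd) (α β : List L) (X Y : B) (hX : D.Below α X)
    (hY : D.Below β Y) (hXY : X ≤ Y) :
    monomial P S Sd [] Y α * monomial P S Sd α X β * monomial P S Sd β Y [] = P X := by
  rw [h.monomial_mul_same [] α β Y X hX, h.monomial_mul_same [] β [] _ Y hY,
    inf_eq_right.2 hXY, inf_eq_left.2 hXY]
  rfl

/-- The gauge action: in every relation the scalars either agree on both sides or cancel. -/
theorem smul {𝕜 : Type*} [CommRing 𝕜] [Module 𝕜 A] [IsScalarTower 𝕜 A A] [SMulCommClass 𝕜 A A]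
    (h : D.IsCKFamily P S Sd) {z w : 𝕜} (hzw : z * w = 1) :
    D.IsCKFamily P (fun a => z • S a) (fun a => w • Sd a) := by
  have hwz : w * z = 1 := by rw [mul_comm, hzw]
  constructor
  · exact h.bot
  · exact h.inf
  · exact h.sup
  · intro a
    rw [smul_mul_smul_comm, smul_mul_smul_comm, hzw, one_mul, h.isometry_left]
  · intro a
    rw [smul_mul_smul_comm, smul_mul_smul_comm, hwz, one_mul, h.isometry_right]
  · intro a X
    rw [mul_smul_comm, h.comm_left, smul_mul_assoc]
  · intro a X
    rw [smul_mul_assoc, h.comm_right, mul_smul_comm]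
  · intro a
    rw [smul_mul_smul_comm, hwz, one_smul, h.source]
  · intro a b hab
    rw [smul_mul_smul_comm, h.orthogonal a b hab, smul_zero]
  · intro X hX F hF
    rw [h.regular X hX F hF]
    refine Finset.sum_congr rfl fun a _ => ?_
    rw [mul_smul_comm, smul_mul_assoc, smul_mul_assoc, smul_smul, hwz, one_smul]

end IsCKFamily

theorem monomial_smul {B : Type u} {𝕜 A : Type*} [CommRing 𝕜] [NonUnitalRing A] [Module 𝕜 A]
    [IsScalarTower 𝕜 A A] [SMulCommClass 𝕜 A A] (P : B → A) (S Sd : L → A) (z w : 𝕜)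
    (α β : List L) (X : B) :
    monomial P (fun a => z • S a) (fun a => w • Sd a) α X β =
      (z ^ α.length * w ^ β.length) • monomial P S Sd α X β := by
  have h1 : ∀ (α : List L) (x : A), word (fun a => z • S a) α x = z ^ α.length • word S α x := by
    intro α x
    induction α with
    | nil => simp [word]
    | cons a α ih =>
      change z • S a * word (fun a => z • S a) α x = _ • (S a * word S α x)
      rw [ih, smul_mul_smul_comm, List.length_cons, pow_succ']
  have h2 : ∀ (α : List L) (x : A),
      wordStar (fun a => w • Sd a) α x = w ^ α.length • wordStar Sd α x := by
    intro α x
    induction α with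
    | nil => simp [wordStar]
    | cons a α ih =>
      change wordStar (fun a => w • Sd a) α x * w • Sd a = _ • (wordStar Sd α x * Sd a)
      rw [ih, smul_mul_smul_comm, List.length_cons, pow_succ]
  have h3 : ∀ (α : List L) (c : 𝕜) (x : A), word S α (c • x) = c • word S α x := by
    intro α c x
    induction α with
    | nil => rfl
    | cons a α ih =>
      change S a * word S α (c • x) = c • (S a * word S α x)
      rw [ih, mul_smul_comm]
  rw [monomial, h1, h2, h3, smul_smul, monomial]

/-! ### The universal monomials -/

variable (D) in
/-- The element `s_α p_X s_β^*` of the universal C*-algebra. -/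
noncomputable def univMonomial (α : List L) (X : B) (β : List L) : D.UniversalCStarAlgebra :=
  monomial D.univP D.univS (fun a => star (D.univS a)) α X β

variable (D) in
theorem univ_isCKFamily : D.IsCKFamily D.univP D.univS (fun a => star (D.univS a)) :=
  D.univ_isCKRepresentation.family

theorem univP_eq_zero_iff {X : B} : D.univP X = 0 ↔ X = ⊥ :=
  ⟨fun h => by_contra fun h0 => D.univP_ne_zero h0 h, fun h => h ▸ D.univ_isCKFamily.bot⟩

theorem univP_injective : Function.Injective D.univP := by
  have key : ∀ X Y, D.univP X = D.univP Y → X ≤ Y := by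
    intro X Y h
    have h1 := D.univ_isCKFamily.P_sdiff X Y
    rw [D.univ_isCKFamily.inf, ← h, D.univ_isCKFamily.P_mul_self, left_eq_add,
      univP_eq_zero_iff] at h1
    exact sdiff_eq_bot_iff.1 h1
  exact fun X Y h => (key X Y h).antisymm (key Y X h.symm)

theorem univMonomial_eq_zero_iff {α β : List L} {X : B} (hα : D.Below α X) (hβ : D.Below β X) :
    D.univMonomial α X β = 0 ↔ X = ⊥ := by
  constructor
  · intro h
    have := D.univ_isCKFamily.compress α β X X hα hβ le_rfl
    change _ * D.univMonomial α X β * _ = _ at this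
    rw [h, mul_zero, zero_mul] at this
    exact univP_eq_zero_iff.1 this.symm
  · rintro rfl
    exact D.univ_isCKFamily.monomial_bot α β

theorem star_univMonomial (α β : List L) (X : B) :
    star (D.univMonomial α X β) = D.univMonomial β X α :=
  D.univ_isCKRepresentation.star_monomial α β X

theorem toRep_univMonomial (ρ : Representation D) (α β : List L) (X : B) :
    D.toRep ρ (D.univMonomial α X β) = monomial ρ.P ρ.S (fun a => star (ρ.S a)) α X β := by
  rw [univMonomial, map_monomial (D.toRep ρ) (map_mul _)]
  rfl

namespace Representation

/-- A representation twisted by a complex number of modulus one. -/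
noncomputable def gauge (ρ : Representation D) (z : ℂ) (hz : z * star z = 1) :
    Representation D where
  alg := ρ.alg
  P := ρ.P
  S a := z • ρ.S a
  isCK :=
    { projection := ρ.isCK.projection
      family := by
        simp only [star_smul]
        exact ρ.isCK.family.smul hz }

theorem monomial_gauge (ρ : Representation D) (z : ℂ) (hz : z * star z = 1) (α β : List L)
    (X : B) :
    monomial (ρ.gauge z hz).P (ρ.gauge z hz).S (fun a => star ((ρ.gauge z hz).S a)) α X β =
      (z ^ α.length * star z ^ β.length) • monomial ρ.P ρ.S (fun a => star (ρ.S a)) α X β := by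
  have h : (fun a => star ((ρ.gauge z hz).S a)) = fun a => star z • star (ρ.S a) :=
    funext fun a => star_smul z (ρ.S a)
  rw [h]
  exact monomial_smul ρ.P ρ.S _ z (star z) α β X

end Representation

/-- Equal nonzero monomials have the same degree. -/
theorem degree_eq {α β γ δ : List L} {X Y : B}
    (h : D.univMonomial α X β = D.univMonomial γ Y δ) (h0 : D.univMonomial α X β ≠ 0) :
    α.length + δ.length = γ.length + β.length := by
  have key : ∀ {α β γ δ : List L} {X Y : B}, D.univMonomial α X β = D.univMonomial γ Y δ →
      D.univMonomial α X β ≠ 0 → ¬ γ.length + β.length < α.length + δ.length := by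
    intro α β γ δ X Y h h0 hlt
    obtain ⟨n, hn⟩ := Nat.exists_eq_add_of_lt hlt
    -- The degrees differ by $n+1$, and $z$ is chosen with $z^{n+1}=-1$. Comparing the equation with
    -- its gauge twist then gives $m=-m$ in every representation.
    set z : ℂ := Complex.exp ((Real.pi / (n + 1) : ℝ) * Complex.I) with hzdef
    have hz : z * star z = 1 := by
      have : ‖z‖ = 1 := Complex.norm_exp_ofReal_mul_I _
      change z * (starRingEnd ℂ) z = 1
      rw [Complex.mul_conj, Complex.normSq_eq_norm_sq, this]
      norm_num
    have hzn : z ^ (n + 1) = -1 := by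
      rw [hzdef, ← Complex.exp_nat_mul, ← Complex.exp_pi_mul_I]
      congr 1
      have : (n + 1 : ℂ) ≠ 0 := by exact_mod_cast Nat.succ_ne_zero n
      push_cast
      field_simp
    refine h0 (D.univ_ext fun ρ => ?_)
    rw [map_zero]
    have h1 := congrArg (D.toRep ρ) h
    have h2 := congrArg (D.toRep (ρ.gauge z hz)) h
    rw [toRep_univMonomial, toRep_univMonomial] at h1 h2
    rw [ρ.monomial_gauge, ρ.monomial_gauge, ← h1] at h2
    rw [toRep_univMonomial]
    set m := monomial ρ.P ρ.S (fun a => star (ρ.S a)) α X β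
    replace h2 : (z ^ α.length * star z ^ β.length) • m =
      (z ^ γ.length * star z ^ δ.length) • m := h2
    -- Multiplication by this power of $z$ cancels the powers of $\bar z$, which is the inverse of
    -- $z$.
    have h3 : z ^ (β.length + δ.length) • (z ^ α.length * star z ^ β.length) • m =
      z ^ (β.length + δ.length) • (z ^ γ.length * star z ^ δ.length) • m := by rw [h2]
    have hpow : ∀ a b c : ℕ, z ^ (b + c) * (z ^ a * star z ^ b) = z ^ (a + c) := by
      intro a b c
      calc z ^ (b + c) * (z ^ a * star z ^ b) = z ^ (a + c) * (z * star z) ^ b := by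
            rw [mul_pow, pow_add, pow_add]; ring
        _ = _ := by rw [hz, one_pow, mul_one]
    rw [smul_smul, smul_smul, hpow, add_comm β.length, hpow, hn, add_assoc, pow_add, hzn,
      mul_neg_one, neg_smul, neg_eq_iff_add_eq_zero, ← two_smul ℂ, smul_smul] at h3
    refine (smul_eq_zero.1 h3).resolve_left (mul_ne_zero two_ne_zero (pow_ne_zero _ ?_))
    exact fun h => by simp [h] at hz
  have h1 := key h h0
  have h2 := key h.symm (h ▸ h0)
  omega

/-- An idempotent partial isometry equals its own $x^*x$, here $s_\beta p_Xs_\beta^*$, so the words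
have the same length by `degree_eq`. As the square is nonzero, one word is a prefix of the other. -/
theorem eq_of_idem {α β : List L} {X : B} (hα : D.Below α X) (hβ : D.Below β X)
    (hi : D.univMonomial α X β * D.univMonomial α X β = D.univMonomial α X β)
    (h0 : D.univMonomial α X β ≠ 0) : α = β := by
  have h1 := eq_star_mul_self
    (D.univ_isCKRepresentation.mul_star_mul (Or.inr ⟨α, X, β, hα, hβ, rfl⟩)) hi
  have h2 : D.univMonomial α X β = D.univMonomial β X β :=
    h1.trans (D.univ_isCKRepresentation.monomial_star_mul_self α β X hα)
  have hlen := degree_eq h2 h0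
  by_cases h3 : ∃ ε, α = β ++ ε
  · obtain ⟨ε, rfl⟩ := h3
    have : ε = [] := List.length_eq_zero_iff.1 (by rw [List.length_append] at hlen; omega)
    rw [this, List.append_nil]
  by_cases h4 : ∃ ε, β = α ++ ε
  · obtain ⟨ε, rfl⟩ := h4
    have : ε = [] := List.length_eq_zero_iff.1 (by rw [List.length_append] at hlen; omega)
    rw [this, List.append_nil]
  exact absurd (hi.symm.trans (D.univ_isCKFamily.monomial_mul_eq_zero α β α β X X hβ hα h3 h4)) h0

/-! ### Relations between monomials are the same in all Cuntz-Krieger families -/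

section transfer

variable {A : Type*} [NonUnitalRing A] {P : B → A} {S Sd : L → A}

/-- The hypothesis puts $p_X$ below the range projection $s_as_a^*$, hence also $p_Y$ for every
$Y\subseteq X$. -/
theorem univP_eq_of_le_range {a : L} {X : B} {m : D.UniversalCStarAlgebra}
    (hX : D.univP X = D.univS a * m * star (D.univS a)) {Y : B} (hYX : Y ≤ X) :
    D.univP Y = D.univS a * D.univP (D.θ a Y) * star (D.univS a) := by
  have h := D.univ_isCKFamily
  have h1 : D.univP X * (D.univS a * star (D.univS a)) = D.univP X := by
    conv_lhs => rw [hX, mul_assoc, ← mul_assoc (star _), h.isometry_right]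
    exact hX.symm
  calc D.univP Y = D.univP Y * D.univP X := by rw [← h.inf, inf_eq_left.2 hYX]
    _ = D.univP Y * D.univP X * (D.univS a * star (D.univS a)) := by rw [mul_assoc, h1]
    _ = D.univP Y * D.univS a * star (D.univS a) := by
      rw [← h.inf, inf_eq_left.2 hYX, mul_assoc]
    _ = _ := by rw [h.comm_left]

theorem univS_star_mul_univP_mul (a : L) (X : B) :
    star (D.univS a) * D.univP X * D.univS a = D.univP (D.θ a X) := by
  rw [D.univ_isCKFamily.comm_right, mul_assoc, D.univ_isCKFamily.source, ← D.univ_isCKFamily.inf,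
    inf_eq_left.2 (D.θ_le_rng a X)]

/-- For $b\ne a$, $p_{\theta_b(Y)}=s_b^*p_Ys_b$ vanishes by orthogonality of the ranges; and
$\theta_a(Y)=\emptyset$ would give $p_Y=0$. -/
theorem letters_eq_singleton {a : L} {X : B}
    (hX : ∀ Y ≤ X, D.univP Y = D.univS a * D.univP (D.θ a Y) * star (D.univS a)) {Y : B}
    (hY : Y ≠ ⊥) (hYX : Y ≤ X) : D.letters Y = {a} := by
  have h := D.univ_isCKFamily
  ext b
  rw [Set.mem_singleton_iff]
  constructor
  · intro hb
    by_contra hba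
    refine hb (univP_eq_zero_iff (D := D).1 ?_)
    rw [← univS_star_mul_univP_mul, hX Y hYX, ← mul_assoc, ← mul_assoc,
      h.orthogonal b a hba, zero_mul, zero_mul, zero_mul]
  · rintro rfl h0
    refine D.univP_ne_zero hY ?_
    rw [hX Y hYX, h0, h.bot, mul_zero, zero_mul]

/-- An equation in the C*-algebra becomes combinatorial: it forces $X$ to be regular, with
$\Delta_X=\{a\}$ unless $X=\emptyset$. The relation for regular sets then has a single summand in
every family. -/
theorem IsCKFamily.P_eq_of_univP_eq (h : D.IsCKFamily P S Sd) {a : L} {X : B}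
    {m : D.UniversalCStarAlgebra} (hX : D.univP X = D.univS a * m * star (D.univS a)) :
    P X = S a * P (D.θ a X) * Sd a := by
  by_cases h0 : X = ⊥
  · rw [h0, D.map_bot, h.bot, mul_zero, zero_mul]
  have hlet := fun Y (hY : Y ≠ ⊥) (hYX : Y ≤ X) =>
    letters_eq_singleton (fun Z hZ => univP_eq_of_le_range hX hZ) hY hYX
  rw [h.regular X (fun Y hY hYX => by rw [hlet Y hY hYX]; simp) {a}
    (by rw [hlet X h0 le_rfl]; simp), Finset.sum_singleton]

theorem monomial_cons_cons {B : Type u} {A : Type*} [NonUnitalRing A] (P : B → A) (S Sd : L → A)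
    (a : L) (α β : List L) (X : B) :
    monomial P S Sd (a :: α) X (a :: β) = S a * monomial P S Sd α X β * Sd a := by
  change S a * word S α (wordStar Sd β (P X) * Sd a) = _
  rw [← word_mul, ← mul_assoc]
  rfl

/-- The first letter is stripped by `IsCKFamily.P_eq_of_univP_eq`. Conjugating the hypothesis by
$s_a$ gives the same hypothesis for $\theta_a(X)$ and the shorter word. -/
theorem IsCKFamily.P_eq_monomial (h : D.IsCKFamily P S Sd) (ε : List L) {X Y : B}
    (hY : D.Below ε Y) (hX : D.univP X = D.univMonomial ε Y ε) :
    P X = monomial P S Sd ε Y ε := by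
  induction ε generalizing X with
  | nil =>
    rw [univP_injective (hX.trans rfl : D.univP X = D.univP Y)]
    rfl
  | cons a ε ih =>
    have hcons : D.univMonomial (a :: ε) Y (a :: ε) =
        D.univS a * D.univMonomial ε Y ε * star (D.univS a) := monomial_cons_cons _ _ _ a ε ε Y
    rw [hcons] at hX
    rw [h.P_eq_of_univP_eq hX, monomial_cons_cons, ih hY.of_cons]
    rw [← univS_star_mul_univP_mul, hX]
    have hu := D.univ_isCKFamily
    have hR : D.Below [] (D.rng [a]) := Below.nil _
    have h1 : D.univP (D.rng [a]) * D.univMonomial ε Y ε = D.univMonomial ε Y ε := by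
      have := hu.monomial_mul_append [] [] ε ε (D.rng [a]) Y hY.of_cons
      rw [inf_eq_right.2 hY.le_act] at this
      exact this
    have h2 : D.univMonomial ε Y ε * D.univP (D.rng [a]) = D.univMonomial ε Y ε := by
      have := hu.monomial_append_mul ε [] [] ε Y (D.rng [a]) hR
      rw [inf_eq_left.2 hY.le_act] at this
      exact this
    calc star (D.univS a) * (D.univS a * D.univMonomial ε Y ε * star (D.univS a)) * D.univS a =
          (star (D.univS a) * D.univS a) * D.univMonomial ε Y ε *
            (star (D.univS a) * D.univS a) := by
            simp only [mul_assoc]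
      _ = _ := by rw [hu.source, h1, h2]

theorem monomial_append {B : Type u} {A : Type*} [NonUnitalRing A] (P : B → A) (S Sd : L → A)
    (α β ε : List L) (X : B) :
    monomial P S Sd (α ++ ε) X (β ++ ε) = word S α (wordStar Sd β (monomial P S Sd ε X ε)) := by
  rw [monomial, monomial, word_append, wordStar_append, word_wordStar S Sd ε β]

theorem IsCKFamily.monomial_eq_append (h : D.IsCKFamily P S Sd) {α β ε : List L} {X Y : B}
    (hα : D.Below α X) (hβ : D.Below β X) (hα' : D.Below (α ++ ε) Y) (hβ' : D.Below (β ++ ε) Y)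
    (he : D.univMonomial α X β = D.univMonomial (α ++ ε) Y (β ++ ε)) :
    monomial P S Sd α X β = monomial P S Sd (α ++ ε) Y (β ++ ε) := by
  have hu := D.univ_isCKFamily
  -- The set that the compression of $s_{\alpha\varepsilon}p_Ys_{\beta\varepsilon}^*$ by $\alpha$
  -- and $\beta$ produces. It turns out to be $Y$ itself.
  set Y' := D.act ε X ⊓ Y ⊓ D.act ε X with hY'
  have hY'Y : Y' ≤ Y := inf_le_left.trans inf_le_right
  have h1 : D.univP X = D.univMonomial ε Y' ε := by
    have h2 := hu.compress α β X X hα hβ le_rfl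
    rw [show monomial _ _ _ α X β = _ from he] at h2
    rw [univMonomial, hu.monomial_mul_append [] α _ ε X Y hα',
      hu.monomial_append_mul _ β [] ε _ X hβ] at h2
    exact h2.symm
  have hbelow : D.Below ε Y' := (hα'.of_append).mono hY'Y
  have h3 := hu.P_eq_monomial ε hbelow h1
  have h4 : D.univMonomial (α ++ ε) Y' (β ++ ε) = D.univMonomial (α ++ ε) Y (β ++ ε) := by
    rw [← he, univMonomial, monomial_append, ← h3]
    rfl
  have h5 : Y' = Y := by
    have h6 := hu.compress (α ++ ε) (β ++ ε) Y' Y (hα'.mono hY'Y) hβ' hY'Y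
    rw [show monomial _ _ _ (α ++ ε) Y' (β ++ ε) = _ from h4, univMonomial,
      hu.compress _ _ Y Y hα' hβ' le_rfl] at h6
    exact univP_injective h6.symm
  rw [monomial_append, ← h5, ← h.P_eq_monomial ε hbelow h1]
  rfl

/-- Multiplying one side by the adjoint of the other gives a nonzero idempotent. So $\beta$ and
$\delta$ are comparable, and `eq_of_idem` shows that $\alpha$ and $\gamma$ differ by the same
suffix; this leaves `IsCKFamily.monomial_eq_append`. -/
theorem IsCKFamily.monomial_eq (h : D.IsCKFamily P S Sd) {α β γ δ : List L} {X Y : B}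
    (hα : D.Below α X) (hβ : D.Below β X) (hγ : D.Below γ Y) (hδ : D.Below δ Y)
    (he : D.univMonomial α X β = D.univMonomial γ Y δ) :
    monomial P S Sd α X β = monomial P S Sd γ Y δ := by
  have hu := D.univ_isCKFamily
  by_cases h0 : D.univMonomial α X β = 0
  · rw [(univMonomial_eq_zero_iff hα hβ).1 h0, (univMonomial_eq_zero_iff hγ hδ).1 (he ▸ h0),
      h.monomial_bot, h.monomial_bot]
  have hX : X ≠ ⊥ := fun hX => h0 ((univMonomial_eq_zero_iff hα hβ).2 hX)
  have h1 : D.univMonomial α X β * D.univMonomial δ Y γ = D.univMonomial α X α := by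
    rw [← star_univMonomial γ δ, ← he, star_univMonomial, univMonomial, univMonomial,
      hu.monomial_mul_same α β α X X hβ, inf_idem, univMonomial]
  have h2 : D.univMonomial α X α ≠ 0 := fun h => hX ((univMonomial_eq_zero_iff hα hα).1 h)
  have h3 : D.univMonomial α X α * D.univMonomial α X α = D.univMonomial α X α := by
    rw [univMonomial, hu.monomial_mul_same α α α X X hα, inf_idem]
  by_cases h4 : ∃ ε, δ = β ++ ε
  · obtain ⟨ε, rfl⟩ := h4
    rw [univMonomial, univMonomial, hu.monomial_mul_append α β γ ε X Y hδ] at h1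
    have h5 : α ++ ε = γ := by
      refine eq_of_idem (D := D) (X := D.act ε X ⊓ Y) ((hα.append ε).mono inf_le_left)
        (hγ.mono inf_le_right) ?_ ?_
      · rw [univMonomial, h1, h3]
      · rw [univMonomial, h1]
        exact h2
    subst h5
    exact h.monomial_eq_append hα hβ hγ hδ he
  by_cases h5 : ∃ ε, β = δ ++ ε
  · obtain ⟨ε, rfl⟩ := h5
    rw [univMonomial, univMonomial, hu.monomial_append_mul α δ γ ε X Y hδ] at h1
    have h5 : α = γ ++ ε := by
      refine eq_of_idem (D := D) (X := X ⊓ D.act ε Y) (hα.mono inf_le_left)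
        ((hγ.append ε).mono inf_le_right) ?_ ?_
      · rw [univMonomial, h1, h3]
      · rw [univMonomial, h1]
        exact h2
    subst h5
    exact (h.monomial_eq_append hγ hδ hα hβ he.symm).symm
  exact absurd (h1.symm.trans (hu.monomial_mul_eq_zero α β δ γ X Y hβ hδ h4 h5)) h2

end transfer

/-! ### The inverse semigroup `T` -/

namespace T

theorem val_mul (s t : D.T) : (s * t).1 = s.1 * t.1 := rfl

theorem exists_eq (t : D.T) : ∃ α X β, D.Below α X ∧ D.Below β X ∧ t.1 = D.univMonomial α X β := by
  rcases t.2 with h | h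
  · exact ⟨[], ⊥, [], Below.nil _, Below.nil _,
      h.trans (D.univ_isCKFamily.monomial_bot [] []).symm⟩
  · exact h

theorem exists_eq_of_idem {e : D.T} (he : e * e = e) :
    ∃ β X, D.Below β X ∧ e.1 = D.univMonomial β X β := by
  rcases D.univ_isCKRepresentation.idem_form e.2 (congrArg Subtype.val he) with h | h
  · exact ⟨[], ⊥, Below.nil _, h.trans (D.univ_isCKFamily.monomial_bot [] []).symm⟩
  · exact h

variable (D) in
-- The product $se=e$ is a nonzero idempotent monomial, so its two words agree by `eq_of_idem`.
-- Comparing them shows that the words of $s$ agree, and such a monomial is idempotent.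
theorem isEStarUnitary : IsEStarUnitary D.T := by
  intro s e he h0 hse
  have hu := D.univ_isCKFamily
  obtain ⟨α, X, β, hα, hβ, hs⟩ := exists_eq s
  obtain ⟨γ, Y, hγ, he'⟩ := exists_eq_of_idem he
  have h0' : e.1 ≠ 0 := fun h => h0 (Subtype.ext h)
  have hi : e.1 * e.1 = e.1 := congrArg Subtype.val he
  have h1 : D.univMonomial α X β * D.univMonomial γ Y γ = e.1 := by
    rw [← hs, ← he']
    exact congrArg Subtype.val hse
  suffices hαβ : α = β by
    subst hαβ
    refine Subtype.ext ?_
    rw [val_mul, hs, univMonomial, hu.monomial_mul_same α α α X X hα, inf_idem]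
  by_cases h4 : ∃ ε, γ = β ++ ε
  · obtain ⟨ε, rfl⟩ := h4
    rw [univMonomial, univMonomial, hu.monomial_mul_append α β _ ε X Y hγ] at h1
    have h5 : α ++ ε = β ++ ε := by
      refine eq_of_idem (D := D) (X := D.act ε X ⊓ Y) ((hα.append ε).mono inf_le_left)
        (hγ.mono inf_le_right) ?_ ?_
      · rw [univMonomial, h1, hi]
      · rw [univMonomial, h1]
        exact h0'
    exact List.append_cancel_right h5
  by_cases h5 : ∃ ε, β = γ ++ ε
  · obtain ⟨ε, rfl⟩ := h5
    rw [univMonomial, univMonomial, hu.monomial_append_mul α γ γ ε X Y hγ] at h1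
    refine eq_of_idem (D := D) (X := X ⊓ D.act ε Y) (hα.mono inf_le_left)
      ((hγ.append ε).mono inf_le_right) ?_ ?_
    · rw [univMonomial, h1, hi]
    · rw [univMonomial, h1]
      exact h0'
  exact absurd (h1.symm.trans (hu.monomial_mul_eq_zero α β γ γ X Y hβ hγ h4 h5)) h0'

variable {A : Type*}

/-- The map from `T` to a ring with a Cuntz-Krieger family that sends `s_α p_X s_β^*` to the
corresponding monomial. -/
noncomputable def lift [Mul A] (P : B → A) (S Sd : L → A) (t : D.T) : A :=
  monomial P S Sd (exists_eq t).choose (exists_eq t).choose_spec.choose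
    (exists_eq t).choose_spec.choose_spec.choose

variable [NonUnitalRing A] {P : B → A} {S Sd : L → A}

/-- Independence of the chosen presentation of `t`, by `IsCKFamily.monomial_eq`. -/
theorem lift_eq (h : D.IsCKFamily P S Sd) {t : D.T} {α β : List L} {X : B} (hα : D.Below α X)
    (hβ : D.Below β X) (ht : t.1 = D.univMonomial α X β) :
    lift P S Sd t = monomial P S Sd α X β := by
  obtain ⟨h1, h2, h3⟩ := (exists_eq t).choose_spec.choose_spec.choose_spec
  exact h.monomial_eq h1 h2 hα hβ (h3.symm.trans ht)

theorem lift_zero (h : D.IsCKFamily P S Sd) : lift P S Sd (0 : D.T) = 0 := by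
  rw [lift_eq h (Below.nil ⊥) (Below.nil ⊥) (D.univ_isCKFamily.monomial_bot [] []).symm,
    h.monomial_bot]

theorem lift_mul (h : D.IsCKFamily P S Sd) (s t : D.T) :
    lift P S Sd (s * t) = lift P S Sd s * lift P S Sd t := by
  have hu := D.univ_isCKFamily
  obtain ⟨α, X, β, hα, hβ, hs⟩ := exists_eq s
  obtain ⟨γ, Y, δ, hγ, hδ, ht⟩ := exists_eq t
  rw [lift_eq h hα hβ hs, lift_eq h hγ hδ ht]
  have hst : (s * t).1 = D.univMonomial α X β * D.univMonomial γ Y δ := by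
    rw [val_mul, hs, ht]
  by_cases h4 : ∃ ε, γ = β ++ ε
  · obtain ⟨ε, rfl⟩ := h4
    rw [univMonomial, univMonomial, hu.monomial_mul_append α β _ ε X Y hγ] at hst
    rw [h.monomial_mul_append α β _ ε X Y hγ]
    exact lift_eq h ((hα.append ε).mono inf_le_left) (hδ.mono inf_le_right) hst
  by_cases h5 : ∃ ε, β = γ ++ ε
  · obtain ⟨ε, rfl⟩ := h5
    rw [univMonomial, univMonomial, hu.monomial_append_mul α γ δ ε X Y hγ] at hst
    rw [h.monomial_append_mul α γ δ ε X Y hγ]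
    exact lift_eq h (hα.mono inf_le_left) ((hδ.append ε).mono inf_le_right) hst
  rw [univMonomial, univMonomial, hu.monomial_mul_eq_zero α β γ δ X Y hβ hγ h4 h5] at hst
  rw [h.monomial_mul_eq_zero α β γ δ X Y hβ hγ h4 h5, ← lift_zero h]
  exact congrArg _ (Subtype.ext hst)

end T

/-! ### Tightness -/

variable (D) in
/-- Every nonzero `s_{βγ} p_C s_{βγ}^* ≤ s_β p_X s_β^*` meets some `s_δ p_Y s_δ^*`, where
`(δ, Y) ∈ Z`. -/
def IsWordCover (β : List L) (X : B) (Z : Set (List L × B)) : Prop :=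
  ∀ (γ : List L) (C : B), C ≠ ⊥ → C ≤ D.act γ X → ∃ z ∈ Z,
    (∃ ε, β ++ γ = z.1 ++ ε ∧ C ⊓ D.act ε z.2 ≠ ⊥) ∨
      (∃ ε, z.1 = β ++ γ ++ ε ∧ D.act ε C ⊓ z.2 ≠ ⊥)

theorem IsWordCover.cons {β : List L} {X X' : B} {Z : Set (List L × B)}
    (h : D.IsWordCover β X Z) (hX : X' ≤ X) (a : L) : D.IsWordCover (β ++ [a]) (D.θ a X') Z := by
  intro γ C hC hCX
  have := h (a :: γ) C hC (hCX.trans (D.act_mono (a :: γ) hX))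
  simpa only [List.append_assoc, List.singleton_append] using this

theorem word_sum {A ι : Type*} [NonUnitalRing A] (S : L → A) (β : List L) (F : Finset ι)
    (f : ι → A) : word S β (∑ i ∈ F, f i) = ∑ i ∈ F, word S β (f i) := by
  induction β with
  | nil => rfl
  | cons b β ih =>
    change S b * word S β _ = ∑ i ∈ F, S b * word S β (f i)
    rw [ih, Finset.mul_sum]

theorem word_add {A : Type*} [NonUnitalRing A] (S : L → A) (β : List L) (x y : A) :
    word S β (x + y) = word S β x + word S β y := by
  induction β with
  | nil => rfl
  | cons b β ih =>
    change S b * word S β _ = S b * word S β x + S b * word S β y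
    rw [ih, mul_add]

section tight

variable {A : Type*} [NonUnitalRing A] {P : B → A} {S Sd : L → A}

/-- With the next lemma: the sets $X$ with $y\,s_\beta p_X=0$ are closed under subsets and finite
unions. -/
theorem IsCKFamily.mul_word_P_eq_zero_of_le (h : D.IsCKFamily P S Sd) {β : List L} {y : A}
    {X Y : B} (hY : y * word S β (P Y) = 0) (hXY : X ≤ Y) : y * word S β (P X) = 0 := by
  have : P X = P Y * P X := by rw [← h.inf, inf_eq_right.2 hXY]
  rw [this, ← word_mul, ← mul_assoc, hY, zero_mul]

theorem IsCKFamily.mul_word_P_sup_eq_zero (h : D.IsCKFamily P S Sd) {β : List L} {y : A}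
    {X Y : B} (hX : y * word S β (P X) = 0) (hY : y * word S β (P Y) = 0) :
    y * word S β (P (X ⊔ Y)) = 0 := by
  have h1 : P (X ⊔ Y) = P X + P (Y \ X) := by
    rw [h.P_sdiff (X ⊔ Y) X, inf_eq_right.2 le_sup_left, sup_sdiff_left_self]
  rw [h1, word_add, mul_add, hX, h.mul_word_P_eq_zero_of_le hY sdiff_le, add_zero]

theorem IsCKFamily.mul_word_P_act_eq_zero (h : D.IsCKFamily P S Sd) {β ε : List L} {y : A} {Y : B}
    (hY : y * word S β (P Y) = 0) : y * word S (β ++ ε) (P (D.act ε Y)) = 0 := by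
  rw [word_append, ← h.P_mul_self (D.act ε Y), ← h.mul_word, ← word_mul, ← mul_assoc, hY, zero_mul]

/-- After removal of what the words up to $\beta$ cover, only words of `Z` that properly extend
$\beta$ remain effective. There are finitely many next letters, and every nonempty piece has one, so
the remainder is regular. -/
theorem IsCKFamily.exists_regular_of_cover (h : D.IsCKFamily P S Sd) {Z : Set (List L × B)}
    (hZ : Z.Finite) {y : A} (hy : ∀ z ∈ Z, y * word S z.1 (P z.2) = 0) {β : List L} {X : B}
    (hc : D.IsWordCover β X Z) :
    ∃ X' ≤ X, D.IsRegular X' ∧ D.letters X' ⊆ {a | ∃ z ∈ Z, ∃ ε, z.1 = β ++ a :: ε} ∧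
      (y * word S β (P X') = 0 → y * word S β (P X) = 0) := by
  -- The union of the contributions of those members of `Z` whose word is a prefix of $\beta$; `y`
  -- already kills it.
  obtain ⟨W, hyW, hW⟩ : ∃ W, y * word S β (P W) = 0 ∧
      ∀ z ∈ Z, ∀ ε, β = z.1 ++ ε → D.act ε z.2 ≤ W := by
    clear hc
    induction Z, hZ using Set.Finite.induction_on with
    | empty => exact ⟨⊥, by rw [h.bot, word_zero, mul_zero], by simp⟩
    | @insert z Z _ _ ih =>
      obtain ⟨W, h1, h2⟩ := ih fun z hz => hy z (Or.inr hz)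
      by_cases hz : ∃ ε, β = z.1 ++ ε
      · obtain ⟨ε, rfl⟩ := hz
        refine ⟨W ⊔ D.act ε z.2, h.mul_word_P_sup_eq_zero h1
          (h.mul_word_P_act_eq_zero (hy z (Or.inl rfl))), ?_⟩
        rintro z' (rfl | hz') ε' he
        · rw [List.append_cancel_left he]
          exact le_sup_right
        · exact (h2 z' hz' ε' he).trans le_sup_left
      · refine ⟨W, h1, ?_⟩
        rintro z' (rfl | hz') ε' he
        · exact absurd ⟨ε', he⟩ hz
        · exact h2 z' hz' ε' he
  have hdis : ∀ C, C ≤ X \ W → ∀ z ∈ Z, ∀ ε, β = z.1 ++ ε → C ⊓ D.act ε z.2 = ⊥ := by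
    intro C hC z hz ε he
    refine le_bot_iff.1 ((inf_le_inf hC (hW z hz ε he)).trans ?_)
    rw [inf_comm, inf_sdiff_self_right]
  have hne : ∀ C, C ≠ ⊥ → C ≤ X \ W → (D.letters C).Nonempty := by
    intro C hC hCX
    obtain ⟨z, hz, ⟨ε, h1, h2⟩ | ⟨ε, h1, h2⟩⟩ := hc [] C hC (hCX.trans sdiff_le)
    · rw [List.append_nil] at h1
      exact absurd (hdis C hCX z hz ε h1) h2
    · rw [List.append_nil] at h1
      cases ε with
      | nil => exact absurd (hdis C hCX z hz [] (by simpa using h1.symm)) h2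
      | cons a ε =>
        refine ⟨a, fun h0 => h2 ?_⟩
        rw [act_cons, h0, act_bot, bot_inf_eq]
  have hlet : ∀ C, C ≤ X \ W → D.letters C ⊆ {a | ∃ z ∈ Z, ∃ ε, z.1 = β ++ a :: ε} := by
    intro C hCX b hb
    obtain ⟨z, hz, ⟨ε, h1, h2⟩ | ⟨ε, h1, h2⟩⟩ :=
      hc [b] (D.θ b C) hb (D.θ_mono b (hCX.trans sdiff_le))
    -- A prefix of $\beta b$ is $\beta b$ itself, which properly extends $\beta$, or a prefix of
    -- $\beta$, which is excluded off $W$.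
    · rcases List.eq_nil_or_concat ε with rfl | ⟨ε', b', rfl⟩
      · exact ⟨z, hz, [], by rw [h1, List.append_nil]⟩
      · rw [List.concat_eq_append, ← List.append_assoc] at h1
        obtain ⟨h3, h4⟩ := List.append_inj' h1 rfl
        rw [List.concat_eq_append, ← h4, act_append] at h2
        refine absurd ?_ h2
        change D.θ b C ⊓ D.θ b _ = ⊥
        rw [← D.map_inf, hdis C hCX z hz ε' h3, D.map_bot]
    · exact ⟨z, hz, ε, by rw [h1, List.append_assoc]; rfl⟩
  have hfin : {a | ∃ z ∈ Z, ∃ ε, z.1 = β ++ a :: ε}.Finite := by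
    refine Set.Finite.subset
      (Set.Finite.preimage (Option.some_injective L).injOn
        (hZ.image fun z => (z.1.drop β.length).head?)) ?_
    rintro a ⟨z, hz, ε, he⟩
    exact ⟨z, hz, by simp [he]⟩
  refine ⟨X \ W, sdiff_le, fun C hC hCX => ⟨hne C hC hCX, hfin.subset (hlet C hCX)⟩,
    hlet _ le_rfl, fun h0 => ?_⟩
  rw [h.P_sdiff X W, word_add, mul_add, h0, h.mul_word_P_eq_zero_of_le hyW inf_le_right, add_zero]

/-- Induction on `n`, a bound for the excess of the word lengths in `Z` over that of $\beta$. The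
regular remainder is expanded by its Cuntz–Krieger relation, which lengthens $\beta$ by a letter;
once no word of `Z` is longer, the remainder has no letters and is empty. -/
theorem IsCKFamily.mul_word_P_eq_zero_of_cover (h : D.IsCKFamily P S Sd) {Z : Set (List L × B)}
    (hZ : Z.Finite) {y : A} (hy : ∀ z ∈ Z, y * word S z.1 (P z.2) = 0) (n : ℕ) :
    ∀ (β : List L) (X : B), (∀ z ∈ Z, z.1.length ≤ β.length + n) → D.IsWordCover β X Z →
      y * word S β (P X) = 0 := by
  induction n with
  | zero =>
    intro β X hlen hc
    obtain ⟨X', -, hreg, hlet, h0⟩ := h.exists_regular_of_cover hZ hy hc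
    refine h0 ?_
    suffices hX' : X' = ⊥ by rw [hX', h.bot, word_zero, mul_zero]
    by_contra hX'
    obtain ⟨a, ha⟩ := (hreg X' hX' le_rfl).1
    obtain ⟨z, hz, ε, he⟩ := hlet ha
    have := hlen z hz
    rw [he, List.length_append, List.length_cons] at this
    omega
  | succ n ih =>
    intro β X hlen hc
    obtain ⟨X', hX'X, hreg, -, h0⟩ := h.exists_regular_of_cover hZ hy hc
    refine h0 ?_
    by_cases hX' : X' = ⊥
    · rw [hX', h.bot, word_zero, mul_zero]
    have hfin := (hreg X' hX' le_rfl).2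
    rw [h.regular X' hreg hfin.toFinset hfin.coe_toFinset, word_sum, Finset.mul_sum]
    refine Finset.sum_eq_zero fun a _ => ?_
    have h1 := ih (β ++ [a]) (D.θ a X')
      (fun z hz => by
        have := hlen z hz
        rw [List.length_append, List.length_singleton]
        omega)
      (hc.cons hX'X a)
    rw [← word_mul, ← mul_assoc]
    rw [word_append] at h1
    change y * word S β (S a * P (D.θ a X')) = 0 at h1
    rw [h1, zero_mul]

end tight

/-- The map from `T` to a ring with a Cuntz-Krieger family is a tight representation. -/
theorem T.isTightRepresentation_lift {A : Type*} [Ring A] {P : B → A} {S Sd : L → A}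
    (h : D.IsCKFamily P S Sd) : IsTightRepresentation (T.lift (D := D) P S Sd) where
  map_zero := T.lift_zero h
  map_mul := T.lift_mul h
  tight e he Z hZ hZi hc y hy := by
    have hu := D.univ_isCKFamily
    obtain ⟨β, X, hβ, he'⟩ := T.exists_eq_of_idem he
    choose! ζ V hζ hV using fun z hz => T.exists_eq_of_idem (hZi z hz)
    have hZ' := hZ.image fun z => (ζ z, V z)
    obtain ⟨N, hN⟩ := (hZ.image fun z => (ζ z).length).bddAbove
    have key : y * word S β (P X) = 0 := by
      refine h.mul_word_P_eq_zero_of_cover hZ' ?_ N β X ?_ ?_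
      · rintro _ ⟨z, hz, rfl⟩
        have h1 := hy z hz
        rw [T.lift_eq h (hζ z hz) (hζ z hz) (hV z hz)] at h1
        -- Multiplication by $s_\zeta p_V$ on the right removes the adjoint part of $s_\zeta
        -- p_Vs_\zeta^*$.
        have h2 := congrArg (· * monomial P S Sd (ζ z) (V z) []) h1
        simp only [zero_mul] at h2
        rwa [mul_assoc, h.monomial_mul_same _ _ _ _ _ (hζ z hz), inf_idem] at h2
      · rintro _ ⟨z, hz, rfl⟩
        exact (hN ⟨z, hz, rfl⟩).trans (Nat.le_add_left _ _)
      · intro γ C hC hCX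
        have hbC : D.Below (β ++ γ) C := (hβ.append γ).mono hCX
        -- A nonzero idempotent below $e$, to which the covering hypothesis applies; comparing words
        -- then yields the two cases of `IsWordCover`.
        let f : D.T := ⟨D.univMonomial (β ++ γ) C (β ++ γ), Or.inr ⟨_, _, _, hbC, hbC, rfl⟩⟩
        have hf : f * f = f := Subtype.ext (by
          rw [T.val_mul]
          exact (hu.monomial_mul_same _ _ _ _ _ hbC).trans (by rw [inf_idem]; rfl))
        have hfe : f * e = f := Subtype.ext (by
          rw [T.val_mul, he']
          exact (hu.monomial_append_mul _ β β γ C X hβ).trans (by rw [inf_eq_left.2 hCX]; rfl))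
        have hf0 : f ≠ 0 := fun h0 =>
          hC ((univMonomial_eq_zero_iff hbC hbC).1 (congrArg Subtype.val h0))
        obtain ⟨z, hz, hfz⟩ := hc f hf hfe hf0
        have hfz' : D.univMonomial (β ++ γ) C (β ++ γ) * D.univMonomial (ζ z) (V z) (ζ z) ≠ 0 := by
          intro h0
          refine hfz (Subtype.ext ?_)
          rw [T.val_mul, hV z hz]
          exact h0
        refine ⟨_, ⟨z, hz, rfl⟩, ?_⟩
        by_cases h4 : ∃ ε, ζ z = β ++ γ ++ ε
        · obtain ⟨ε, hε⟩ := h4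
          refine Or.inr ⟨ε, hε, fun h0 => hfz' ?_⟩
          have hz' := hζ z hz
          rw [hε] at hz' ⊢
          rw [univMonomial, univMonomial, hu.monomial_mul_append _ _ _ ε C _ hz', h0,
            hu.monomial_bot]
        by_cases h5 : ∃ ε, β ++ γ = ζ z ++ ε
        · obtain ⟨ε, hε⟩ := h5
          refine Or.inl ⟨ε, hε, fun h0 => hfz' ?_⟩
          rw [hε, univMonomial, univMonomial, hu.monomial_append_mul _ _ _ ε C _ (hζ z hz), h0,
            hu.monomial_bot]
        · exact absurd (hu.monomial_mul_eq_zero _ _ _ _ _ _ hbC (hζ z hz) h4 h5) hfz'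
    rw [T.lift_eq h hβ hβ he', monomial, word_wordStar, mul_wordStar, key, wordStar_zero]

end BooleanDynamicalSystem

/-! ### The isomorphism. -/

namespace BooleanDynamicalSystem

variable {B : Type u} {L : Type v} [GeneralizedBooleanAlgebra B] (D : BooleanDynamicalSystem B L)

open TightGroupoid

namespace T

theorem star_sT_mul_sT (a : L) : star (D.sT a) * D.sT a = D.pT (D.rng [a]) :=
  Subtype.ext (D.univ_isCKFamily.source a)

theorem pT_inf (X Y : B) : D.pT (X ⊓ Y) = D.pT X * D.pT Y :=
  Subtype.ext (D.univ_isCKFamily.inf X Y)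

theorem pT_bot : D.pT ⊥ = 0 := Subtype.ext D.univ_isCKFamily.bot

theorem pT_idem (X : B) : D.pT X * D.pT X = D.pT X := by rw [← pT_inf, inf_idem]

theorem eq_monomial {t : D.T} {α β : List L} {X : B} (ht : t.1 = D.univMonomial α X β) :
    t = monomial D.pT D.sT (fun a => star (D.sT a)) α X β :=
  Subtype.ext (ht.trans (map_monomial (A := D.T) (fun t : D.T => t.1) (fun _ _ => rfl)
    D.pT D.sT (fun a => star (D.sT a)) α β X).symm)

/-- The idempotent `s_a p_X s_a^*`. -/
noncomputable def qT (a : L) (X : B) : D.T := D.sT a * D.pT X * star (D.sT a)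

theorem qT_idem (a : L) (X : B) : qT D a X * qT D a X = qT D a X :=
  conj_idem_star (D.sT a) (pT_idem D X)

/-- Tightness enters through the cover $\{p_X,p_Y\}$ of $p_{X\cup Y}$: an idempotent below $p_{X\cup
Y}$ and orthogonal to both is 0 by the relation for unions. -/
theorem pT_mem_iff_of_sup (ξ : TightFilter D.T) (X Y : B) :
    D.pT (X ⊔ Y) ∈ ξ.carrier ↔ D.pT X ∈ ξ.carrier ∨ D.pT Y ∈ ξ.carrier := by
  have hu := D.univ_isCKFamily
  constructor
  · intro h
    obtain ⟨z, rfl | rfl, hz⟩ := ξ.exists_mem_of_cover h (Z := {D.pT X, D.pT Y}) (by simp)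
      (by rintro z (rfl | rfl) <;> exact pT_idem D _)
      (by
        intro f hf hfe hf0
        by_contra hcon
        push Not at hcon
        refine hf0 ?_
        have h1 : f.1 * D.univP X = 0 := congrArg Subtype.val (hcon _ (Or.inl rfl))
        have h2 : f.1 * D.univP Y = 0 := congrArg Subtype.val (hcon _ (Or.inr rfl))
        have h3 : f.1 * D.univP (X ⊔ Y) = f.1 := congrArg Subtype.val hfe
        refine Subtype.ext (h3.symm.trans ?_)
        rw [hu.sup, hu.inf, mul_sub, mul_add, h1, h2, ← mul_assoc, h1]
        simp
        rfl)
    · exact Or.inl hz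
    · exact Or.inr hz
  · have hle : ∀ {X Y : B}, X ≤ Y → D.pT X ∈ ξ.carrier → D.pT Y ∈ ξ.carrier := fun h hX =>
      ξ.upward _ hX _ (pT_idem D _) (by rw [← pT_inf, inf_eq_left.2 h])
    exact fun h => h.elim (hle le_sup_left) (hle le_sup_right)

/-- The relation for regular sets makes the idempotents $s_ap_{\theta_a(X)}s_a^*$ a finite cover of
$p_X$, which is then met by every tight filter. -/
theorem pT_mem_of_regular (ξ : TightFilter D.T) {X : B} (hX : D.IsRegular X) {F : Finset L}
    (hF : (F : Set L) = D.letters X) :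
    D.pT X ∈ ξ.carrier ↔ ∃ a ∈ F, qT D a (D.θ a X) ∈ ξ.carrier := by
  have hu := D.univ_isCKFamily
  constructor
  · intro h
    obtain ⟨_, ⟨a, ha, rfl⟩, hz⟩ := ξ.exists_mem_of_cover h
      (Z := (fun a => qT D a (D.θ a X)) '' F) (F.finite_toSet.image _)
      (by rintro _ ⟨a, -, rfl⟩; exact qT_idem D a _)
      (by
        intro f hf hfe hf0
        by_contra hcon
        push Not at hcon
        refine hf0 ?_
        have h3 : f.1 * D.univP X = f.1 := congrArg Subtype.val hfe
        refine Subtype.ext (h3.symm.trans ?_)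
        rw [hu.regular X hX F hF, Finset.mul_sum]
        exact Finset.sum_eq_zero fun a ha => congrArg Subtype.val (hcon _ ⟨a, ha, rfl⟩))
    exact ⟨a, ha, hz⟩
  · rintro ⟨a, ha, h⟩
    refine ξ.upward _ h _ (pT_idem D X) (Subtype.ext ?_)
    change D.univS a * D.univP (D.θ a X) * star (D.univS a) * D.univP X =
      D.univS a * D.univP (D.θ a X) * star (D.univS a)
    rw [mul_assoc, hu.comm_right, ← mul_assoc, mul_assoc (D.univS a), hu.P_mul_self]

theorem qT_mul_eq_zero {a b : L} (hab : a ≠ b) (X Y : B) : qT D a X * qT D b Y = 0 := by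
  have hu := D.univ_isCKFamily
  refine Subtype.ext ?_
  change D.univS a * D.univP X * star (D.univS a) * (D.univS b * D.univP Y * star (D.univS b)) = 0
  calc _ = D.univS a * D.univP X * (star (D.univS a) * D.univS b) * D.univP Y *
        star (D.univS b) := by simp only [mul_assoc]
    _ = 0 := by rw [hu.orthogonal a b hab, mul_zero, zero_mul, zero_mul]

end T

variable (R : Type w) [CommRing R]

/-- The multiplicative relations already hold in $T$. The two additive ones compare multiplications
by characteristic functions, and so reduce to membership in a tight filter. -/
theorem leftRegular_isCKFamily : D.IsCKFamily (fun X => leftRegular R (D.pT X))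
    (fun a => leftRegular R (D.sT a)) (fun a => leftRegular R (star (D.sT a))) := by
  classical
  have hu := D.univ_isCKFamily
  constructor
  · rw [T.pT_bot, leftRegular_zero]
  · intro X Y
    rw [T.pT_inf, leftRegular_mul]
  · intro X Y
    refine LinearMap.ext fun g => funext fun c => ?_
    change translate _ g c = translate _ g c + translate _ g c - translate _ g c
    rw [translate_idem (T.pT_idem D _), translate_idem (T.pT_idem D _),
      translate_idem (T.pT_idem D _), translate_idem (T.pT_idem D _), T.pT_inf,
      TightFilter.mul_mem_iff _ (T.pT_idem D _) (T.pT_idem D _), T.pT_mem_iff_of_sup]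
    by_cases h1 : D.pT X ∈ (range c).carrier <;> by_cases h2 : D.pT Y ∈ (range c).carrier <;>
      simp [h1, h2]
  · intro a
    rw [← leftRegular_mul, ← leftRegular_mul, mul_star_mul]
  · intro a
    rw [← leftRegular_mul, ← leftRegular_mul, star_mul_self_mul_star]
  · intro a X
    rw [← leftRegular_mul, ← leftRegular_mul]
    exact congrArg _ (Subtype.ext (hu.comm_left a X))
  · intro a X
    rw [← leftRegular_mul, ← leftRegular_mul]
    exact congrArg _ (Subtype.ext (hu.comm_right a X))
  · intro a
    rw [← leftRegular_mul, T.star_sT_mul_sT]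
  · intro a b hab
    rw [← leftRegular_mul, ← leftRegular_zero]
    exact congrArg _ (Subtype.ext (hu.orthogonal a b hab))
  · intro X hX F hF
    have hq : ∀ a, leftRegular R (D.sT a) * leftRegular R (D.pT (D.θ a X)) *
        leftRegular R (star (D.sT a)) = leftRegular R (T.qT D a (D.θ a X)) := fun a => by
      rw [← leftRegular_mul, ← leftRegular_mul, T.qT]
    simp only [hq]
    refine LinearMap.ext fun g => funext fun c => ?_
    rw [LinearMap.sum_apply, Finset.sum_apply]
    simp only [leftRegular_apply, translate_idem (T.qT_idem D _ _), translate_idem (T.pT_idem D _)]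
    rw [T.pT_mem_of_regular D _ hX hF]
    by_cases h : ∃ a ∈ F, T.qT D a (D.θ a X) ∈ (range c).carrier
    · rw [if_pos h]
      obtain ⟨a, ha, hm⟩ := h
      -- The idempotents for different letters are orthogonal, so a filter contains at most one of
      -- them.
      rw [Finset.sum_eq_single a, if_pos hm]
      · intro b _ hba
        rw [if_neg]
        intro hm'
        have := (range c).mul_mem _ hm' _ hm
        rw [T.qT_mul_eq_zero D hba] at this
        exact (range c).zero_notMem this
      · exact fun h => absurd ha h
    · rw [if_neg h, Finset.sum_eq_zero]
      intro a ha
      rw [if_neg]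
      exact fun hm => h ⟨a, ha, hm⟩

/-- The representation of `R(B, L, θ)` on the functions on the tight groupoid of `T`. -/
noncomputable def regularRepresentation : D.alg R →ₙₐ[R] Module.End R (TightGroupoid D.T → R) :=
  (D.existsUnique_lift R (D.leftRegular_isCKFamily R)).choose

theorem regularRepresentation_pR (X : B) :
    D.regularRepresentation R (D.pR R X) = leftRegular R (D.pT X) :=
  (D.existsUnique_lift R (D.leftRegular_isCKFamily R)).choose_spec.1.1 X

theorem regularRepresentation_sR (a : L) :
    D.regularRepresentation R (D.sR R a) = leftRegular R (D.sT a) :=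
  (D.existsUnique_lift R (D.leftRegular_isCKFamily R)).choose_spec.1.2.1 a

theorem regularRepresentation_sdR (a : L) :
    D.regularRepresentation R (D.sdR R a) = leftRegular R (star (D.sT a)) :=
  (D.existsUnique_lift R (D.leftRegular_isCKFamily R)).choose_spec.1.2.2 a

/-- The canonical map from `T` to `R(B, L, θ)`. -/
noncomputable def ofT (t : D.T) : D.alg R := T.lift (D.pR R) (D.sR R) (D.sdR R) t

theorem ofT_mul (s t : D.T) : D.ofT R (s * t) = D.ofT R s * D.ofT R t :=
  T.lift_mul (D.alg_isCKFamily R) s t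

/-- Both sides are multiplicative and agree on generators, and every element of $T$ is a monomial in
the generators. -/
theorem regularRepresentation_ofT (t : D.T) :
    D.regularRepresentation R (D.ofT R t) = leftRegular R t := by
  obtain ⟨α, X, β, hα, hβ, ht⟩ := T.exists_eq t
  rw [ofT, T.lift_eq (D.alg_isCKFamily R) hα hβ ht,
    map_monomial (D.regularRepresentation R) (map_mul _)]
  simp only [regularRepresentation_pR, regularRepresentation_sR, regularRepresentation_sdR]
  conv_rhs => rw [T.eq_monomial D ht]
  exact (map_monomial (leftRegular R) leftRegular_mul D.pT D.sT _ α β X).symm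

theorem ofT_pT (X : B) : D.ofT R (D.pT X) = D.pR R X :=
  T.lift_eq (D.alg_isCKFamily R) (Below.nil X) (Below.nil X) rfl

theorem ofT_sT (a : L) : D.ofT R (D.sT a) = D.sR R a := by
  have h : ∀ {A : Type _} [NonUnitalRing A] {P : B → A} {S Sd : L → A}, D.IsCKFamily P S Sd →
      S a = monomial P S Sd [a] (D.rng [a]) [] := by
    intro A _ P S Sd h
    change S a = S a * P (D.rng [a])
    rw [← h.source, ← mul_assoc, h.isometry_left]
  have h' : (D.sT a).1 = D.univMonomial [a] (D.rng [a]) [] := by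
    change D.univS a = D.univS a * D.univP (D.rng [a])
    rw [← D.univ_isCKFamily.source, ← mul_assoc, D.univ_isCKFamily.isometry_left]
  rw [ofT, T.lift_eq (D.alg_isCKFamily R) (fun _ => le_rfl) (Below.nil _) h']
  exact (h (D.alg_isCKFamily R)).symm

theorem ofT_star_sT (a : L) : D.ofT R (star (D.sT a)) = D.sdR R a := by
  have h' : (star (D.sT a)).1 = D.univMonomial [] (D.rng [a]) [a] := by
    change star (D.univS a) = D.univP (D.rng [a]) * star (D.univS a)
    rw [← D.univ_isCKFamily.source, D.univ_isCKFamily.isometry_right]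
  rw [ofT, T.lift_eq (D.alg_isCKFamily R) (Below.nil _) (fun _ => le_rfl) h']
  change D.pR R (D.rng [a]) * D.sdR R a = _
  rw [← (D.alg_isCKFamily R).source, (D.alg_isCKFamily R).isometry_right]

/-- An induction principle for `R(B, L, θ)`. -/
theorem alg_induction {p : D.alg R → Prop} (hp : ∀ X, p (D.pR R X)) (hs : ∀ a, p (D.sR R a))
    (hsd : ∀ a, p (D.sdR R a)) (hadd : ∀ x y, p x → p y → p (x + y)) (hzero : p 0)
    (hmul : ∀ x y, p x → p y → p (x * y)) (hsmul : ∀ (r : R) x, p x → p (r • x)) (x : D.alg R) :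
    p x := by
  obtain ⟨x, hx⟩ := x
  refine NonUnitalAlgebra.adjoin_induction (R := R) (p := fun x hx => p ⟨x, hx⟩) ?_ ?_ ?_ ?_ ?_ hx
  · rintro _ ⟨g, rfl⟩
    cases g with
    | p X => exact hp X
    | s a => exact hs a
    | sd a => exact hsd a
  · exact fun x y hx hy => hadd ⟨x, hx⟩ ⟨y, hy⟩
  · exact hzero
  · exact fun x y hx hy => hmul ⟨x, hx⟩ ⟨y, hy⟩
  · exact fun r x hx => hsmul r ⟨x, hx⟩

theorem span_range_ofT : Submodule.span R (Set.range (D.ofT R)) = ⊤ := by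
  refine Submodule.eq_top_iff'.2 fun x => ?_
  refine D.alg_induction R (p := fun x => x ∈ Submodule.span R (Set.range (D.ofT R)))
    (fun X => Submodule.subset_span ⟨_, D.ofT_pT R X⟩)
    (fun a => Submodule.subset_span ⟨_, D.ofT_sT R a⟩)
    (fun a => Submodule.subset_span ⟨_, D.ofT_star_sT R a⟩)
    (fun x y => add_mem) (zero_mem _) (fun x y hx hy => ?_)
    (fun r x => Submodule.smul_mem _ r) x
  refine Submodule.span_induction ?_ ?_ ?_ ?_ hx
  · rintro _ ⟨s, rfl⟩
    refine Submodule.span_induction ?_ ?_ ?_ ?_ hy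
    · rintro _ ⟨t, rfl⟩
      exact Submodule.subset_span ⟨s * t, D.ofT_mul R s t⟩
    · rw [mul_zero]; exact zero_mem _
    · intro a b _ _ h1 h2
      rw [mul_add]; exact add_mem h1 h2
    · intro r a _ h1
      rw [mul_smul_comm]; exact Submodule.smul_mem _ r h1
  · rw [zero_mul]; exact zero_mem _
  · intro a b _ _ h1 h2
    rw [add_mul]; exact add_mem h1 h2
  · intro r a _ h1
    rw [smul_mul_assoc]; exact Submodule.smul_mem _ r h1

/-- The map from `R(B, L, θ)` to the functions on the tight groupoid of `T`. -/
noncomputable def toFunction : D.alg R →ₗ[R] (TightGroupoid D.T → R) where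
  toFun x := D.regularRepresentation R x ((units D.T).indicator 1)
  map_add' x y := by rw [map_add]; rfl
  map_smul' r x := by rw [map_smul]; rfl

theorem toFunction_ofT (t : D.T) : D.toFunction R (D.ofT R t) = (bisection t).indicator 1 := by
  change D.regularRepresentation R _ _ = _
  rw [regularRepresentation_ofT, leftRegular_indicator_units]

/-- The image of $T$ spans $R(\mathcal B,\mathcal L,\theta)$, and the characteristic functions of
the bisections span the Steinberg algebra. -/
theorem range_toFunction : LinearMap.range (D.toFunction R) = SteinbergAlgebra R D.T := by
  rw [← bisectionSpan_eq_steinbergAlgebra (T.isEStarUnitary D), LinearMap.range_eq_map,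
    ← D.span_range_ofT R, Submodule.map_span, ← Set.range_comp, bisectionSpan]
  congr 2
  funext t
  exact D.toFunction_ofT R t

theorem toFunction_mem (x : D.alg R) : D.toFunction R x ∈ SteinbergAlgebra R D.T :=
  D.range_toFunction R ▸ ⟨x, rfl⟩

theorem toFunction_mul (x y : D.alg R) :
    D.toFunction R (x * y) = convolution (D.toFunction R x) (D.toFunction R y) := by
  -- The element $x$ acts on every function as convolution by its own function. Applied to the
  -- function of $y$, this is multiplicativity.
  have key : ∀ x : D.alg R, ∀ g,
      D.regularRepresentation R x g = convolution (D.toFunction R x) g := by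
    intro x g
    have hx : x ∈ Submodule.span R (Set.range (D.ofT R)) := by
      rw [D.span_range_ofT R]
      exact Submodule.mem_top
    have hmem : ∀ x, D.toFunction R x ∈ bisectionSpan D.T R := fun x => by
      rw [bisectionSpan_eq_steinbergAlgebra (T.isEStarUnitary D)]
      exact D.toFunction_mem R x
    refine Submodule.span_induction ?_ ?_ ?_ ?_ hx
    · rintro _ ⟨t, rfl⟩
      rw [toFunction_ofT, convolution_indicator_bisection, regularRepresentation_ofT]
    · rw [map_zero, map_zero, convolution_zero_left]
      rfl
    · intro x y _ _ h1 h2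
      rw [map_add, map_add, convolution_add_left (hmem x) (hmem y), ← h1, ← h2]
      rfl
    · intro r x _ h1
      rw [map_smul, map_smul, convolution_smul_left (hmem x), ← h1]
      rfl
  rw [← key]
  change D.regularRepresentation R (x * y) _ = _
  rw [map_mul]
  rfl

/-- The target is the unital `RingQuot`, since tight representations are defined with a unit so that
$1-\pi(z)$ makes sense. -/
theorem isTightRepresentation_ofT :
    IsTightRepresentation fun t : D.T => (D.ofT R t : RingQuot (D.Rel R)) := by
  have h : D.IsCKFamily (fun X => (D.pR R X : RingQuot (D.Rel R)))
      (fun a => (D.sR R a : RingQuot (D.Rel R))) (fun a => (D.sdR R a : RingQuot (D.Rel R))) := by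
    have h := D.alg_isCKFamily R
    exact
      { bot := congrArg Subtype.val h.bot
        inf := fun X Y => congrArg Subtype.val (h.inf X Y)
        sup := fun X Y => congrArg Subtype.val (h.sup X Y)
        isometry_left := fun a => congrArg Subtype.val (h.isometry_left a)
        isometry_right := fun a => congrArg Subtype.val (h.isometry_right a)
        comm_left := fun a X => congrArg Subtype.val (h.comm_left a X)
        comm_right := fun a X => congrArg Subtype.val (h.comm_right a X)
        source := fun a => congrArg Subtype.val (h.source a)
        orthogonal := fun a b hab => congrArg Subtype.val (h.orthogonal a b hab)
        regular := fun X hX F hF => (congrArg Subtype.val (h.regular X hX F hF)).trans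
          (map_sum (NonUnitalSubalgebraClass.subtype (D.alg R)) _ F) }
  have h2 : (fun t : D.T => (D.ofT R t : RingQuot (D.Rel R))) = T.lift
      (fun X => (D.pR R X : RingQuot (D.Rel R)))
      (fun a => (D.sR R a : RingQuot (D.Rel R))) (fun a => (D.sdR R a : RingQuot (D.Rel R))) :=
    funext fun t => map_monomial (fun x : D.alg R => (x : RingQuot (D.Rel R))) (fun _ _ => rfl)
      _ _ _ _ _ _
  rw [h2]
  exact T.isTightRepresentation_lift h

/-- An element is a combination of images of elements of $T$; if its function vanishes, tightness of
`ofT` makes the combination itself vanish. -/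
theorem toFunction_injective : Function.Injective (D.toFunction R) := by
  rw [injective_iff_map_eq_zero]
  intro x hx
  have hmem : x ∈ Submodule.span R (Set.range (D.ofT R)) := by
    rw [D.span_range_ofT R]
    exact Submodule.mem_top
  obtain ⟨c, rfl⟩ := Finsupp.mem_span_range_iff_exists_finsupp.1 hmem
  have h1 := (D.isTightRepresentation_ofT R).sum_eq_zero c (by
    rw [Finsupp.sum, map_sum] at hx
    refine Eq.trans ?_ hx
    refine Finset.sum_congr rfl fun t _ => ?_
    rw [map_smul, toFunction_ofT])
  refine Subtype.ext (Eq.trans ?_ h1)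
  exact map_sum (NonUnitalSubalgebraClass.subtype (D.alg R)) _ _

/-- The isomorphism from `R(B, L, θ)` to the Steinberg algebra. -/
noncomputable def toSteinbergAlgebra : D.alg R ≃ₗ[R] SteinbergAlgebra R D.T :=
  LinearEquiv.ofBijective ((D.toFunction R).codRestrict _ (D.toFunction_mem R))
    ⟨fun _ _ h => D.toFunction_injective R (congrArg Subtype.val h), fun f => by
      obtain ⟨x, hx⟩ := LinearMap.mem_range.1 ((D.range_toFunction R).symm.le f.2)
      exact ⟨x, Subtype.ext hx⟩⟩

theorem coe_toSteinbergAlgebra (x : D.alg R) :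
    (D.toSteinbergAlgebra R x : TightGroupoid D.T → R) = D.toFunction R x := rfl

theorem coe_toSteinbergAlgebra_pR (X : B) :
    (D.toSteinbergAlgebra R (D.pR R X) : TightGroupoid D.T → R) =
      (Θ (D.pT X) (TightFilter.dom (D.pT X))).indicator 1 := by
  rw [coe_toSteinbergAlgebra, ← ofT_pT, toFunction_ofT, bisection,
    idem_star_eq (T.pT_idem D X), T.pT_idem]

theorem coe_toSteinbergAlgebra_sR (a : L) :
    (D.toSteinbergAlgebra R (D.sR R a) : TightGroupoid D.T → R) =
      (Θ (D.sT a) (TightFilter.dom (star (D.sT a) * D.sT a))).indicator 1 := by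
  rw [coe_toSteinbergAlgebra, ← ofT_sT, toFunction_ofT, bisection]

theorem coe_toSteinbergAlgebra_sdR (a : L) :
    (D.toSteinbergAlgebra R (D.sdR R a) : TightGroupoid D.T → R) =
      (Θ (star (D.sT a)) (TightFilter.dom (D.sT a * star (D.sT a)))).indicator 1 := by
  rw [coe_toSteinbergAlgebra, ← ofT_star_sT, toFunction_ofT, bisection, star_star]

end BooleanDynamicalSystem

theorem theorem7p1 {B : Type u} {L : Type v} [GeneralizedBooleanAlgebra B]
    (D : BooleanDynamicalSystem B L) (R : Type w) [CommRing R] :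
    ∃! τ : SteinbergAlgebra R D.T ≃ₗ[R] D.alg R,
      (∀ f g : SteinbergAlgebra R D.T, ∃ h : SteinbergAlgebra R D.T,
        (h : TightGroupoid D.T → R) = convolution (f : TightGroupoid D.T → R) g ∧
          τ h = τ f * τ g) ∧
      (∀ a : L, ∃ f : SteinbergAlgebra R D.T,
        (f : TightGroupoid D.T → R) = Set.indicator
          (TightGroupoid.Θ (D.sT a) (TightFilter.dom (star (D.sT a) * D.sT a))) 1 ∧
          τ f = D.sR R a) ∧
      (∀ a : L, ∃ f : SteinbergAlgebra R D.T,
        (f : TightGroupoid D.T → R) = Set.indicator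
          (TightGroupoid.Θ (star (D.sT a)) (TightFilter.dom (D.sT a * star (D.sT a)))) 1 ∧
          τ f = D.sdR R a) ∧
      (∀ X : B, ∃ f : SteinbergAlgebra R D.T,
        (f : TightGroupoid D.T → R) = Set.indicator
          (TightGroupoid.Θ (D.pT X) (TightFilter.dom (D.pT X))) 1 ∧
          τ f = D.pR R X) := by
  set Φ := D.toSteinbergAlgebra R with hΦ
  have hmul : ∀ x y, (Φ (x * y) : TightGroupoid D.T → R) = convolution (Φ x) (Φ y) :=
    D.toFunction_mul R
  refine ⟨Φ.symm, ⟨fun f g => ⟨Φ (Φ.symm f * Φ.symm g), ?_, Φ.symm_apply_apply _⟩,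
    fun a => ⟨_, D.coe_toSteinbergAlgebra_sR R a, Φ.symm_apply_apply _⟩,
    fun a => ⟨_, D.coe_toSteinbergAlgebra_sdR R a, Φ.symm_apply_apply _⟩,
    fun X => ⟨_, D.coe_toSteinbergAlgebra_pR R X, Φ.symm_apply_apply _⟩⟩, ?_⟩
  · rw [hmul, Φ.apply_symm_apply, Φ.apply_symm_apply]
  · rintro τ ⟨h1, h2, h3, h4⟩
    -- By the multiplicativity of $\tau$, the elements that satisfy this form a subalgebra, and the
    -- prescribed values put the generators into it.
    have key : ∀ x, τ (Φ x) = x := by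
      refine D.alg_induction R ?_ ?_ ?_ ?_ ?_ ?_ ?_
      · intro X
        obtain ⟨f, hf, hτ⟩ := h4 X
        exact (congrArg τ (Subtype.ext ((D.coe_toSteinbergAlgebra_pR R X).trans hf.symm))).trans hτ
      · intro a
        obtain ⟨f, hf, hτ⟩ := h2 a
        exact (congrArg τ (Subtype.ext ((D.coe_toSteinbergAlgebra_sR R a).trans hf.symm))).trans hτ
      · intro a
        obtain ⟨f, hf, hτ⟩ := h3 a
        exact (congrArg τ (Subtype.ext ((D.coe_toSteinbergAlgebra_sdR R a).trans hf.symm))).trans hτ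
      · intro x y hx hy
        rw [map_add, map_add, hx, hy]
      · rw [map_zero, map_zero]
      · intro x y hx hy
        obtain ⟨h, hh, hτ⟩ := h1 (Φ x) (Φ y)
        have : Φ (x * y) = h := Subtype.ext ((hmul x y).trans hh.symm)
        rw [this, hτ, hx, hy]
      · intro r x hx
        rw [map_smul, map_smul, hx]
    refine LinearEquiv.ext fun f => ?_
    obtain ⟨x, rfl⟩ := Φ.surjective f
    rw [key, Φ.symm_apply_apply]
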